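/- Let $n\ge 2$, let $\mathbb T^n=\mathbb R^n/\Gamma$ be a torus ($\Gamma\subset\mathbb R^n$ a full-rank lattice), let $I\subset\mathbb R$ be an open interval, and let $2/3<\alpha<1$. Let $v:I\times\mathbb T^n\to\mathbb R^n$ be measurable and $p:I\times\mathbb T^n\to\mathbb R$ be locally integrable, and suppose that $(v,p)$ solves the incompressible Euler equations $$\partial_t v+\operatorname{div}(v\otimes v)+\nabla p=0,\qquad \operatorname{div} v=0$$ in the sense of distributions on $I\times\mathbb T^n$, that $$\|v\|_{C_tC_x^\alpha}=\sup_{t\in I}\|v(t,\cdot)\|_{C^\alpha}<\infty,$$ where $\|f\|_{C^\alpha}=\sup_x|f(x)|+\sup_{x\ne y}\frac{|f(x)-f(y)|}{|x-y|^\alpha}$, and that $\int_{\mathbb T^n}p(t,x)\,dx=0$ for almost every $t\in I$. For a locally integrable function $f$ on $I\times\mathbb T^n$ write $D_tf=\partial_tf+\operatorname{div}(v\otimes f)=\partial_t f+\sum_j\partial_j(v^jf)$ (a distribution). Then the distribution $\nabla p=-D_tv$ is a continuous function on $I\times\mathbb T^n$, so that $$D_t\nabla p=\partial_t\nabla p+\operatorname{div}(v\otimes\nabla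 p)=-D_t^2v$$ is well defined as a distribution on $I\times\mathbb T^n$; and this distribution is again a continuous function on $I\times\mathbb T^n$. -/

import Mathlib

open MeasureTheory TopologicalSpace Set
open scoped NNReal ENNReal Distributions LineDeriv

noncomputable section

namespace EulerFlow

/-- The Euclidean space `ℝⁿ` of positions. -/
abbrev Space (n : ℕ) : Type := EuclideanSpace ℝ (Fin n)

/-- Points `(t, x)` of space-time `ℝ × ℝⁿ`. -/
abbrev SpaceTime (n : ℕ) : Type := ℝ × Space n

/-- The open set `I × ℝⁿ`. Objects on `I × 𝕋ⁿ`, where `𝕋ⁿ = ℝⁿ / Γ`, are regarded as objects on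
`I × ℝⁿ` that are `Γ`-periodic in the space variable. -/
def slab (n : ℕ) (I : Opens ℝ) : Opens (SpaceTime n) :=
  ⟨(I : Set ℝ) ×ˢ (univ : Set (Space n)), I.isOpen.prod isOpen_univ⟩

/-- `f : I × ℝⁿ → F` is periodic in space with respect to the lattice `Γ = ⨁ᵢ ℤ bᵢ` generated by
the basis `b` of `ℝⁿ`, i.e. it is a function on `I × ℝⁿ / Γ`. -/
def IsPeriodic {n : ℕ} {F : Type*} (b : Module.Basis (Fin n) ℝ (Space n)) (I : Opens ℝ)
    (f : SpaceTime n → F) : Prop :=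
  ∀ t ∈ I, ∀ x : Space n, ∀ γ ∈ Submodule.span ℤ (range b), f (t, x + γ) = f (t, x)

/-- The Hölder norm `‖f‖_{C^α} = sup |f| + [f]_α`, with values in `[0, ∞]`. -/
def holderNorm {n : ℕ} (α : ℝ≥0) (f : Space n → Space n) : ℝ≥0∞ :=
  (⨆ x, ‖f x‖ₑ) + eHolderNorm α f

/-- The norm `‖v‖_{C_t C_x^α} = sup_{t ∈ I} ‖v(t, ·)‖_{C^α}`, with values in `[0, ∞]`. -/
def timeHolderNorm {n : ℕ} (I : Opens ℝ) (α : ℝ≥0) (v : SpaceTime n → Space n) : ℝ≥0∞ :=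
  ⨆ t ∈ I, holderNorm α (fun x => v (t, x))

/-- The distribution `φ ↦ ∫ φ f` on `I × ℝⁿ` defined by a locally integrable function `f`. -/
def toDist {n : ℕ} {F : Type*} [NormedAddCommGroup F] [NormedSpace ℝ F] (I : Opens ℝ)
    (f : SpaceTime n → F) : 𝓓'(slab n I, F) :=
  let T : 𝓓(slab n I, ℝ) →L[ℝ] F :=
    TestFunction.integralAgainstBilinCLM (ContinuousLinearMap.lsmul ℝ ℝ) volume f
  { toFun := T, map_add' := T.map_add, map_smul' := T.map_smul, cont := T.cont }

/-- Unfolding `toDist`: it is integration against `f`. -/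
theorem toDist_apply {n : ℕ} {F : Type*} [NormedAddCommGroup F] [NormedSpace ℝ F] (I : Opens ℝ)
    (f : SpaceTime n → F) (hf : LocallyIntegrableOn f (slab n I)) (φ : 𝓓(slab n I, ℝ)) :
    toDist I f φ = ∫ z, φ z • f z := by
  change TestFunction.integralAgainstBilinCLM (ContinuousLinearMap.lsmul ℝ ℝ) volume f φ = _
  rw [TestFunction.integralAgainstBilinCLM_eq_integral hf]
  rfl

variable {n : ℕ} {I : Opens ℝ} {F : Type*} [NormedAddCommGroup F] [NormedSpace ℝ F]

/-- The time derivative `∂ₜ T` of a distribution on `I × ℝⁿ`. -/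
def timeDeriv (T : 𝓓'(slab n I, F)) : 𝓓'(slab n I, F) :=
  ∂_{((1 : ℝ), (0 : Space n))} T

/-- The space derivative `∂ⱼ T` of a distribution on `I × ℝⁿ`. -/
def spaceDeriv (j : Fin n) (T : 𝓓'(slab n I, F)) : 𝓓'(slab n I, F) :=
  ∂_{((0 : ℝ), EuclideanSpace.single j (1 : ℝ))} T

/-- The spatial gradient `∇ T = ∑ⱼ (∂ⱼ T) eⱼ` of a scalar distribution on `I × ℝⁿ`. -/
def grad (T : 𝓓'(slab n I, ℝ)) : 𝓓'(slab n I, Space n) :=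
  ∑ j, Distribution.mapCLM
    (ContinuousLinearMap.toSpanSingleton ℝ (EuclideanSpace.single j (1 : ℝ) : Space n))
    (spaceDeriv j T)

/-- The distribution `div v = ∑ⱼ ∂ⱼ vʲ`. -/
def divergence (I : Opens ℝ) (v : SpaceTime n → Space n) : 𝓓'(slab n I, ℝ) :=
  ∑ j, spaceDeriv j (toDist I fun z => v z j)

/-- The material derivative `Dₜ f = ∂ₜ f + div (v ⊗ f) = ∂ₜ f + ∑ⱼ ∂ⱼ (vʲ f)`, as a distribution
on `I × ℝⁿ`. -/
def matDeriv (I : Opens ℝ) (v : SpaceTime n → Space n) (f : SpaceTime n → F) :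
    𝓓'(slab n I, F) :=
  timeDeriv (toDist I f) + ∑ j, spaceDeriv j (toDist I fun z => v z j • f z)

/-- `(v, p)` solves the incompressible Euler equations
`∂ₜ v + div (v ⊗ v) + ∇ p = 0`, `div v = 0` in the sense of distributions on `I × ℝⁿ`. -/
structure IsEulerSolution (I : Opens ℝ) (v : SpaceTime n → Space n) (p : SpaceTime n → ℝ) :
    Prop where
  momentum : matDeriv I v v + grad (toDist I p) = 0
  incompressible : divergence I v = 0

end EulerFlow

end

open MeasureTheory TopologicalSpace Set
open scoped NNReal ENNReal Distributions LineDeriv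

noncomputable section

namespace EulerFlow

open Filter
open scoped Topology ContDiff

section Development

variable {n : ℕ}

/-! The pressure gradient is cut into dyadic scales. There are a mollifier ψ and a compactly
supported `W` with ΔW = 2⁻ⁿ ψ(·/2) − ψ (`exists_dyadicPotential`). By the Poisson equation −Δp = ∑
∂ᵢ∂ⱼ(vⁱvʲ), the difference of the mollifications of ∂ₗp at the scales 2s and s is, up to sign, the
convolution of vⁱvʲ with third derivatives of the dilated `W`, which is `pressTerm`. Since div v =
0, the products vʲvⁱ in it may be replaced by products of increments v(x − sy) − v(x)
(`pressTerm_eq_diff`), so the term is O(s^(2α−1)) for s ≤ 1 and O(1/s) for s ≥ 1. Telescoping over s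
= 2ᵏ, the small scales recover ∇p weakly and the large scales vanish because p is periodic
(`IsPressureSlice.integral_pd_mul`). Hence ∇p is a uniformly convergent series as soon as α > 1/2,
with Hölder bounds of every exponent θ < 2α − 1.

The material derivative of a single term again contains only increments: by div v = 0 and the
Poisson equation all other contributions cancel (`pressTimeRate_add_transport`). What remains are
triple velocity increments with prefactor s⁻² and products of a velocity increment with an increment
of ∇p, with prefactor s⁻¹. For s ≤ 1 they are O(s^(3α−2)) and O(s^(α+θ−1)). Both exponents can be
made positive with some θ < 2α − 1 exactly when α > 2/3, and then Dₜ∇p is a uniformly convergent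
series of continuous functions.

Two points make this rigorous. The velocity is only measurable in time, but the momentum equation
makes its mollifications Lipschitz in time, so it agrees at almost every time with a continuous
field u (`exists_continuous_version`), and the equations tested in space then hold at every time.
Differentiating ∫ χ uⁱuʲ in time requires a product rule that is not available for u itself; it is
proved for mollified fields, where the commutator with transport is O(s^(2α−1)), and passes to the
limit (`IsHolderFlow.hasDerivAt_pairing_mul`). -/

/-- The `i`-th partial derivative of a scalar function on `ℝⁿ`. -/
def pd (i : Fin n) (f : Space n → ℝ) : Space n → ℝ :=
  fun x => fderiv ℝ f x (EuclideanSpace.single i 1)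

/-- Smooth compactly supported functions on `ℝⁿ`. -/
structure IsTest (χ : Space n → ℝ) : Prop where
  smooth : ContDiff ℝ ∞ χ
  supp : HasCompactSupport χ

/-- Averaging `f` against the kernel `K` at scale `s`: the convolution of `f` with
`s⁻ⁿ K(·/s)`. -/
def scaledConv (K : Space n → ℝ) (s : ℝ) (f : Space n → ℝ) (x : Space n) : ℝ :=
  ∫ y, K y * f (x - s • y)

/-- The function `y ↦ K ((x - y) / s)`. -/
def kerAt (K : Space n → ℝ) (s : ℝ) (x : Space n) : Space n → ℝ :=
  fun y => K (s⁻¹ • (x - y))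

/-! ### Calculus of test functions and dilated kernels. -/

namespace IsTest

variable {χ ψ : Space n → ℝ}

theorem continuous (h : IsTest χ) : Continuous χ := h.smooth.continuous

theorem differentiable (h : IsTest χ) : Differentiable ℝ χ := h.smooth.differentiable (by simp)

theorem pd (h : IsTest χ) (i : Fin n) : IsTest (pd i χ) where
  smooth := (h.smooth.fderiv_right (m := ∞) (by simp)).clm_apply contDiff_const
  supp := by
    refine (h.supp.fderiv (𝕜 := ℝ)).comp_left (g := fun L => L (EuclideanSpace.single i 1)) ?_
    simp

theorem mul (h : IsTest χ) {f : Space n → ℝ} (hf : ContDiff ℝ ∞ f) :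
    IsTest (fun x => χ x * f x) where
  smooth := h.smooth.mul hf
  supp := h.supp.mul_right

theorem integrable_mul (h : IsTest χ) {f : Space n → ℝ} (hf : LocallyIntegrable f) :
    Integrable (fun x => χ x * f x) := by
  simpa using hf.integrable_smul_left_of_hasCompactSupport h.continuous h.supp

theorem integrable (h : IsTest χ) : Integrable χ :=
  h.continuous.integrable_of_hasCompactSupport h.supp

theorem kerAt (h : IsTest χ) {s : ℝ} (hs : 0 < s) (x : Space n) : IsTest (kerAt χ s x) where
  smooth := h.smooth.comp (by fun_prop)
  supp := by
    have e : EulerFlow.kerAt χ s x = χ ∘ ((Homeomorph.subLeft x).trans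
      (Homeomorph.smulOfNeZero s⁻¹ (inv_ne_zero hs.ne'))) := by
      ext y; simp [EulerFlow.kerAt]
    rw [e]
    exact h.supp.comp_homeomorph _

theorem exists_bound (h : IsTest χ) : ∃ C, 0 ≤ C ∧ ∀ x, |χ x| ≤ C := by
  obtain ⟨C, hC⟩ := h.continuous.bounded_above_of_compact_support h.supp
  exact ⟨C, (norm_nonneg _).trans (hC 0), hC⟩

theorem exists_radius (h : IsTest χ) : ∃ R, 0 < R ∧ ∀ x, χ x ≠ 0 → ‖x‖ ≤ R := by
  obtain ⟨R, hR, hR'⟩ := h.supp.isCompact.isBounded.exists_pos_norm_le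
  exact ⟨R, hR, fun x hx => hR' x (subset_tsupport _ hx)⟩

theorem smul (h : IsTest χ) (c : ℝ) : IsTest (fun x => c * χ x) where
  smooth := contDiff_const.mul h.smooth
  supp := h.supp.mul_left

theorem comp_smul (h : IsTest χ) {c : ℝ} (hc : c ≠ 0) : IsTest (fun x => χ (c • x)) where
  smooth := h.smooth.comp (by fun_prop)
  supp := h.supp.comp_homeomorph (Homeomorph.smulOfNeZero c hc)

end IsTest

theorem pd_comm {χ : Space n → ℝ} (h : ContDiff ℝ ∞ χ) (i j : Fin n) :
    pd i (pd j χ) = pd j (pd i χ) := by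
  have key : ∀ (a b : Fin n) (x), pd a (pd b χ) x =
      fderiv ℝ (fderiv ℝ χ) x (EuclideanSpace.single a 1) (EuclideanSpace.single b 1) := by
    intro a b x
    have hd : DifferentiableAt ℝ (fderiv ℝ χ) x :=
      ((h.fderiv_right (m := ∞) (by simp)).differentiable (by simp)) x
    unfold pd
    rw [fderiv_clm_apply hd (differentiableAt_const _)]
    simp
  ext x
  rw [key, key]
  have : IsSymmSndFDerivAt ℝ χ x := h.contDiffAt.isSymmSndFDerivAt
    (by simpa using (show ((2 : ℕ∞) : WithTop ℕ∞) ≤ ((⊤ : ℕ∞) : WithTop ℕ∞) from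
      WithTop.coe_le_coe.2 le_top))
  exact this.eq _ _

theorem pd_const_mul {f : Space n → ℝ} (c : ℝ) (hf : Differentiable ℝ f) (i : Fin n) :
    pd i (fun x => c * f x) = fun x => c * pd i f x := by
  ext x
  simp [pd, fderiv_const_mul (hf x)]

theorem pd_sub {f g : Space n → ℝ} (hf : Differentiable ℝ f) (hg : Differentiable ℝ g)
    (i : Fin n) : pd i (fun x => f x - g x) = fun x => pd i f x - pd i g x := by
  ext x
  simp [pd, fderiv_fun_sub (hf x) (hg x)]

theorem pd_sum {ι : Type*} (s : Finset ι) {f : ι → Space n → ℝ}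
    (hf : ∀ a ∈ s, Differentiable ℝ (f a)) (i : Fin n) :
    pd i (fun x => ∑ a ∈ s, f a x) = fun x => ∑ a ∈ s, pd i (f a) x := by
  ext x
  simp [pd, fderiv_fun_sum (fun a ha => hf a ha x)]

theorem pd_mul {f g : Space n → ℝ} (hf : Differentiable ℝ f) (hg : Differentiable ℝ g)
    (i : Fin n) : pd i (fun x => f x * g x) = fun x => f x * pd i g x + pd i f x * g x := by
  ext x
  simp [pd, fderiv_fun_mul (hf x) (hg x)]
  ring

theorem pd_comp_smul {f : Space n → ℝ} (hf : Differentiable ℝ f) (c : ℝ) (i : Fin n) :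
    pd i (fun x => f (c • x)) = fun x => c * pd i f (c • x) := by
  ext x
  have : HasFDerivAt (fun x => f (c • x))
      ((fderiv ℝ f (c • x)).comp (c • ContinuousLinearMap.id ℝ (Space n))) x :=
    (hf (c • x)).hasFDerivAt.comp x ((hasFDerivAt_id x).const_smul c)
  simp [pd, this.fderiv]

theorem pd_kerAt {f : Space n → ℝ} (hf : Differentiable ℝ f) (s : ℝ) (x : Space n) (i : Fin n) :
    pd i (kerAt f s x) = fun y => -s⁻¹ * kerAt (pd i f) s x y := by
  ext y
  have : HasFDerivAt (kerAt f s x)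
      ((fderiv ℝ f (s⁻¹ • (x - y))).comp (s⁻¹ • -ContinuousLinearMap.id ℝ (Space n))) y :=
    (hf (s⁻¹ • (x - y))).hasFDerivAt.comp y (((hasFDerivAt_id y).const_sub x).const_smul s⁻¹)
  simp [pd, this.fderiv, kerAt]

theorem IsTest.integral_pd_mul {χ f : Space n → ℝ} (h : IsTest χ) (hf : ContDiff ℝ 1 f)
    (i : Fin n) : ∫ x, EulerFlow.pd i χ x * f x = -∫ x, χ x * EulerFlow.pd i f x := by
  have hc : Continuous (EulerFlow.pd i f) :=
    (hf.continuous_fderiv (by simp)).clm_apply continuous_const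
  have := integral_mul_fderiv_eq_neg_fderiv_mul_of_integrable (μ := volume) (f := χ) (g := f)
    (v := EuclideanSpace.single i 1) ((h.pd i).integrable_mul hf.continuous.locallyIntegrable)
    (h.integrable_mul hc.locallyIntegrable)
    (h.integrable_mul hf.continuous.locallyIntegrable)
    (fun x _ => h.differentiable x) (fun x _ => hf.differentiable (by simp) x)
  simp only [EulerFlow.pd]
  rw [this, neg_neg]

theorem IsTest.integral_pd {χ : Space n → ℝ} (h : IsTest χ) (i : Fin n) :
    ∫ x, EulerFlow.pd i χ x = 0 := by
  have := h.integral_pd_mul (f := fun _ => 1) contDiff_const i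
  simpa [EulerFlow.pd] using this

theorem integral_kerAt_mul (K f : Space n → ℝ) {s : ℝ} (hs : 0 < s) (x : Space n) :
    ∫ y, kerAt K s x y * f y = s ^ n * scaledConv K s f x := by
  have h1 : ∫ y, kerAt K s x y * f y = ∫ y, K (s⁻¹ • y) * f (x - y) := by
    rw [← integral_sub_left_eq_self _ _ x]
    simp [kerAt]
  have h2 := Measure.integral_comp_inv_smul_of_nonneg (volume : Measure (Space n))
    (fun y => K y * f (x - s • y)) hs.le
  simp only [finrank_euclideanSpace, Fintype.card_fin, smul_eq_mul] at h2
  rw [h1, scaledConv, ← h2]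
  simp [smul_smul, mul_inv_cancel₀ hs.ne']

theorem scaledConv_eq_kerAt (K f : Space n → ℝ) {s : ℝ} (hs : 0 < s) (x : Space n) :
    scaledConv K s f x = (s ^ n)⁻¹ * ∫ y, kerAt K s x y * f y := by
  rw [integral_kerAt_mul K f hs, ← mul_assoc, inv_mul_cancel₀ (by positivity), one_mul]

/-! ### A compactly supported potential for the difference of two dilations. -/

/-- The average `∫₁² sᵃ h(r / s²) ds` of the dilations of `h`. -/
def dilationAverage (h : ℝ → ℝ) (a : ℤ) (r : ℝ) : ℝ := ∫ s in (1 : ℝ)..2, s ^ a * h (r / s ^ 2)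

theorem hasDerivAt_dilationAverage {h : ℝ → ℝ} (hh : ContDiff ℝ ∞ h) (a : ℤ) (r : ℝ) :
    HasDerivAt (dilationAverage h a) (dilationAverage (deriv h) (a - 2) r) r := by
  have hd : Continuous (deriv h) := hh.continuous_deriv (by simp)
  have hpos : ∀ s ∈ uIcc (1 : ℝ) 2, s ≠ 0 := by
    intro s hs
    rw [uIcc_of_le (by norm_num)] at hs
    linarith [hs.1]
  have hcont : ∀ (g : ℝ → ℝ) (b : ℤ) (r : ℝ), Continuous g →
      ContinuousOn (fun s : ℝ => s ^ b * g (r / s ^ 2)) (uIcc 1 2) := by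
    intro g b r hg
    refine ContinuousOn.mul (fun s hs => ?_) (hg.comp_continuousOn ?_)
    · exact (continuousAt_zpow₀ s b (Or.inl (hpos s hs))).continuousWithinAt
    · exact continuousOn_const.div (by fun_prop) (fun s hs => pow_ne_zero 2 (hpos s hs))
  obtain ⟨C, hC⟩ : ∃ C, ∀ z ∈ Metric.closedBall r 1 ×ˢ uIcc (1 : ℝ) 2,
      ‖z.2 ^ (a - 2) * deriv h (z.1 / z.2 ^ 2)‖ ≤ C := by
    have hK : IsCompact (Metric.closedBall r 1 ×ˢ uIcc (1 : ℝ) 2) :=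
      (isCompact_closedBall r 1).prod isCompact_uIcc
    refine hK.exists_bound_of_continuousOn ?_
    refine ContinuousOn.mul (fun z hz => ?_) (hd.comp_continuousOn ?_)
    · exact ((continuousAt_zpow₀ z.2 _ (Or.inl (hpos z.2 hz.2))).comp
        continuousAt_snd).continuousWithinAt
    · exact continuousOn_fst.div (by fun_prop) (fun z hz => pow_ne_zero 2 (hpos z.2 hz.2))
  refine (intervalIntegral.hasDerivAt_integral_of_dominated_loc_of_deriv_le
    (F' := fun r s => s ^ (a - 2) * deriv h (r / s ^ 2)) (bound := fun _ => C)
    (Metric.closedBall_mem_nhds r one_pos) ?_ ?_ ?_ ?_ ?_ ?_).2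
  · refine Eventually.of_forall fun r => ?_
    exact ((hcont h a r hh.continuous).mono uIoc_subset_uIcc).aestronglyMeasurable
      measurableSet_uIoc
  · exact (hcont h a r hh.continuous).intervalIntegrable
  · exact ((hcont _ _ r hd).mono uIoc_subset_uIcc).aestronglyMeasurable measurableSet_uIoc
  · exact Eventually.of_forall fun s hs r hr => hC (r, s) ⟨hr, uIoc_subset_uIcc hs⟩
  · exact intervalIntegrable_const
  · refine Eventually.of_forall fun s hs r _ => ?_
    have hs0 := hpos s (uIoc_subset_uIcc hs)
    have h1 : HasDerivAt h (deriv h (r / s ^ 2)) (r / s ^ 2) :=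
      (hh.differentiable (by simp) _).hasDerivAt
    have h2 : HasDerivAt (fun r : ℝ => r / s ^ 2) (1 / s ^ 2) r := (hasDerivAt_id r).div_const _
    refine ((h1.comp r h2).const_mul (s ^ a)).congr_deriv ?_
    rw [zpow_sub₀ hs0]
    norm_cast
    field_simp

/-- The derivative is an average of the same kind, with `deriv h` and exponent `a - 2`; the
induction therefore runs over all `h` and `a` at once. -/
theorem contDiff_dilationAverage {h : ℝ → ℝ} (hh : ContDiff ℝ ∞ h) (a : ℤ) :
    ContDiff ℝ ∞ (dilationAverage h a) := by
  have key : ∀ (m : ℕ) (h : ℝ → ℝ) (a : ℤ), ContDiff ℝ ∞ h →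
      ContDiff ℝ m (dilationAverage h a) := by
    intro m
    induction m with
    | zero =>
      intro h a hh
      exact contDiff_zero.2 (continuous_iff_continuousAt.2 fun r =>
        (hasDerivAt_dilationAverage hh a r).continuousAt)
    | succ m ih =>
      intro h a hh
      push_cast
      rw [contDiff_succ_iff_deriv]
      refine ⟨fun r => (hasDerivAt_dilationAverage hh a r).differentiableAt, by simp, ?_⟩
      have : deriv (dilationAverage h a) = dilationAverage (deriv h) (a - 2) := by
        ext r; exact (hasDerivAt_dilationAverage hh a r).deriv
      rw [this]
      exact ih _ _ (contDiff_infty_iff_deriv.1 hh).2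
  exact contDiff_infty.2 fun m => key m h a hh

/-- The combined integrand is the s-derivative of −2 s⁻ⁿ h'(r/s²), so the fundamental theorem of
calculus leaves only the endpoints s = 1 and s = 2. The left side is the radial Laplacian from
`laplace_radial`. -/
theorem dilationAverage_laplace {h : ℝ → ℝ} (hh : ContDiff ℝ ∞ h) (n : ℕ) (r : ℝ) :
    2 * n * dilationAverage (deriv h) (-1 - n) r +
      4 * r * dilationAverage (deriv (deriv h)) (-3 - n) r =
    2 * deriv h r - 2 * (2 ^ n)⁻¹ * deriv h (r / 4) := by
  have hh1 : ContDiff ℝ ∞ (deriv h) := (contDiff_infty_iff_deriv.1 hh).2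
  have hh2 : Continuous (deriv (deriv h)) := hh1.continuous_deriv (by simp)
  have hpos : ∀ s ∈ uIcc (1 : ℝ) 2, s ≠ 0 := by
    intro s hs
    rw [uIcc_of_le (by norm_num)] at hs
    linarith [hs.1]
  have hcont : ∀ (g : ℝ → ℝ) (b : ℤ), Continuous g →
      ContinuousOn (fun s : ℝ => s ^ b * g (r / s ^ 2)) (uIcc 1 2) := by
    intro g b hg
    refine ContinuousOn.mul (fun s hs => ?_) (hg.comp_continuousOn ?_)
    · exact (continuousAt_zpow₀ s b (Or.inl (hpos s hs))).continuousWithinAt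
    · exact continuousOn_const.div (by fun_prop) (fun s hs => pow_ne_zero 2 (hpos s hs))
  have hi1 := ((hcont _ (-1 - n) hh1.continuous).intervalIntegrable (μ := volume)).const_mul
    (2 * n : ℝ)
  have hi2 := ((hcont _ (-3 - n) hh2).intervalIntegrable (μ := volume)).const_mul (4 * r)
  have ftc := intervalIntegral.integral_eq_sub_of_hasDerivAt
    (f := fun s : ℝ => -2 * (s ^ (-(n : ℤ)) * deriv h (r / s ^ 2)))
    (f' := fun s : ℝ => 2 * n * (s ^ (-1 - n : ℤ) * deriv h (r / s ^ 2)) +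
      4 * r * (s ^ (-3 - n : ℤ) * deriv (deriv h) (r / s ^ 2))) (a := 1) (b := 2) ?_
      (hi1.add hi2)
  · rw [intervalIntegral.integral_add hi1 hi2, intervalIntegral.integral_const_mul,
      intervalIntegral.integral_const_mul] at ftc
    unfold dilationAverage
    rw [ftc]
    simp
    norm_num
    ring
  · intro s hs
    have hs0 := hpos s hs
    have h1 : HasDerivAt (deriv h) (deriv (deriv h) (r / s ^ 2)) (r / s ^ 2) :=
      (hh1.differentiable (by simp) _).hasDerivAt
    have h2 : HasDerivAt (fun s : ℝ => r / s ^ 2) (r * (-(2 * s) / (s ^ 2) ^ 2)) s := by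
      have := ((hasDerivAt_pow 2 s).inv (pow_ne_zero 2 hs0)).const_mul r
      simpa [div_eq_mul_inv] using this
    have h3 := (((hasDerivAt_zpow (-(n : ℤ)) s (Or.inl hs0)).mul (h1.comp s h2)).const_mul (-2))
    refine h3.congr_deriv ?_
    have e1 : s ^ (-1 - n : ℤ) = s ^ (-(n : ℤ)) * s⁻¹ := by
      rw [show (-1 - n : ℤ) = -(n : ℤ) + (-1) by ring, zpow_add₀ hs0, zpow_neg_one]
    have e2 : s ^ (-3 - n : ℤ) = s ^ (-(n : ℤ)) * (s ^ 3)⁻¹ := by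
      rw [show (-3 - n : ℤ) = -(n : ℤ) + (-3) by ring, zpow_add₀ hs0]
      norm_cast
    have e3 : s ^ (-(n : ℤ) - 1) = s ^ (-(n : ℤ)) * s⁻¹ := by
      rw [zpow_sub_one₀ hs0]
    rw [e1, e2, e3]
    simp only [Function.comp]
    push_cast
    field_simp
    ring

theorem pd_radial {w : ℝ → ℝ} (hw : Differentiable ℝ w) (i : Fin n) :
    pd i (fun x => w (‖x‖ ^ 2)) = fun x => 2 * (x i * deriv w (‖x‖ ^ 2)) := by
  ext x
  have h1 : HasFDerivAt (fun x : Space n => ‖x‖ ^ 2) (2 • innerSL ℝ x) x :=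
    (hasStrictFDerivAt_norm_sq x).hasFDerivAt
  have h2 := ((hw (‖x‖ ^ 2)).hasDerivAt.comp_hasFDerivAt x h1)
  have h3 : fderiv ℝ (fun x : Space n => w (‖x‖ ^ 2)) x = _ := h2.fderiv
  simp only [pd, h3]
  simp [EuclideanSpace.inner_single_right]
  ring

theorem contDiff_radial {w : ℝ → ℝ} (hw : ContDiff ℝ ∞ w) :
    ContDiff ℝ ∞ (fun x : Space n => w (‖x‖ ^ 2)) :=
  hw.comp (contDiff_norm_sq ℝ)

theorem isTest_radial {w : ℝ → ℝ} (hw : ContDiff ℝ ∞ w) {R : ℝ} (hR : ∀ r, R ≤ r → w r = 0) :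
    IsTest (fun x : Space n => w (‖x‖ ^ 2)) where
  smooth := contDiff_radial hw
  supp := by
    refine HasCompactSupport.of_support_subset_isCompact
      (isCompact_closedBall (0 : Space n) (|R| + 1)) fun x hx => ?_
    rw [mem_closedBall_zero_iff]
    by_contra hcon
    push Not at hcon
    refine hx (hR _ ?_)
    have := le_abs_self R
    have := abs_nonneg R
    nlinarith

theorem laplace_radial {w : ℝ → ℝ} (hw : ContDiff ℝ ∞ w) (x : Space n) :
    ∑ i, pd i (pd i (fun x => w (‖x‖ ^ 2))) x =
      2 * n * deriv w (‖x‖ ^ 2) + 4 * ‖x‖ ^ 2 * deriv (deriv w) (‖x‖ ^ 2) := by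
  have hw1 : ContDiff ℝ ∞ (deriv w) := (contDiff_infty_iff_deriv.1 hw).2
  have hco : ∀ i : Fin n, Differentiable ℝ (fun x : Space n => x i) := fun i => by fun_prop
  have hpc : ∀ i : Fin n, ∀ x, pd i (fun x : Space n => x i) x = 1 := by
    intro i x
    have : HasFDerivAt (fun x : Space n => x i) (EuclideanSpace.proj i : Space n →L[ℝ] ℝ) x :=
      (EuclideanSpace.proj i : Space n →L[ℝ] ℝ).hasFDerivAt
    simp [pd, this.fderiv]
  have h1 : ∀ i : Fin n, pd i (pd i (fun x => w (‖x‖ ^ 2))) x =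
      2 * deriv w (‖x‖ ^ 2) + 4 * (x i ^ 2 * deriv (deriv w) (‖x‖ ^ 2)) := by
    intro i
    have hd : Differentiable ℝ (fun x : Space n => deriv w (‖x‖ ^ 2)) :=
      (contDiff_radial hw1).differentiable (by simp)
    rw [pd_radial (hw.differentiable (by simp)), pd_const_mul 2 ((hco i).fun_mul hd),
      pd_mul (hco i) hd, pd_radial (hw1.differentiable (by simp))]
    simp only [hpc]
    ring
  simp_rw [h1, Finset.sum_add_distrib, ← Finset.mul_sum, ← Finset.sum_mul]
  rw [EuclideanSpace.norm_sq_eq]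
  simp
  ring

/-- A compactly supported potential `W` whose Laplacian is the difference of two dilations of an
approximate identity `ψ`. -/
structure IsDyadicPotential (W ψ : Space n → ℝ) : Prop where
  test : IsTest W
  test_mean : IsTest ψ
  integral_mean : ∫ x, ψ x = 1
  laplace : ∀ x, ∑ i, pd i (pd i W) x = (2 ^ n)⁻¹ * ψ ((2 : ℝ)⁻¹ • x) - ψ x

/-- For ψ(x) = −2h'(|x|²) the field xψ(x) is −∇(h(|x|²)), so the scaling derivative of s⁻ⁿψ(x/s),
which is −div(x s⁻ⁿ⁻¹ψ(x/s)), equals Δ(s^(1−n) h(|x|²/s²)). Integrating over 1 ≤ s ≤ 2 produces the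
potential and explains the exponent 1 − n. The potential is compactly supported because `h` is. -/
theorem exists_dyadicPotential (hn : n ≠ 0) :
    ∃ W ψ : Space n → ℝ, IsDyadicPotential W ψ := by
  -- A decreasing cutoff, equal to 1 for r ≤ 1 and to 0 for r ≥ 2.
  set h : ℝ → ℝ := fun r => Real.smoothTransition (2 - r) with hh
  have hs : ContDiff ℝ ∞ h := Real.smoothTransition.contDiff.comp (by fun_prop)
  have hs1 : ContDiff ℝ ∞ (deriv h) := (contDiff_infty_iff_deriv.1 hs).2
  have hanti : Antitone h := fun a b hab => Real.smoothTransition.monotone (by linarith)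
  have hz : ∀ r, 2 ≤ r → h r = 0 := fun r hr =>
    Real.smoothTransition.zero_of_nonpos (by linarith)
  have hz1 : ∀ r, 3 ≤ r → deriv h r = 0 := by
    intro r hr
    have : h =ᶠ[𝓝 r] fun _ => 0 := by
      filter_upwards [lt_mem_nhds (show (2 : ℝ) < r by linarith)] with y hy using hz y hy.le
    rw [this.deriv_eq]; simp
  set ψ₀ : Space n → ℝ := fun x => -2 * deriv h (‖x‖ ^ 2) with hψ₀
  set W₀ : Space n → ℝ := fun x => dilationAverage h (1 - n) (‖x‖ ^ 2) with hW₀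
  have hψt : IsTest ψ₀ := (isTest_radial hs1 hz1).smul (-2)
  have hw := contDiff_dilationAverage hs (1 - n)
  have hWt : IsTest W₀ := by
    -- For s ≤ 2 and r ≥ 8 one has r/s² ≥ 2, where `h` vanishes.
    refine isTest_radial hw (R := 8) fun r hr => ?_
    unfold dilationAverage
    rw [intervalIntegral.integral_congr (g := fun _ => 0)]
    · simp
    · intro s hs
      rw [uIcc_of_le (by norm_num)] at hs
      have : 2 ≤ r / s ^ 2 := by
        rw [le_div_iff₀ (by have := hs.1; positivity)]
        nlinarith [hs.1, hs.2]
      simp [hz _ this]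
  have hint : 0 < ∫ x, ψ₀ x := by
    have hnn : ∀ x, 0 ≤ ψ₀ x := fun x => by
      have := hanti.deriv_nonpos (x := ‖x‖ ^ 2)
      simp only [hψ₀]; linarith
    -- `h` drops from 1 at 0 to 0 at 2, so its derivative is nonzero somewhere in between; since n ≠
    -- 0 there is a point with |x|² = r.
    obtain ⟨r, hr0, hr⟩ : ∃ r, 0 ≤ r ∧ deriv h r ≠ 0 := by
      by_contra! hcon
      obtain ⟨c, hc, hc'⟩ := exists_deriv_eq_slope h (show (0 : ℝ) < 2 by norm_num)
        hs.continuous.continuousOn ((hs.differentiable (by simp)).differentiableOn)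
      have h0 : h 0 = 1 := Real.smoothTransition.one_of_one_le (by norm_num)
      rw [hcon c hc.1.le, hz 2 le_rfl, h0] at hc'
      norm_num at hc'
    have : ψ₀ (EuclideanSpace.single ⟨0, Nat.pos_of_ne_zero hn⟩ (√r)) ≠ 0 := by
      simp [hψ₀, Real.sq_sqrt hr0, hr]
    exact hψt.continuous.integral_pos_of_hasCompactSupport_nonneg_nonzero hψt.supp hnn this
  set c := (∫ x, ψ₀ x)⁻¹ with hc
  refine ⟨fun x => c * W₀ x, fun x => c * ψ₀ x, hWt.smul c, hψt.smul c, ?_, ?_⟩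
  · rw [integral_const_mul, hc, inv_mul_cancel₀ hint.ne']
  · intro x
    have e1 : deriv (dilationAverage h (1 - n)) = dilationAverage (deriv h) (-1 - n) := by
      ext r
      rw [(hasDerivAt_dilationAverage hs _ r).deriv]
      congr 1; ring
    have e2 : deriv (dilationAverage (deriv h) (-1 - n)) =
        dilationAverage (deriv (deriv h)) (-3 - n) := by
      ext r
      rw [(hasDerivAt_dilationAverage hs1 _ r).deriv]
      congr 1; ring
    have e3 := laplace_radial hw x
    rw [e1, e2, dilationAverage_laplace hs] at e3
    have e4 : ∀ i, pd i (pd i (fun x => c * W₀ x)) x = c * pd i (pd i W₀) x := by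
      intro i
      rw [pd_const_mul c hWt.differentiable, pd_const_mul c (hWt.pd i).differentiable]
    simp_rw [e4, ← Finset.mul_sum]
    rw [e3]
    have : ‖(2 : ℝ)⁻¹ • x‖ ^ 2 = ‖x‖ ^ 2 / 4 := by
      rw [norm_smul]; norm_num; ring
    simp only [hψ₀, this]
    ring

/-! ### Weak derivatives in one variable. -/

theorem exists_Ioo_of_isCompact_subset {I K : Set ℝ} (hIo : IsOpen I) (hK : IsCompact K)
    (hne : K.Nonempty) (hKI : K ⊆ I) : ∃ a ∈ I, ∃ b ∈ I, K ⊆ Ioo a b := by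
  obtain ⟨ε, hε, h1⟩ := Metric.isOpen_iff.1 hIo _ (hKI (hK.sInf_mem hne))
  obtain ⟨δ, hδ, h2⟩ := Metric.isOpen_iff.1 hIo _ (hKI (hK.sSup_mem hne))
  refine ⟨sInf K - ε / 2, h1 ?_, sSup K + δ / 2, h2 ?_, fun x hx => ⟨?_, ?_⟩⟩
  · rw [Metric.mem_ball, Real.dist_eq, abs_lt]; constructor <;> linarith
  · rw [Metric.mem_ball, Real.dist_eq, abs_lt]; constructor <;> linarith
  · linarith [csInf_le hK.bddBelow hx]
  · linarith [le_csSup hK.bddAbove hx]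

theorem intervalIntegrable_of_locallyIntegrableOn {I : Set ℝ} (hI : I.OrdConnected) {w : ℝ → ℝ}
    (hw : LocallyIntegrableOn w I) {a b : ℝ} (ha : a ∈ I) (hb : b ∈ I) :
    IntervalIntegrable w volume a b :=
  (hw.integrableOn_compact_subset (hI.uIcc_subset ha hb) isCompact_uIcc).intervalIntegrable

/-- As `w` is merely locally integrable, its primitive is only absolutely continuous; integration by
parts is carried out in that class, on an interval whose endpoints lie outside the support of `θ`.
-/
theorem integral_deriv_mul_primitive {I : Set ℝ} (hIo : IsOpen I) (hI : I.OrdConnected)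
    {w : ℝ → ℝ} (hw : LocallyIntegrableOn w I) {t₀ : ℝ} (ht₀ : t₀ ∈ I) {θ : ℝ → ℝ}
    (hθ : ContDiff ℝ ∞ θ) (hc : HasCompactSupport θ) (hs : tsupport θ ⊆ I) :
    ∫ t, deriv θ t * ∫ s in t₀..t, w s = -∫ t, θ t * w t := by
  obtain ⟨a, ha, b, hb, hK⟩ := exists_Ioo_of_isCompact_subset hIo
    (hc.isCompact.union (isCompact_singleton (x := t₀))) ⟨t₀, by simp⟩
    (union_subset hs (by simpa using ht₀))
  have ht : t₀ ∈ Ioo a b := hK (by simp)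
  have hab : a < b := ht.1.trans ht.2
  have hsupp : ∀ {t}, t ∉ Ioo a b → t ∉ tsupport θ := fun h1 h2 => h1 (hK (Or.inl h2))
  have hz : ∀ t, t ∉ Ioo a b → θ t = 0 := fun t h1 => image_eq_zero_of_notMem_tsupport (hsupp h1)
  have hz' : ∀ t, t ∉ Ioo a b → deriv θ t = 0 := fun t h1 =>
    image_eq_zero_of_notMem_tsupport fun h2 => hsupp h1 (tsupport_deriv_subset h2)
  have hwi := intervalIntegrable_of_locallyIntegrableOn hI hw ha hb
  have hW := hwi.absolutelyContinuousOnInterval_intervalIntegral (c := t₀)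
    (by rw [uIcc_of_le hab.le]; exact Ioo_subset_Icc_self ht)
  obtain ⟨C, hC⟩ := (hθ.of_le (m := 1) (by simp)).lipschitzWith_of_hasCompactSupport hc (by simp)
  have hθac : AbsolutelyContinuousOnInterval θ a b :=
    (hC.lipschitzOnWith (s := uIcc a b)).absolutelyContinuousOnInterval
  have key := hW.integral_mul_deriv_eq_deriv_mul hθac
  rw [hz a (by simp), hz b (by simp)] at key
  rw [← intervalIntegral.integral_eq_integral_of_support_subset (a := a) (b := b),
    ← intervalIntegral.integral_eq_integral_of_support_subset (a := a) (b := b)]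
  · calc _ = ∫ t in a..b, (∫ s in t₀..t, w s) * deriv θ t := by simp_rw [mul_comm]
      _ = _ := key
      _ = -∫ t in a..b, deriv (fun t => ∫ s in t₀..t, w s) t * θ t := by simp
      _ = _ := by
        congr 1
        apply intervalIntegral.integral_congr_ae
        filter_upwards [hwi.ae_hasDerivAt_integral] with t h1 h2
        rw [(h1 (uIoc_subset_uIcc h2) t₀ (by
          rw [uIcc_of_le hab.le]; exact Ioo_subset_Icc_self ht)).deriv, mul_comm]
  · intro t h
    by_contra hcon
    exact h (by simp [hz t fun h' => hcon (Ioo_subset_Ioc_self h')])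
  · intro t h
    by_contra hcon
    exact h (by simp [hz' t fun h' => hcon (Ioo_subset_Ioc_self h')])

theorem integrable_mul_of_locallyIntegrableOn {I : Set ℝ} {f θ : ℝ → ℝ}
    (hf : LocallyIntegrableOn f I) (hθ : Continuous θ) (hc : HasCompactSupport θ)
    (hs : tsupport θ ⊆ I) : Integrable (fun t => θ t * f t) := by
  have h1 : IntegrableOn (fun t => θ t * f t) (tsupport θ) :=
    (hf.integrableOn_compact_subset hs hc.isCompact).continuousOn_mul hθ.continuousOn hc.isCompact
  refine (integrableOn_iff_integrable_of_support_subset ?_).1 h1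
  exact fun t ht => subset_tsupport _ (left_ne_zero_of_mul ht)

/-- The du Bois-Reymond argument: a test function with zero integral is the derivative of a test
function, so f pairs to zero with it. The constant is the mean of f against a fixed bump of mass
one. -/
theorem exists_ae_eq_const_of_weak_deriv_eq_zero {I : Set ℝ} (hIo : IsOpen I)
    (hI : I.OrdConnected) (hne : I.Nonempty) {f : ℝ → ℝ} (hf : LocallyIntegrableOn f I)
    (h : ∀ θ : ℝ → ℝ, ContDiff ℝ ∞ θ → HasCompactSupport θ → tsupport θ ⊆ I →
      ∫ t, deriv θ t * f t = 0) : ∃ c, ∀ᵐ t, t ∈ I → f t = c := by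
  obtain ⟨t₀, ht₀⟩ := hne
  obtain ⟨ε, hε, hball⟩ := Metric.isOpen_iff.1 hIo t₀ ht₀
  let φ : ContDiffBump t₀ := ⟨ε / 4, ε / 2, by positivity, by linarith⟩
  set θ₀ : ℝ → ℝ := φ.normed volume with hθ₀
  have h1 : ContDiff ℝ ∞ θ₀ := φ.contDiff_normed
  have h2 : HasCompactSupport θ₀ := φ.hasCompactSupport_normed
  have h3 : tsupport θ₀ ⊆ I := by
    rw [hθ₀, φ.tsupport_normed_eq]
    exact (Metric.closedBall_subset_ball (by simp [φ]; linarith)).trans hball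
  have h4 : ∫ t, θ₀ t = 1 := φ.integral_normed
  set c := ∫ t, θ₀ t * f t with hcdef
  refine ⟨c, ?_⟩
  have key : ∀ g : ℝ → ℝ, ContDiff ℝ ∞ g → HasCompactSupport g → tsupport g ⊆ I →
      ∫ t, g t • (f t - c) = 0 := by
    intro g hg hgc hgs
    set m := ∫ t, g t with hm
    -- Removing the mass of `g` gives `η` integral zero, which is what makes its primitive `N`
    -- vanish to the right of the support as well.
    set η : ℝ → ℝ := fun t => g t - m * θ₀ t with hη
    have hη1 : ContDiff ℝ ∞ η := hg.sub (contDiff_const.mul h1)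
    have hgi : Integrable g := hg.continuous.integrable_of_hasCompactSupport hgc
    have hθi : Integrable θ₀ := h1.continuous.integrable_of_hasCompactSupport h2
    have hηi : Integrable η := hgi.sub (hθi.const_mul m)
    obtain ⟨a, ha, b, hb, hK⟩ := exists_Ioo_of_isCompact_subset hIo
      ((hgc.isCompact.union h2.isCompact).union (isCompact_singleton (x := t₀))) ⟨t₀, by simp⟩
      (union_subset (union_subset hgs h3) (by simpa using ht₀))
    have hηz : ∀ t, t ∉ Ioo a b → η t = 0 := by
      intro t ht
      have e1 : g t = 0 := image_eq_zero_of_notMem_tsupport fun h' =>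
        ht (hK (Or.inl (Or.inl h')))
      have e2 : θ₀ t = 0 := image_eq_zero_of_notMem_tsupport fun h' =>
        ht (hK (Or.inl (Or.inr h')))
      simp [hη, e1, e2]
    have hab : a < b := by
      have : t₀ ∈ Ioo a b := hK (by simp)
      exact this.1.trans this.2
    have hηint : ∫ t in a..b, η t = 0 := by
      rw [intervalIntegral.integral_eq_integral_of_support_subset]
      · rw [integral_sub hgi (hθi.const_mul m), integral_const_mul, h4, ← hm]; ring
      · intro t ht
        by_contra hcon
        exact ht (hηz t fun h' => hcon (Ioo_subset_Ioc_self h'))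
    set N : ℝ → ℝ := fun t => ∫ s in a..t, η s with hN
    have hNd : ∀ t, HasDerivAt N (η t) t := fun t =>
      intervalIntegral.integral_hasDerivAt_right (hη1.continuous.intervalIntegrable _ _)
        hη1.continuous.stronglyMeasurable.stronglyMeasurableAtFilter hη1.continuous.continuousAt
    have hNderiv : deriv N = η := by ext t; exact (hNd t).deriv
    have hN1 : ContDiff ℝ ∞ N :=
      contDiff_infty_iff_deriv.2 ⟨fun t => (hNd t).differentiableAt, hNderiv ▸ hη1⟩
    have hNz : ∀ t, t ∉ Icc a b → N t = 0 := by
      intro t ht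
      simp only [hN]
      rcases lt_or_ge t a with hta | hta
      · rw [intervalIntegral.integral_congr (g := fun _ => 0)]
        · simp
        · intro s hs
          rw [uIcc_of_ge hta.le] at hs
          exact hηz s fun h' => absurd hs.2 (not_le.2 h'.1)
      · have htb : b < t := by
          by_contra! hcon
          exact ht ⟨hta, hcon⟩
        rw [← intervalIntegral.integral_add_adjacent_intervals
          (hη1.continuous.intervalIntegrable a b) (hη1.continuous.intervalIntegrable b t),
          hηint, intervalIntegral.integral_congr (a := b) (g := fun _ => 0)]
        · simp
        · intro s hs
          rw [uIcc_of_le htb.le] at hs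
          exact hηz s fun h' => absurd hs.1 (not_le.2 h'.2)
    have hNsub : tsupport N ⊆ Icc a b := by
      refine closure_minimal (fun t ht => ?_) isClosed_Icc
      by_contra hcon
      exact ht (hNz t hcon)
    have hNc : HasCompactSupport N := isCompact_Icc.of_isClosed_subset isClosed_closure hNsub
    have := h N hN1 hNc (hNsub.trans (hI.out ha hb))
    rw [hNderiv] at this
    have i1 := integrable_mul_of_locallyIntegrableOn hf hg.continuous hgc hgs
    have i2 := integrable_mul_of_locallyIntegrableOn hf h1.continuous h2 h3
    have e1 : ∀ t, η t * f t = g t * f t - m * (θ₀ t * f t) := fun t => by simp only [hη]; ring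
    simp_rw [e1] at this
    rw [integral_sub i1 (i2.const_mul m), integral_const_mul, ← hcdef] at this
    simp_rw [smul_eq_mul, mul_sub]
    rw [integral_sub i1 (hgi.mul_const c), integral_mul_const, ← hm]
    exact this
  have hloc : LocallyIntegrableOn (fun t => f t - c) I :=
    hf.sub ((locallyIntegrable_const c).locallyIntegrableOn I)
  filter_upwards [hIo.ae_eq_zero_of_integral_contDiff_smul_eq_zero hloc key] with t ht htI
  exact sub_eq_zero.1 (ht htI)

/-- The difference of f and a primitive of w has zero weak derivative, hence is constant. -/
theorem exists_ae_eq_primitive_of_weak_deriv {I : Set ℝ} (hIo : IsOpen I)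
    (hI : I.OrdConnected) {f w : ℝ → ℝ} (hf : LocallyIntegrableOn f I)
    (hw : LocallyIntegrableOn w I)
    (h : ∀ θ : ℝ → ℝ, ContDiff ℝ ∞ θ → HasCompactSupport θ → tsupport θ ⊆ I →
      (∫ t, deriv θ t * f t) + ∫ t, θ t * w t = 0) {t₀ : ℝ} (ht₀ : t₀ ∈ I) :
    ∃ c, ∀ᵐ t, t ∈ I → f t = c + ∫ s in t₀..t, w s := by
  have hWc : ContinuousOn (fun t => ∫ s in t₀..t, w s) I := by
    intro t ht
    obtain ⟨a, ha, b, hb, hK⟩ := exists_Ioo_of_isCompact_subset hIo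
      (isCompact_singleton (x := t).union (isCompact_singleton (x := t₀))) ⟨t₀, by simp⟩
      (union_subset (by simpa using ht) (by simpa using ht₀))
    have htm : t ∈ Ioo a b := hK (by simp)
    have ht0 : t₀ ∈ Ioo a b := hK (by simp)
    have hab : a < b := htm.1.trans htm.2
    have hwi := intervalIntegrable_of_locallyIntegrableOn hI hw ha hb
    have := (hwi.absolutelyContinuousOnInterval_intervalIntegral (c := t₀)
      (by rw [uIcc_of_le hab.le]; exact Ioo_subset_Icc_self ht0)).continuousOn
    rw [uIcc_of_le hab.le] at this
    exact (this.continuousAt (Icc_mem_nhds htm.1 htm.2)).continuousWithinAt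
  have hWl : LocallyIntegrableOn (fun t => ∫ s in t₀..t, w s) I :=
    hWc.locallyIntegrableOn hIo.measurableSet
  obtain ⟨c, hc⟩ := exists_ae_eq_const_of_weak_deriv_eq_zero hIo hI ⟨t₀, ht₀⟩ (hf.sub hWl)
    fun θ h1 h2 h3 => by
      have hd : Continuous (deriv θ) := h1.continuous_deriv (by simp)
      have hdc : HasCompactSupport (deriv θ) := h2.deriv
      have hds : tsupport (deriv θ) ⊆ I := (tsupport_deriv_subset).trans h3
      simp only [Pi.sub_apply, mul_sub]
      rw [integral_sub (integrable_mul_of_locallyIntegrableOn hf hd hdc hds)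
        (integrable_mul_of_locallyIntegrableOn hWl hd hdc hds),
        integral_deriv_mul_primitive hIo hI hw ht₀ h1 h2 h3, sub_neg_eq_add]
      exact h θ h1 h2 h3
  refine ⟨c, ?_⟩
  filter_upwards [hc] with t ht htI
  have := ht htI
  simp only [Pi.sub_apply] at this
  linarith

variable {I : Opens ℝ} {F : Type*} [NormedAddCommGroup F] [NormedSpace ℝ F]

/-! ### The distributions of the statement written as integrals. -/

theorem timeDeriv_toDist_apply {f : SpaceTime n → F} (hf : LocallyIntegrableOn f (slab n I))
    (φ : 𝓓(slab n I, ℝ)) :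
    timeDeriv (toDist I f) φ = -∫ z, fderiv ℝ φ z ((1 : ℝ), (0 : Space n)) • f z := by
  rw [timeDeriv, Distribution.lineDerivOp_apply_apply, map_neg, toDist_apply I f hf]
  congr 1

theorem spaceDeriv_toDist_apply {f : SpaceTime n → F} (hf : LocallyIntegrableOn f (slab n I))
    (j : Fin n) (φ : 𝓓(slab n I, ℝ)) :
    spaceDeriv j (toDist I f) φ =
      -∫ z, fderiv ℝ φ z ((0 : ℝ), EuclideanSpace.single j (1 : ℝ)) • f z := by
  rw [spaceDeriv, Distribution.lineDerivOp_apply_apply, map_neg, toDist_apply I f hf]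
  congr 1

theorem divergence_apply {v : SpaceTime n → Space n}
    (hv : ∀ j, LocallyIntegrableOn (fun z => v z j) (slab n I)) (φ : 𝓓(slab n I, ℝ)) :
    divergence I v φ =
      -∑ j, ∫ z, fderiv ℝ φ z ((0 : ℝ), EuclideanSpace.single j (1 : ℝ)) * v z j := by
  simp only [divergence, _root_.sum_apply]
  rw [← Finset.sum_neg_distrib]
  exact Finset.sum_congr rfl fun j _ => spaceDeriv_toDist_apply (hv j) j φ

theorem matDeriv_apply {v : SpaceTime n → Space n} {f : SpaceTime n → F}
    (hf : LocallyIntegrableOn f (slab n I))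
    (hvf : ∀ j, LocallyIntegrableOn (fun z => v z j • f z) (slab n I)) (φ : 𝓓(slab n I, ℝ)) :
    matDeriv I v f φ = -(∫ z, fderiv ℝ φ z ((1 : ℝ), (0 : Space n)) • f z) -
      ∑ j, ∫ z, fderiv ℝ φ z ((0 : ℝ), EuclideanSpace.single j (1 : ℝ)) • v z j • f z := by
  simp only [matDeriv, _root_.add_apply, _root_.sum_apply]
  rw [timeDeriv_toDist_apply hf, sub_eq_add_neg, ← Finset.sum_neg_distrib]
  congr 1
  exact Finset.sum_congr rfl fun j _ => spaceDeriv_toDist_apply (hvf j) j φ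

theorem grad_apply {p : SpaceTime n → ℝ} (hp : LocallyIntegrableOn p (slab n I))
    (φ : 𝓓(slab n I, ℝ)) (i : Fin n) :
    grad (toDist I p) φ i =
      -∫ z, fderiv ℝ φ z ((0 : ℝ), EuclideanSpace.single i (1 : ℝ)) * p z := by
  simp only [grad, _root_.sum_apply, Distribution.mapCLM_apply]
  have : ∀ j, spaceDeriv j (toDist I p) φ =
      -∫ z, fderiv ℝ φ z ((0 : ℝ), EuclideanSpace.single j (1 : ℝ)) * p z :=
    fun j => spaceDeriv_toDist_apply hp j φ
  simp only [this, ContinuousLinearMap.toSpanSingleton_apply]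
  simp [Finset.sum_apply, Pi.single_apply, EuclideanSpace.single]

/-! ### Separating time from space by product test functions. -/

/-- The test function `(t, x) ↦ θ(t) χ(x)`. -/
def productTest {θ : ℝ → ℝ} (hθ : ContDiff ℝ ∞ θ) (hc : HasCompactSupport θ)
    (hs : tsupport θ ⊆ I) {χ : Space n → ℝ} (hχ : IsTest χ) : 𝓓(slab n I, ℝ) where
  toFun z := θ z.1 * χ z.2
  contDiff' := (hθ.comp contDiff_fst).mul (hχ.smooth.comp contDiff_snd)
  hasCompactSupport' := by
    refine HasCompactSupport.of_support_subset_isCompact (hc.isCompact.prod hχ.supp.isCompact) ?_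
    intro z hz
    exact ⟨subset_tsupport _ (left_ne_zero_of_mul hz), subset_tsupport _ (right_ne_zero_of_mul hz)⟩
  tsupport_subset' := by
    have : tsupport (fun z : SpaceTime n => θ z.1 * χ z.2) ⊆ tsupport θ ×ˢ tsupport χ := by
      refine closure_minimal ?_ (isClosed_closure.prod isClosed_closure)
      intro z hz
      exact ⟨subset_tsupport _ (left_ne_zero_of_mul hz),
        subset_tsupport _ (right_ne_zero_of_mul hz)⟩
    exact this.trans fun z hz => ⟨hs hz.1, mem_univ _⟩

theorem hasFDerivAt_productTest {θ : ℝ → ℝ} (hθ : ContDiff ℝ ∞ θ) {χ : Space n → ℝ}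
    (hχ : IsTest χ) (z : SpaceTime n) :
    HasFDerivAt (fun z : SpaceTime n => θ z.1 * χ z.2)
      (θ z.1 • (fderiv ℝ χ z.2).comp (ContinuousLinearMap.snd ℝ ℝ (Space n)) +
        χ z.2 • (fderiv ℝ θ z.1).comp (ContinuousLinearMap.fst ℝ ℝ (Space n))) z :=
  ((hθ.differentiable (by simp) z.1).hasFDerivAt.comp z hasFDerivAt_fst).mul
    ((hχ.differentiable z.2).hasFDerivAt.comp z hasFDerivAt_snd)

section productTest

variable {θ : ℝ → ℝ} (hθ : ContDiff ℝ ∞ θ) (hc : HasCompactSupport θ) (hs : tsupport θ ⊆ I)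
  {χ : Space n → ℝ} (hχ : IsTest χ)

theorem fderiv_productTest_time (z : SpaceTime n) :
    fderiv ℝ (productTest hθ hc hs hχ) z ((1 : ℝ), (0 : Space n)) = deriv θ z.1 * χ z.2 := by
  have : fderiv ℝ (productTest hθ hc hs hχ) z = _ := (hasFDerivAt_productTest hθ hχ z).fderiv
  rw [this]
  simp [mul_comm]

theorem fderiv_productTest_space (z : SpaceTime n) (j : Fin n) :
    fderiv ℝ (productTest hθ hc hs hχ) z ((0 : ℝ), EuclideanSpace.single j (1 : ℝ)) =
      θ z.1 * pd j χ z.2 := by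
  have : fderiv ℝ (productTest hθ hc hs hχ) z = _ := (hasFDerivAt_productTest hθ hχ z).fderiv
  rw [this]
  simp [pd]

end productTest

theorem isCompact_prod_subset_slab {K : Set ℝ} (hK : K ⊆ I) (L : Set (Space n)) :
    K ×ˢ L ⊆ (slab n I : Set (SpaceTime n)) :=
  fun _ hz => ⟨hK hz.1, mem_univ _⟩

theorem integrable_productTest_mul {f : SpaceTime n → ℝ} (hf : LocallyIntegrableOn f (slab n I))
    {θ : ℝ → ℝ} (hθ : Continuous θ) (hc : HasCompactSupport θ) (hs : tsupport θ ⊆ I)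
    {χ : Space n → ℝ} (hχ : IsTest χ) :
    Integrable (fun z : SpaceTime n => (θ z.1 * χ z.2) * f z) := by
  have hK : IsCompact (tsupport θ ×ˢ tsupport χ) := hc.isCompact.prod hχ.supp.isCompact
  have h1 : IntegrableOn (fun z : SpaceTime n => (θ z.1 * χ z.2) * f z)
      (tsupport θ ×ˢ tsupport χ) :=
    (hf.integrableOn_compact_subset (isCompact_prod_subset_slab hs _) hK).continuousOn_mul
      ((hθ.comp continuous_fst).mul (hχ.continuous.comp continuous_snd)).continuousOn hK
  refine (integrableOn_iff_integrable_of_support_subset ?_).1 h1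
  intro z hz
  have := left_ne_zero_of_mul hz
  exact ⟨subset_tsupport _ (left_ne_zero_of_mul this),
    subset_tsupport _ (right_ne_zero_of_mul this)⟩

theorem integral_productTest_mul {f : SpaceTime n → ℝ} (hf : LocallyIntegrableOn f (slab n I))
    {θ : ℝ → ℝ} (hθ : Continuous θ) (hc : HasCompactSupport θ) (hs : tsupport θ ⊆ I)
    {χ : Space n → ℝ} (hχ : IsTest χ) :
    ∫ z : SpaceTime n, (θ z.1 * χ z.2) * f z = ∫ t, θ t * ∫ x, χ x * f (t, x) := by
  have hi := integrable_productTest_mul hf hθ hc hs hχ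
  rw [Measure.volume_eq_prod] at hi ⊢
  rw [integral_prod _ hi]
  refine integral_congr_ae (Eventually.of_forall fun t => ?_)
  simp only [mul_assoc]
  rw [integral_const_mul]

theorem locallyIntegrableOn_pairing {f : SpaceTime n → ℝ}
    (hf : LocallyIntegrableOn f (slab n I)) {χ : Space n → ℝ} (hχ : IsTest χ) :
    LocallyIntegrableOn (fun t => ∫ x, χ x * f (t, x)) I := by
  rw [locallyIntegrableOn_iff I.isOpen.isLocallyClosed]
  intro K hKI hK
  have h1 : IntegrableOn (fun z : SpaceTime n => χ z.2 * f z) (K ×ˢ tsupport χ) :=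
    (hf.integrableOn_compact_subset (isCompact_prod_subset_slab hKI _)
      (hK.prod hχ.supp.isCompact)).continuousOn_mul
      (hχ.continuous.comp continuous_snd).continuousOn (hK.prod hχ.supp.isCompact)
  have h2 : IntegrableOn (fun z : SpaceTime n => χ z.2 * f z) (K ×ˢ univ) := by
    refine h1.of_forall_sdiff_eq_zero (hK.measurableSet.prod MeasurableSet.univ) ?_
    intro z hz
    have : z.2 ∉ tsupport χ := fun h => hz.2 ⟨hz.1.1, h⟩
    simp [image_eq_zero_of_notMem_tsupport this]
  rw [IntegrableOn, Measure.volume_eq_prod, ← Measure.prod_restrict, Measure.restrict_univ] at h2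
  exact h2.integral_prod_left

variable {v : SpaceTime n → Space n} {p : SpaceTime n → ℝ}

/-- Local integrability of all the terms in the weak formulation of the Euler equations. -/
structure HasIntegrableTerms (I : Opens ℝ) (v : SpaceTime n → Space n) (p : SpaceTime n → ℝ) :
    Prop where
  velocity : LocallyIntegrableOn v (slab n I)
  component : ∀ i, LocallyIntegrableOn (fun z => v z i) (slab n I)
  flux : ∀ i, LocallyIntegrableOn (fun z => v z i • v z) (slab n I)
  product : ∀ i j, LocallyIntegrableOn (fun z => v z i * v z j) (slab n I)
  pressure : LocallyIntegrableOn p (slab n I)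

namespace IsEulerSolution

theorem momentum_component (h : IsEulerSolution I v p) (hi : HasIntegrableTerms I v p)
    (φ : 𝓓(slab n I, ℝ)) (i : Fin n) :
    (∫ z, fderiv ℝ φ z ((1 : ℝ), (0 : Space n)) * v z i) +
      (∑ j, ∫ z, fderiv ℝ φ z ((0 : ℝ), EuclideanSpace.single j (1 : ℝ)) * (v z j * v z i)) +
      ∫ z, fderiv ℝ φ z ((0 : ℝ), EuclideanSpace.single i (1 : ℝ)) * p z = 0 := by
  have h0 := congrArg (fun T : 𝓓'(slab n I, Space n) => T φ i) h.momentum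
  simp only [_root_.add_apply, PiLp.add_apply, _root_.zero_apply, PiLp.zero_apply] at h0
  rw [matDeriv_apply hi.velocity hi.flux, grad_apply hi.pressure] at h0
  have hint : ∀ {f : SpaceTime n → Space n} (_ : LocallyIntegrableOn f (slab n I))
      (m : SpaceTime n), Integrable (fun z => fderiv ℝ φ z m • f z) := by
    intro f hf m
    have := (∂_{m} φ : 𝓓(slab n I, ℝ)).integrable_bilin (ContinuousLinearMap.lsmul ℝ ℝ)
      (μ := volume) (φ := f) hf
    refine this.congr (Eventually.of_forall fun z => ?_)
    refine congrArg (fun c : ℝ => c • f z) ?_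
    rw [TestFunction.lineDerivOp_eq_lineDerivCLM ℝ,
      TestFunction.lineDerivCLM_apply_of_le (by simp)]
    exact (φ.contDiff.differentiable (by simp) z).lineDeriv_eq_fderiv
  have hproj : ∀ {f : SpaceTime n → Space n}, Integrable f → (∫ z, f z) i = ∫ z, f z i := by
    intro f hf
    exact ((EuclideanSpace.proj i : Space n →L[ℝ] ℝ).integral_comp_comm hf).symm
  simp only [PiLp.sub_apply, PiLp.neg_apply, WithLp.ofLp_sum, Finset.sum_apply] at h0
  rw [hproj (hint hi.velocity _), Finset.sum_congr rfl fun j _ => hproj (hint (hi.flux j) _)] at h0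
  simp only [PiLp.smul_apply, smul_eq_mul] at h0
  linarith

end IsEulerSolution

variable {I : Opens ℝ} {v : SpaceTime n → Space n} {p : SpaceTime n → ℝ}

theorem locallyIntegrableOn_finset_sum {X ι : Type*} [TopologicalSpace X] [MeasurableSpace X]
    {μ : Measure X} {S : Set X} (s : Finset ι) {f : ι → X → ℝ}
    (hf : ∀ i ∈ s, LocallyIntegrableOn (f i) S μ) :
    LocallyIntegrableOn (fun x => ∑ i ∈ s, f i x) S μ := by
  classical
  induction s using Finset.induction_on with
  | empty => simpa using locallyIntegrableOn_zero
  | insert a s ha ih =>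
    simp_rw [Finset.sum_insert ha]
    exact (hf a (by simp)).add (ih fun i hi => hf i (by simp [hi]))

/-! ### The equations at almost every time, tested in space. -/

namespace IsEulerSolution

/-- The exceptional null set of times depends on χ. This is why the kernels used later are centred
at a dense sequence: only countably many null sets are then discarded. -/
theorem ae_divergence_pairing (h : IsEulerSolution I v p) (hi : HasIntegrableTerms I v p)
    {χ : Space n → ℝ} (hχ : IsTest χ) :
    ∀ᵐ t, t ∈ I → ∑ k, ∫ x, pd k χ x * v (t, x) k = 0 := by
  refine I.isOpen.ae_eq_zero_of_integral_contDiff_smul_eq_zero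
    (locallyIntegrableOn_finset_sum _ fun k _ =>
      locallyIntegrableOn_pairing (hi.component k) (hχ.pd k)) fun θ hθ hc hs => ?_
  have h0 := congrArg (fun T : 𝓓'(slab n I, ℝ) => T (productTest hθ hc hs hχ)) h.incompressible
  simp only [_root_.zero_apply] at h0
  rw [divergence_apply hi.component, neg_eq_zero] at h0
  simp only [fderiv_productTest_space] at h0
  simp only [smul_eq_mul, Finset.mul_sum]
  rw [integral_finsetSum]
  · rw [← h0]
    exact Finset.sum_congr rfl fun k _ =>
      (integral_productTest_mul (hi.component k) hθ.continuous hc hs (hχ.pd k)).symm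
  · intro k _
    exact integrable_mul_of_locallyIntegrableOn
      (locallyIntegrableOn_pairing (hi.component k) (hχ.pd k)) hθ.continuous hc hs

theorem weak_momentum (h : IsEulerSolution I v p) (hi : HasIntegrableTerms I v p)
    {χ : Space n → ℝ} (hχ : IsTest χ) (i : Fin n) {θ : ℝ → ℝ} (hθ : ContDiff ℝ ∞ θ)
    (hc : HasCompactSupport θ) (hs : tsupport θ ⊆ I) :
    (∫ t, deriv θ t * ∫ x, χ x * v (t, x) i) +
      ∫ t, θ t * ((∑ k, ∫ x, pd k χ x * (v (t, x) k * v (t, x) i)) +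
        ∫ x, pd i χ x * p (t, x)) = 0 := by
  have h0 := h.momentum_component hi (productTest hθ hc hs hχ) i
  simp only [fderiv_productTest_space, fderiv_productTest_time] at h0
  have hd : Continuous (deriv θ) := hθ.continuous_deriv (by simp)
  rw [integral_productTest_mul (hi.component i) hd hc.deriv
    ((tsupport_deriv_subset).trans hs) hχ,
    integral_productTest_mul hi.pressure hθ.continuous hc hs (hχ.pd i),
    Finset.sum_congr rfl fun k _ =>
      integral_productTest_mul (hi.product k i) hθ.continuous hc hs (hχ.pd k)] at h0
  simp only [mul_add, Finset.mul_sum]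
  have i1 : ∀ k, Integrable fun t => θ t * ∫ x, pd k χ x * (v (t, x) k * v (t, x) i) := fun k =>
    integrable_mul_of_locallyIntegrableOn
      (locallyIntegrableOn_pairing (hi.product k i) (hχ.pd k)) hθ.continuous hc hs
  have i2 : Integrable fun t => θ t * ∫ x, pd i χ x * p (t, x) :=
    integrable_mul_of_locallyIntegrableOn
      (locallyIntegrableOn_pairing hi.pressure (hχ.pd i)) hθ.continuous hc hs
  rw [integral_add (integrable_finsetSum _ fun k _ => i1 k) i2,
    integral_finsetSum _ fun k _ => i1 k, ← add_assoc]
  exact h0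

theorem locallyIntegrableOn_force (hi : HasIntegrableTerms I v p)
    {χ : Space n → ℝ} (hχ : IsTest χ) (i : Fin n) :
    LocallyIntegrableOn (fun t => (∑ k, ∫ x, pd k χ x * (v (t, x) k * v (t, x) i)) +
        ∫ x, pd i χ x * p (t, x)) I :=
  (locallyIntegrableOn_finset_sum _ fun k _ =>
    locallyIntegrableOn_pairing (hi.product k i) (hχ.pd k)).add
      (locallyIntegrableOn_pairing hi.pressure (hχ.pd i))

theorem ae_momentum_pairing (h : IsEulerSolution I v p) (hI : (I : Set ℝ).OrdConnected)
    (hi : HasIntegrableTerms I v p) {χ : Space n → ℝ} (hχ : IsTest χ) (i : Fin n) {t₀ : ℝ}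
    (ht₀ : t₀ ∈ I) :
    ∃ c, ∀ᵐ t, t ∈ I → ∫ x, χ x * v (t, x) i = c + ∫ r in t₀..t,
      ((∑ k, ∫ x, pd k χ x * (v (r, x) k * v (r, x) i)) + ∫ x, pd i χ x * p (r, x)) :=
  exists_ae_eq_primitive_of_weak_deriv I.isOpen hI
    (locallyIntegrableOn_pairing (hi.component i) hχ) (locallyIntegrableOn_force hi hχ i)
    (fun _ hθ hc hs => h.weak_momentum hi hχ i hθ hc hs) ht₀

/-- The momentum equation is tested with ∂ᵢΦ and summed over i. The time derivative then falls on ∑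
∫ ∂ᵢΦ vⁱ, which vanishes by incompressibility, so an identity without time derivative survives and
holds at almost every time. -/
theorem ae_poisson_pairing (h : IsEulerSolution I v p) (hi : HasIntegrableTerms I v p)
    {Φ : Space n → ℝ} (hΦ : IsTest Φ) :
    ∀ᵐ t, t ∈ I → ∑ i, ∫ x, pd i (pd i Φ) x * p (t, x) =
      -∑ i, ∑ k, ∫ x, pd k (pd i Φ) x * (v (t, x) k * v (t, x) i) := by
  have hl := locallyIntegrableOn_finset_sum (Finset.univ : Finset (Fin n)) fun i _ =>
    locallyIntegrableOn_force hi (hΦ.pd i) i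
  have key : ∀ θ : ℝ → ℝ, ContDiff ℝ ∞ θ → HasCompactSupport θ → tsupport θ ⊆ I →
      ∫ t, θ t • ∑ i, ((∑ k, ∫ x, pd k (pd i Φ) x * (v (t, x) k * v (t, x) i)) +
        ∫ x, pd i (pd i Φ) x * p (t, x)) = 0 := by
    intro θ hθ hc hs
    have hd : Continuous (deriv θ) := hθ.continuous_deriv (by simp)
    have hds : tsupport (deriv θ) ⊆ I := (tsupport_deriv_subset).trans hs
    have e := Finset.sum_congr rfl fun i (_ : i ∈ Finset.univ) =>
      h.weak_momentum hi (hΦ.pd i) i hθ hc hs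
    rw [Finset.sum_add_distrib, Finset.sum_const_zero] at e
    -- The time-derivative contribution vanishes because the velocity is divergence free.
    have e1 : ∑ i, ∫ t, deriv θ t * ∫ x, pd i Φ x * v (t, x) i = 0 := by
      rw [← integral_finsetSum]
      · rw [← integral_zero ℝ ℝ]
        refine integral_congr_ae ?_
        filter_upwards [h.ae_divergence_pairing hi hΦ] with t ht
        rw [← Finset.mul_sum]
        by_cases htI : t ∈ I
        · rw [ht htI, mul_zero]
        · rw [image_eq_zero_of_notMem_tsupport fun h' => htI (hds h'), zero_mul]
      · exact fun i _ => integrable_mul_of_locallyIntegrableOn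
          (locallyIntegrableOn_pairing (hi.component i) (hΦ.pd i)) hd hc.deriv hds
    rw [e1, zero_add] at e
    simp only [smul_eq_mul]
    rw [← e, ← integral_finsetSum]
    · simp only [Finset.mul_sum]
    · exact fun i _ => integrable_mul_of_locallyIntegrableOn
        (locallyIntegrableOn_force hi (hΦ.pd i) i) hθ.continuous hc hs
  filter_upwards [I.isOpen.ae_eq_zero_of_integral_contDiff_smul_eq_zero hl key] with t ht htI
  have := ht htI
  rw [Finset.sum_add_distrib] at this
  linarith

end IsEulerSolution

/-- Fubini on products of a rational interval inside `I` and a ball of integer radius. These are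
countable in number, and every time in `I` lies in such an interval, so one null set suffices. -/
theorem ae_locallyIntegrable_slice {f : SpaceTime n → ℝ}
    (hf : LocallyIntegrableOn f (slab n I)) :
    ∀ᵐ t, t ∈ I → LocallyIntegrable (fun x => f (t, x)) := by
  have h1 : ∀ (q : ℚ × ℚ) (m : ℕ), ∀ᵐ t : ℝ, Icc (q.1 : ℝ) q.2 ⊆ (I : Set ℝ) →
      t ∈ Icc (q.1 : ℝ) q.2 →
      IntegrableOn (fun x => f (t, x)) (Metric.closedBall (0 : Space n) m) := by
    intro q m
    by_cases hq : Icc (q.1 : ℝ) q.2 ⊆ (I : Set ℝ)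
    · have h2 : IntegrableOn f (Icc (q.1 : ℝ) q.2 ×ˢ Metric.closedBall (0 : Space n) m) :=
        hf.integrableOn_compact_subset (isCompact_prod_subset_slab hq _)
          (isCompact_Icc.prod (isCompact_closedBall _ _))
      rw [IntegrableOn, Measure.volume_eq_prod, ← Measure.prod_restrict] at h2
      have h3 := h2.prod_right_ae
      rw [ae_restrict_iff' measurableSet_Icc] at h3
      filter_upwards [h3] with t ht _ ht' using ht ht'
    · exact Eventually.of_forall fun t h => absurd h hq
  filter_upwards [ae_all_iff.2 fun q => ae_all_iff.2 (h1 q)] with t ht htI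
  obtain ⟨ε, hε, hball⟩ := Metric.isOpen_iff.1 I.isOpen t htI
  obtain ⟨a, ha, ha'⟩ := exists_rat_btwn (show t - ε < t by linarith)
  obtain ⟨b, hb, hb'⟩ := exists_rat_btwn (show t < t + ε by linarith)
  rw [locallyIntegrable_iff]
  intro K hK
  obtain ⟨R, hR⟩ := hK.isBounded.subset_closedBall 0
  obtain ⟨m, hm⟩ := exists_nat_ge R
  refine (ht (a, b) m (fun r hr => hball ?_) ⟨ha'.le, hb.le⟩).mono_set
    (hR.trans (Metric.closedBall_subset_closedBall hm))
  rw [Metric.mem_ball, Real.dist_eq, abs_lt]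
  constructor <;> linarith [hr.1, hr.2]

theorem continuous_integral_kerAt_mul {K : Space n → ℝ} (hK : IsTest K) {s : ℝ} (hs : 0 < s)
    {f : Space n → ℝ} (hf : LocallyIntegrable f) :
    Continuous fun x => ∫ y, kerAt K s x y * f y := by
  have := (hK.comp_smul (inv_ne_zero hs.ne')).supp.continuous_convolution_right
    (ContinuousLinearMap.mul ℝ ℝ) hf (hK.comp_smul (inv_ne_zero hs.ne')).continuous
  refine this.congr fun x => ?_
  simp [convolution, kerAt, mul_comm]

theorem integral_pd_kerAt_mul {K : Space n → ℝ} (hK : IsTest K) {s : ℝ} (hs : 0 < s)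
    (x : Space n) (i : Fin n) (f : Space n → ℝ) :
    ∫ y, pd i (kerAt K s x) y * f y = -s⁻¹ * (s ^ n * scaledConv (pd i K) s f x) := by
  rw [pd_kerAt hK.differentiable]
  simp only [mul_assoc]
  rw [integral_const_mul, integral_kerAt_mul _ _ hs]

theorem integral_pd_pd_kerAt_mul {K : Space n → ℝ} (hK : IsTest K) {s : ℝ} (hs : 0 < s)
    (x : Space n) (i j : Fin n) (f : Space n → ℝ) :
    ∫ y, pd i (pd j (kerAt K s x)) y * f y =
      s⁻¹ * s⁻¹ * (s ^ n * scaledConv (pd i (pd j K)) s f x) := by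
  rw [pd_kerAt hK.differentiable, pd_const_mul _ ((hK.pd j).kerAt hs x).differentiable]
  simp only [mul_assoc]
  rw [integral_const_mul, integral_pd_kerAt_mul (hK.pd j) hs]
  ring

theorem continuous_scaledConv {K : Space n → ℝ} (hK : IsTest K) {s : ℝ} (hs : 0 < s)
    {f : Space n → ℝ} (hf : LocallyIntegrable f) : Continuous (scaledConv K s f) := by
  have := (continuous_integral_kerAt_mul hK hs hf).const_mul (s ^ n)⁻¹
  exact this.congr fun x => (scaledConv_eq_kerAt K f hs x).symm

namespace IsEulerSolution

/-- Off one null set the identity holds for kernels centred at a dense sequence; both sides are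
continuous in the centre, so it extends to all x. -/
theorem ae_scaledConv_divergence (h : IsEulerSolution I v p) (hi : HasIntegrableTerms I v p)
    {K : Space n → ℝ} (hK : IsTest K) {s : ℝ} (hs : 0 < s) :
    ∀ᵐ t, t ∈ I → ∀ x, ∑ k, scaledConv (pd k K) s (fun y => v (t, y) k) x = 0 := by
  filter_upwards [ae_all_iff.2 fun k => ae_locallyIntegrable_slice (hi.component k),
    ae_all_iff.2 fun m : ℕ => h.ae_divergence_pairing hi (hK.kerAt hs (denseSeq (Space n) m))]
    with t h1 h2 htI x
  have hc : Continuous fun x => ∑ k, scaledConv (pd k K) s (fun y => v (t, y) k) x :=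
    continuous_finsetSum _ fun k _ => continuous_scaledConv (hK.pd k) hs (h1 k htI)
  refine congrFun (hc.ext_on (denseRange_denseSeq (Space n)) (continuous_const (y := (0 : ℝ)))
    ?_) x
  rintro _ ⟨m, rfl⟩
  have := h2 m htI
  simp only [integral_pd_kerAt_mul hK hs, ← Finset.mul_sum] at this
  have hne : -s⁻¹ ≠ 0 := neg_ne_zero.2 (inv_ne_zero hs.ne')
  have hne' : s ^ n ≠ 0 := pow_ne_zero _ hs.ne'
  simpa [hne, hne', hs.ne'] using this

theorem ae_scaledConv_poisson (h : IsEulerSolution I v p) (hi : HasIntegrableTerms I v p)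
    {K : Space n → ℝ} (hK : IsTest K) {s : ℝ} (hs : 0 < s) :
    ∀ᵐ t, t ∈ I → ∀ x, ∑ i, scaledConv (pd i (pd i K)) s (fun y => p (t, y)) x =
      -∑ i, ∑ k, scaledConv (pd k (pd i K)) s (fun y => v (t, y) k * v (t, y) i) x := by
  filter_upwards [ae_all_iff.2 fun k => ae_all_iff.2 fun i =>
      ae_locallyIntegrable_slice (hi.product k i), ae_locallyIntegrable_slice hi.pressure,
    ae_all_iff.2 fun m : ℕ => h.ae_poisson_pairing hi (hK.kerAt hs (denseSeq (Space n) m))]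
    with t h1 h2 h3 htI x
  have hc : Continuous fun x => ∑ i, scaledConv (pd i (pd i K)) s (fun y => p (t, y)) x :=
    continuous_finsetSum _ fun i _ => continuous_scaledConv ((hK.pd i).pd i) hs (h2 htI)
  have hc' : Continuous fun x =>
      -∑ i, ∑ k, scaledConv (pd k (pd i K)) s (fun y => v (t, y) k * v (t, y) i) x :=
    (continuous_finsetSum _ fun i _ => continuous_finsetSum _ fun k _ =>
      continuous_scaledConv ((hK.pd i).pd k) hs (h1 k i htI)).neg
  refine congrFun (hc.ext_on (denseRange_denseSeq (Space n)) hc' ?_) x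
  rintro _ ⟨m, rfl⟩
  have := h3 m htI
  simp only [integral_pd_pd_kerAt_mul hK hs, ← Finset.mul_sum, ← mul_neg] at this
  exact mul_left_cancel₀ (pow_ne_zero n hs.ne')
    (mul_left_cancel₀ (mul_ne_zero (inv_ne_zero hs.ne') (inv_ne_zero hs.ne')) this)

end IsEulerSolution

/-! ### Hölder increments and the size of one dyadic term. -/

/-- `f` is bounded by `M` and Hölder continuous of exponent `α` with constant `M`. -/
structure HolderBound (M α : ℝ) (f : Space n → ℝ) : Prop where
  bound : ∀ x, |f x| ≤ M
  holder : ∀ x y, |f x - f y| ≤ M * ‖x - y‖ ^ α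

theorem HolderBound.nonneg {M α : ℝ} {f : Space n → ℝ} (h : HolderBound M α f) : 0 ≤ M :=
  (abs_nonneg _).trans (h.bound 0)

theorem HolderBound.continuous {M α : ℝ} {f : Space n → ℝ} (h : HolderBound M α f)
    (hα : 0 < α) : Continuous f := by
  rw [continuous_iff_continuousAt]
  intro x
  rw [ContinuousAt, tendsto_iff_dist_tendsto_zero]
  refine squeeze_zero (fun _ => dist_nonneg) (fun y => h.holder y x) ?_
  have h1 : Tendsto (fun y : Space n => M * ‖y - x‖ ^ α) (𝓝 x) (𝓝 (M * ‖x - x‖ ^ α)) := by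
    refine Tendsto.const_mul M (Tendsto.rpow_const ?_ (Or.inr hα.le))
    exact ((continuous_id.sub continuous_const).norm).continuousAt
  simpa [Real.zero_rpow hα.ne'] using h1

/-- The weight of scale `s` in the dyadic decompositions: `s ^ σ` for `s ≤ 1` and `1 / s` for
`1 ≤ s`. -/
def scaleWeight (σ s : ℝ) : ℝ := s⁻¹ * min 1 s ^ (1 + σ)

theorem scaleWeight_nonneg (σ : ℝ) {s : ℝ} (hs : 0 < s) : 0 ≤ scaleWeight σ s := by
  unfold scaleWeight
  have : 0 < min 1 s := lt_min one_pos hs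
  positivity

/-- Two geometric series: ratio 1/2 towards large scales and ratio 2^(−σ) towards small ones, the
latter being where σ > 0 is needed. -/
theorem summable_scaleWeight {σ : ℝ} (hσ : 0 < σ) :
    Summable fun k : ℤ => scaleWeight σ ((2 : ℝ) ^ k) := by
  have h1 : Summable fun m : ℕ => ((2 : ℝ)⁻¹) ^ m :=
    summable_geometric_of_lt_one (by norm_num) (by norm_num)
  have h2 : Summable fun m : ℕ => ((2 : ℝ) ^ (-σ)) ^ m :=
    summable_geometric_of_lt_one (by positivity)
      (Real.rpow_lt_one_of_one_lt_of_neg (by norm_num) (by linarith))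
  refine Summable.of_nat_of_neg ?_ ?_
  · refine h1.congr fun m => ?_
    have : (1 : ℝ) ≤ 2 ^ m := one_le_pow₀ (by norm_num)
    simp [scaleWeight, this]
  · refine h2.congr fun m => ?_
    have h3 : ((2 : ℝ) ^ (-(m : ℤ))) ≤ 1 := by
      rw [zpow_neg, zpow_natCast]
      exact inv_le_one_of_one_le₀ (one_le_pow₀ (by norm_num))
    have h4 : (2 : ℝ) ^ (-(m : ℤ)) = (2 : ℝ) ^ (-(m : ℝ)) := by
      rw [zpow_neg, zpow_natCast, Real.rpow_neg (by norm_num), Real.rpow_natCast]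
    rw [scaleWeight, min_eq_right h3, h4, ← Real.rpow_neg_one, ← Real.rpow_mul (by norm_num),
      ← Real.rpow_mul (by norm_num), ← Real.rpow_add (by norm_num), ← Real.rpow_natCast,
      ← Real.rpow_mul (by norm_num)]
    congr 1
    ring

/-- `A` is the L¹ norm and `R` bounds the support; R is enlarged to be at least 1 so that powers of
R can be inserted freely in later estimates. -/
theorem IsTest.exists_integral_bound {K : Space n → ℝ} (hK : IsTest K) :
    ∃ R A : ℝ, 1 ≤ R ∧ 0 ≤ A ∧ ∀ (g : Space n → ℝ) (B : ℝ), (∀ y, ‖y‖ ≤ R → |g y| ≤ B) →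
      |∫ y, K y * g y| ≤ A * B := by
  obtain ⟨R, hR, hR'⟩ := hK.exists_radius
  refine ⟨max 1 R, ∫ y, |K y|, le_max_left _ _, integral_nonneg fun _ => abs_nonneg _,
    fun g B hg => ?_⟩
  rw [← integral_mul_const]
  refine norm_integral_le_of_norm_le (f := fun y => K y * g y)
    (hK.integrable.abs.mul_const B) (Eventually.of_forall fun y => ?_)
  rw [norm_mul, Real.norm_eq_abs, Real.norm_eq_abs]
  by_cases hy : K y = 0
  · simp [hy]
  · exact mul_le_mul_of_nonneg_left (hg y ((hR' y hy).trans (le_max_right _ _))) (abs_nonneg _)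

/-- Hölder continuity is used below scale 1 and mere boundedness above it, which is the origin of
`min 1 s`. -/
theorem HolderBound.abs_diff_le {M α : ℝ} {f : Space n → ℝ} (h : HolderBound M α f) (hα : 0 ≤ α)
    {R : ℝ} (hR : 1 ≤ R) {s : ℝ} (hs : 0 < s) (x : Space n) {y : Space n} (hy : ‖y‖ ≤ R) :
    |f (x - s • y) - f x| ≤ 2 * M * R ^ α * min 1 s ^ α := by
  have hM := h.nonneg
  rcases le_total s 1 with hs1 | hs1
  · rw [min_eq_right hs1]
    have h1 : ‖x - s • y - x‖ ≤ R * s := by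
      rw [sub_sub_cancel_left, norm_neg, norm_smul, Real.norm_of_nonneg hs.le, mul_comm]
      exact mul_le_mul_of_nonneg_right hy hs.le
    calc _ ≤ M * ‖x - s • y - x‖ ^ α := h.holder _ _
      _ ≤ M * (R * s) ^ α :=
        mul_le_mul_of_nonneg_left (Real.rpow_le_rpow (norm_nonneg _) h1 hα) hM
      _ = 1 * (M * (R ^ α * s ^ α)) := by rw [one_mul, Real.mul_rpow (by linarith) hs.le]
      _ ≤ 2 * (M * (R ^ α * s ^ α)) :=
        mul_le_mul_of_nonneg_right (by norm_num) (by positivity)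
      _ = _ := by ring
  · rw [min_eq_left hs1, Real.one_rpow, mul_one]
    have h1 : 1 ≤ R ^ α := Real.one_le_rpow hR hα
    calc _ ≤ |f (x - s • y)| + |f x| := abs_sub _ _
      _ ≤ 2 * M := by linarith [h.bound (x - s • y), h.bound x]
      _ ≤ _ := le_mul_of_one_le_right (by positivity) h1

/-- Interpolation: min(a, b)^α ≤ a^(α−θ) b^θ. It trades part of the decay in the scale for Hölder
continuity in the point. -/
theorem le_mul_rpow_of_le_of_le {C X a b α θ : ℝ} (ha : 0 < a) (hb : 0 ≤ b) (hC : 0 ≤ C)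
    (hθ : 0 < θ) (hθα : θ ≤ α) (h1 : X ≤ C * a ^ α) (h2 : X ≤ C * b ^ α) :
    X ≤ C * (a ^ (α - θ) * b ^ θ) := by
  rcases le_total b a with hab | hab
  · refine h2.trans (mul_le_mul_of_nonneg_left ?_ hC)
    rcases hb.eq_or_lt with rfl | hb
    · rw [Real.zero_rpow (by linarith)]
      positivity
    · calc b ^ α = b ^ (α - θ) * b ^ θ := by rw [← Real.rpow_add hb]; ring_nf
        _ ≤ _ := mul_le_mul_of_nonneg_right (Real.rpow_le_rpow hb.le hab (by linarith))
          (by positivity)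
  · refine h1.trans (mul_le_mul_of_nonneg_left ?_ hC)
    calc a ^ α = a ^ (α - θ) * a ^ θ := by rw [← Real.rpow_add ha]; ring_nf
      _ ≤ _ := mul_le_mul_of_nonneg_left (Real.rpow_le_rpow ha.le hab hθ.le) (by positivity)

theorem IsTest.integrable_mul_comp {K : Space n → ℝ} (hK : IsTest K) {f : Space n → ℝ}
    (hf : Continuous f) (s : ℝ) (x : Space n) : Integrable fun y => K y * f (x - s • y) :=
  hK.integrable_mul (hf.comp (by fun_prop)).locallyIntegrable

theorem integral_mul_diff_mul_diff {K : Space n → ℝ} (hK : IsTest K) {f g : Space n → ℝ}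
    (hf : Continuous f) (hg : Continuous g) (s : ℝ) (x : Space n) :
    ∫ y, K y * ((f (x - s • y) - f x) * (g (x - s • y) - g x)) =
      scaledConv K s (fun y => f y * g y) x - f x * scaledConv K s g x - g x * scaledConv K s f x +
        f x * g x * ∫ y, K y := by
  have i1 := hK.integrable_mul_comp (hf.fun_mul hg) s x
  have i2 := (hK.integrable_mul_comp hg s x).const_mul (f x)
  have i3 := (hK.integrable_mul_comp hf s x).const_mul (g x)
  have i4 := hK.integrable.const_mul (f x * g x)
  simp only [scaledConv]
  rw [← integral_const_mul, ← integral_const_mul, ← integral_const_mul, ← integral_sub i1 i2,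
    ← integral_sub (by exact i1.sub i2) i3, ← integral_add (by exact (i1.sub i2).sub i3) i4]
  refine integral_congr_ae (Eventually.of_forall fun y => ?_)
  simp only
  ring

/-- The part of the pressure gradient of the velocity field `u` at length scale `s`. -/
def pressTerm (W : Space n → ℝ) (l : Fin n) (s : ℝ) (u : Space n → Space n) (x : Space n) : ℝ :=
  s⁻¹ * ∑ i, ∑ j, scaledConv (pd j (pd i (pd l W))) s (fun y => u y j * u y i) x

/-- The `l`-th component of the pressure gradient of the velocity field `u`. -/
def gradPress (W : Space n → ℝ) (l : Fin n) (u : Space n → Space n) (x : Space n) : ℝ :=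
  ∑' k : ℤ, pressTerm W l ((2 : ℝ) ^ k) u x

/-- The convolutions of `u` with the gradient of the dilation of `K` vanish. -/
def ScaledDivFree (K : Space n → ℝ) (s : ℝ) (u : Space n → Space n) : Prop :=
  ∀ x, ∑ k, scaledConv (pd k K) s (fun y => u y k) x = 0

/-- In the expansion of the product of increments, the two cross terms are convolutions of a
component of `u` with a gradient, which sum to zero by `hdiv`, once after exchanging the roles of i
and j. The term with both factors frozen at x carries the integral of a derivative, which is zero.
-/
theorem pressTerm_eq_diff {W : Space n → ℝ} (hW : IsTest W) (l : Fin n) {s : ℝ}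
    {u : Space n → Space n} (hu : Continuous u)
    (hdiv : ∀ a, ScaledDivFree (pd a (pd l W)) s u) (x : Space n) :
    pressTerm W l s u x = s⁻¹ * ∑ i, ∑ j, ∫ y, pd j (pd i (pd l W)) y *
      ((u (x - s • y) j - u x j) * (u (x - s • y) i - u x i)) := by
  have hc : ∀ i, Continuous fun y => u y i := fun i => by fun_prop
  unfold pressTerm
  congr 1
  have h1 : ∀ i j, ∫ y, pd j (pd i (pd l W)) y *
      ((u (x - s • y) j - u x j) * (u (x - s • y) i - u x i)) =
      scaledConv (pd j (pd i (pd l W))) s (fun y => u y j * u y i) x -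
      u x j * scaledConv (pd i (pd j (pd l W))) s (fun y => u y i) x -
      u x i * scaledConv (pd j (pd i (pd l W))) s (fun y => u y j) x := by
    intro i j
    rw [integral_mul_diff_mul_diff (((hW.pd l).pd i).pd j) (hc j) (hc i),
      ((hW.pd l).pd i).integral_pd, mul_zero, add_zero, pd_comm (hW.pd l).smooth j i]
  simp_rw [h1, Finset.sum_sub_distrib, ← Finset.mul_sum, hdiv _ x]
  rw [Finset.sum_comm (f := fun i j => u x j *
    scaledConv (pd i (pd j (pd l W))) s (fun y => u y i) x)]
  simp_rw [← Finset.mul_sum, hdiv _ x]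
  simp

theorem exists_abs_integral_diff_mul_diff_le {K : Space n → ℝ} (hK : IsTest K) {M α M' α' : ℝ}
    (hα : 0 ≤ α) (hα' : 0 ≤ α') :
    ∃ C, 0 ≤ C ∧ ∀ (f g : Space n → ℝ), HolderBound M α f → HolderBound M' α' g →
      ∀ s, 0 < s → ∀ x, |∫ y, K y * ((f (x - s • y) - f x) * (g (x - s • y) - g x))| ≤
        C * (min 1 s ^ α * min 1 s ^ α') := by
  obtain ⟨R, A, hR, hA, hb⟩ := hK.exists_integral_bound
  refine ⟨A * |(2 * M * R ^ α) * (2 * M' * R ^ α')|, by positivity, fun f g hf hg s hs x => ?_⟩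
  have hm : 0 < min 1 s := lt_min one_pos hs
  have hM := hf.nonneg
  have hM' := hg.nonneg
  have hR0 : 0 < R := by linarith
  have habs : |(2 * M * R ^ α) * (2 * M' * R ^ α')| = (2 * M * R ^ α) * (2 * M' * R ^ α') :=
    abs_of_nonneg (by positivity)
  rw [habs, mul_assoc]
  refine hb _ _ fun y hy => ?_
  rw [abs_mul]
  calc _ ≤ (2 * M * R ^ α * min 1 s ^ α) * (2 * M' * R ^ α' * min 1 s ^ α') :=
        mul_le_mul (hf.abs_diff_le hα hR hs x hy) (hg.abs_diff_le hα' hR hs x hy)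
          (abs_nonneg _) (by positivity)
    _ = _ := by ring

/-- The difference of two products of increments is split as (a − a')b + a'(b − b'). Each a − a' is
bounded both by min(1,s)^α and by |x − x'|^α, and the two bounds are interpolated; the other factor
keeps its full power of the scale. -/
theorem exists_abs_integral_diff_sub_diff_le {K : Space n → ℝ} (hK : IsTest K) {M α θ : ℝ}
    (hθ : 0 < θ) (hθα : θ ≤ α) :
    ∃ C, 0 ≤ C ∧ ∀ (f g : Space n → ℝ), HolderBound M α f → HolderBound M α g →
      ∀ s, 0 < s → ∀ x x',
        |(∫ y, K y * ((f (x - s • y) - f x) * (g (x - s • y) - g x))) -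
          ∫ y, K y * ((f (x' - s • y) - f x') * (g (x' - s • y) - g x'))| ≤
        C * (min 1 s ^ α * min 1 s ^ (α - θ)) * ‖x - x'‖ ^ θ := by
  obtain ⟨R, A, hR, hA, hb⟩ := hK.exists_integral_bound
  have hα : 0 < α := hθ.trans_le hθα
  refine ⟨A * |2 * ((2 * M * R ^ α) * (4 * M * R ^ α))|, by positivity,
    fun f g hf hg s hs x x' => ?_⟩
  have hm : 0 < min 1 s := lt_min one_pos hs
  have hM := hf.nonneg
  have hR0 : 0 < R := by linarith
  have hR1 : 1 ≤ R ^ α := Real.one_le_rpow hR hα.le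
  have hint : ∀ x, Integrable fun y => K y * ((f (x - s • y) - f x) * (g (x - s • y) - g x)) := by
    intro x
    have hfc := hf.continuous hα
    have hgc := hg.continuous hα
    exact hK.integrable_mul (Continuous.locallyIntegrable (by fun_prop))
  have hdd : ∀ {f : Space n → ℝ}, HolderBound M α f → ∀ y, ‖y‖ ≤ R →
      |(f (x - s • y) - f x) - (f (x' - s • y) - f x')| ≤
        4 * M * R ^ α * (min 1 s ^ (α - θ) * ‖x - x'‖ ^ θ) := by
    intro f hf y hy
    refine le_mul_rpow_of_le_of_le hm (norm_nonneg _) (by positivity) hθ hθα ?_ ?_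
    · calc _ ≤ |f (x - s • y) - f x| + |f (x' - s • y) - f x'| := abs_sub _ _
        _ ≤ _ := add_le_add (hf.abs_diff_le hα.le hR hs x hy) (hf.abs_diff_le hα.le hR hs x' hy)
        _ = _ := by ring
    · have e1 := hf.holder (x - s • y) (x' - s • y)
      have e2 := hf.holder x x'
      rw [sub_sub_sub_cancel_right] at e1
      calc _ = |(f (x - s • y) - f (x' - s • y)) - (f x - f x')| := by congr 1; ring
        _ ≤ _ := (abs_sub _ _).trans (add_le_add e1 e2)
        _ = (2 * M * ‖x - x'‖ ^ α) * 1 := by ring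
        _ ≤ (2 * M * ‖x - x'‖ ^ α) * (2 * R ^ α) :=
          mul_le_mul_of_nonneg_left (by linarith) (by positivity)
        _ = _ := by ring
  have habs : |2 * ((2 * M * R ^ α) * (4 * M * R ^ α))| =
    2 * ((2 * M * R ^ α) * (4 * M * R ^ α)) := abs_of_nonneg (by positivity)
  rw [← integral_sub (hint x) (hint x'), habs]
  simp_rw [← mul_sub]
  rw [mul_assoc, mul_assoc]
  refine hb _ _ fun y hy => ?_
  have e1 := hf.abs_diff_le hα.le hR hs x' hy
  have e2 := hg.abs_diff_le hα.le hR hs x hy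
  calc |_| = |((f (x - s • y) - f x) - (f (x' - s • y) - f x')) * (g (x - s • y) - g x) +
        (f (x' - s • y) - f x') * ((g (x - s • y) - g x) - (g (x' - s • y) - g x'))| := by
        congr 1; ring
    _ ≤ (4 * M * R ^ α * (min 1 s ^ (α - θ) * ‖x - x'‖ ^ θ)) * (2 * M * R ^ α * min 1 s ^ α) +
        (2 * M * R ^ α * min 1 s ^ α) *
          (4 * M * R ^ α * (min 1 s ^ (α - θ) * ‖x - x'‖ ^ θ)) := by
        refine (abs_add_le _ _).trans (add_le_add ?_ ?_)
        · rw [abs_mul]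
          exact mul_le_mul (hdd hf y hy) e2 (abs_nonneg _) (by positivity)
        · rw [abs_mul]
          exact mul_le_mul e1 (hdd hg y hy) (abs_nonneg _) (by positivity)
    _ = _ := by ring

/-- The two increments give min(1,s)^(2α) against the prefactor s⁻¹, which is `scaleWeight` with σ =
2α − 1. Summing the constants over `l` as well makes C independent of the component. -/
theorem exists_abs_pressTerm_le {W : Space n → ℝ} (hW : IsTest W) {M α : ℝ} (hα : 0 < α) :
    ∃ C, 0 ≤ C ∧ ∀ u : Space n → Space n, Continuous u → (∀ i, HolderBound M α fun x => u x i) →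
      ∀ s, 0 < s → ∀ l, (∀ a, ScaledDivFree (pd a (pd l W)) s u) → ∀ x,
        |pressTerm W l s u x| ≤ C * scaleWeight (2 * α - 1) s := by
  choose C hC0 hC using fun l i j : Fin n =>
    exists_abs_integral_diff_mul_diff_le (M := M) (α := α) (M' := M) (α' := α)
      (((hW.pd l).pd i).pd j) hα.le hα.le
  refine ⟨∑ l, ∑ i, ∑ j, C l i j, Finset.sum_nonneg fun l _ => Finset.sum_nonneg fun i _ =>
    Finset.sum_nonneg fun j _ => hC0 l i j, fun u huc hu s hs l hdiv x => ?_⟩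
  have hm : 0 < min 1 s := lt_min one_pos hs
  rw [pressTerm_eq_diff hW l huc hdiv, abs_mul, abs_of_pos (inv_pos.2 hs)]
  have h1 : |∑ i, ∑ j, ∫ y, pd j (pd i (pd l W)) y *
      ((u (x - s • y) j - u x j) * (u (x - s • y) i - u x i))| ≤
      (∑ i, ∑ j, C l i j) * (min 1 s ^ α * min 1 s ^ α) := by
    simp_rw [Finset.sum_mul]
    refine (Finset.abs_sum_le_sum_abs _ _).trans (Finset.sum_le_sum fun i _ => ?_)
    refine (Finset.abs_sum_le_sum_abs _ _).trans (Finset.sum_le_sum fun j _ => ?_)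
    exact hC l i j _ _ (hu j) (hu i) s hs x
  have h2 : ∑ i, ∑ j, C l i j ≤ ∑ l, ∑ i, ∑ j, C l i j :=
    Finset.single_le_sum (f := fun l => ∑ i, ∑ j, C l i j)
      (fun l _ => Finset.sum_nonneg fun i _ => Finset.sum_nonneg fun j _ => hC0 l i j)
      (Finset.mem_univ l)
  have h3 : scaleWeight (2 * α - 1) s = s⁻¹ * (min 1 s ^ α * min 1 s ^ α) := by
    rw [scaleWeight, ← Real.rpow_add hm]; ring_nf
  rw [h3, mul_left_comm]
  exact mul_le_mul_of_nonneg_left (h1.trans (mul_le_mul_of_nonneg_right h2 (by positivity)))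
    (inv_nonneg.2 hs.le)

theorem exists_abs_pressTerm_sub_le {W : Space n → ℝ} (hW : IsTest W) {M α θ : ℝ} (hθ : 0 < θ)
    (hθα : θ ≤ α) :
    ∃ C, 0 ≤ C ∧ ∀ u : Space n → Space n, Continuous u → (∀ i, HolderBound M α fun x => u x i) →
      ∀ s, 0 < s → ∀ l, (∀ a, ScaledDivFree (pd a (pd l W)) s u) → ∀ x x',
        |pressTerm W l s u x - pressTerm W l s u x'| ≤
          C * scaleWeight (2 * α - 1 - θ) s * ‖x - x'‖ ^ θ := by
  choose C hC0 hC using fun l i j : Fin n =>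
    exists_abs_integral_diff_sub_diff_le (M := M) (((hW.pd l).pd i).pd j) hθ hθα
  refine ⟨∑ l, ∑ i, ∑ j, C l i j, Finset.sum_nonneg fun l _ => Finset.sum_nonneg fun i _ =>
    Finset.sum_nonneg fun j _ => hC0 l i j, fun u huc hu s hs l hdiv x x' => ?_⟩
  have hm : 0 < min 1 s := lt_min one_pos hs
  rw [pressTerm_eq_diff hW l huc hdiv, pressTerm_eq_diff hW l huc hdiv, ← mul_sub, abs_mul,
    abs_of_pos (inv_pos.2 hs)]
  simp_rw [← Finset.sum_sub_distrib]
  have h2 : ∑ i, ∑ j, C l i j ≤ ∑ l, ∑ i, ∑ j, C l i j :=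
    Finset.single_le_sum (f := fun l => ∑ i, ∑ j, C l i j)
      (fun l _ => Finset.sum_nonneg fun i _ => Finset.sum_nonneg fun j _ => hC0 l i j)
      (Finset.mem_univ l)
  have h3 : scaleWeight (2 * α - 1 - θ) s = s⁻¹ * (min 1 s ^ α * min 1 s ^ (α - θ)) := by
    rw [scaleWeight, ← Real.rpow_add hm]; ring_nf
  rw [h3, mul_left_comm, mul_assoc, mul_assoc]
  refine mul_le_mul_of_nonneg_left ?_ (inv_nonneg.2 hs.le)
  refine le_trans ?_ (mul_le_mul_of_nonneg_right h2 (by positivity))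
  simp_rw [Finset.sum_mul]
  refine (Finset.abs_sum_le_sum_abs _ _).trans (Finset.sum_le_sum fun i _ => ?_)
  refine (Finset.abs_sum_le_sum_abs _ _).trans (Finset.sum_le_sum fun j _ => ?_)
  rw [← mul_assoc]
  exact hC l i j _ _ (hu j) (hu i) s hs x x'

/-! ### Growth of periodic functions at large scales. -/

theorem setLIntegral_translate_fundamentalDomain (b : Module.Basis (Fin n) ℝ (Space n))
    {f : Space n → ℝ≥0∞} (hper : ∀ x, ∀ γ ∈ Submodule.span ℤ (range b), f (x + γ) = f x)
    {γ : Space n} (hγ : γ ∈ Submodule.span ℤ (range b)) :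
    ∫⁻ x in {y | y - γ ∈ ZSpan.fundamentalDomain b}, f x =
      ∫⁻ x in ZSpan.fundamentalDomain b, f x := by
  have hF := ZSpan.fundamentalDomain_measurableSet b
  have hF' : MeasurableSet {y : Space n | y - γ ∈ ZSpan.fundamentalDomain b} :=
    (measurable_id.sub_const γ) hF
  rw [← lintegral_indicator hF', ← lintegral_indicator hF,
    ← lintegral_sub_right_eq_self ((ZSpan.fundamentalDomain b).indicator f) γ]
  refine lintegral_congr fun y => ?_
  by_cases hy : y - γ ∈ ZSpan.fundamentalDomain b
  · rw [indicator_of_mem (by exact hy), indicator_of_mem hy]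
    simpa using hper (y - γ) γ hγ
  · rw [indicator_of_notMem (by exact hy), indicator_of_notMem hy]

/-- A ball of radius r is covered by at most a constant times rⁿ lattice translates of the
fundamental domain, each carrying the same integral of |P|. -/
theorem exists_integral_closedBall_le_of_periodic (b : Module.Basis (Fin n) ℝ (Space n))
    {P : Space n → ℝ} (hP : LocallyIntegrable P)
    (hper : ∀ x, ∀ γ ∈ Submodule.span ℤ (range b), P (x + γ) = P x) :
    ∃ C, 0 ≤ C ∧ ∀ r : ℝ, 1 ≤ r → ∫ x in Metric.closedBall 0 r, |P x| ≤ C * r ^ n := by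
  set D := ZSpan.fundamentalDomain b with hD
  -- `c` bounds every lattice coordinate functional, so points of the ball have coordinates of size
  -- at most c r; `N` exceeds this by at least one, leaving room for the integer parts.
  set c : ℝ := ∑ i, ‖LinearMap.toContinuousLinearMap (b.coord i)‖ with hc
  have hc0 : 0 ≤ c := Finset.sum_nonneg fun i _ => norm_nonneg _
  have hcoord : ∀ y i, |b.repr y i| ≤ c * ‖y‖ := fun y i =>
    ((LinearMap.toContinuousLinearMap (b.coord i)).le_opNorm y).trans
      (mul_le_mul_of_nonneg_right (Finset.single_le_sum
        (f := fun i => ‖LinearMap.toContinuousLinearMap (b.coord i)‖)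
        (fun i _ => norm_nonneg _) (Finset.mem_univ i)) (norm_nonneg _))
  have hDint : IntegrableOn P D := by
    obtain ⟨R, hR⟩ := (ZSpan.fundamentalDomain_isBounded b).subset_closedBall 0
    exact (hP.integrableOn_isCompact (isCompact_closedBall 0 R)).mono_set hR
  set B := ∫ x in D, ‖P x‖ with hB
  have hB0 : 0 ≤ B := integral_nonneg fun _ => norm_nonneg _
  refine ⟨(2 * c + 5) ^ n * B, by positivity, fun r hr => ?_⟩
  set N : ℕ := ⌈c * r⌉₊ + 1 with hN
  have hNr : c * r + 1 ≤ N := by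
    push_cast [hN]
    linarith [Nat.le_ceil (c * r)]
  have hNr' : (2 * N + 1 : ℝ) ≤ (2 * c + 5) * r := by
    push_cast [hN]
    have := (Nat.ceil_lt_add_one (mul_nonneg hc0 (by linarith : (0 : ℝ) ≤ r))).le
    nlinarith
  set S : Finset (Fin n → ℤ) := Fintype.piFinset fun _ => Finset.Icc (-(N : ℤ)) N with hS
  have hScard : S.card = (2 * N + 1) ^ n := by
    rw [hS, Fintype.card_piFinset]
    simp only [Int.card_Icc, Finset.prod_const, Finset.card_univ, Fintype.card_fin]
    congr 1
    omega
  let γ : (Fin n → ℤ) → Space n := fun m => ∑ i, m i • b i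
  have hγ : ∀ m, γ m ∈ Submodule.span ℤ (range b) := fun m =>
    Submodule.sum_mem _ fun i _ => Submodule.smul_mem _ _ (Submodule.subset_span (mem_range_self i))
  have hcover : Metric.closedBall (0 : Space n) r ⊆ ⋃ m : S, {y | y - γ m ∈ D} := by
    intro y hy
    rw [mem_closedBall_zero_iff] at hy
    have hm : (fun i => ⌊b.repr y i⌋) ∈ S := by
      rw [hS, Fintype.mem_piFinset]
      intro i
      have h1 : |b.repr y i| ≤ c * r :=
        (hcoord y i).trans (mul_le_mul_of_nonneg_left hy hc0)
      rw [abs_le] at h1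
      rw [Finset.mem_Icc]
      constructor
      · rw [Int.le_floor]; push_cast; linarith
      · have := Int.floor_le (b.repr y i)
        have h2 : ((⌊b.repr y i⌋ : ℤ) : ℝ) ≤ ((N : ℤ) : ℝ) := by push_cast; linarith
        exact_mod_cast h2
    refine mem_iUnion.2 ⟨⟨_, hm⟩, ?_⟩
    have h3 : ZSpan.fract b y ∈ D := ZSpan.fract_mem_fundamentalDomain b y
    have h4 : y - γ (fun i => ⌊b.repr y i⌋) = ZSpan.fract b y := by
      rw [ZSpan.fract_apply]
      congr 1
      simp [γ, ZSpan.floor]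
    simpa [h4] using h3
  have hle : ∫⁻ x in Metric.closedBall 0 r, ‖P x‖ₑ ≤ ((2 * N + 1) ^ n : ℕ) * ∫⁻ x in D, ‖P x‖ₑ := by
    calc _ ≤ ∫⁻ x in ⋃ m : S, {y | y - γ m ∈ D}, ‖P x‖ₑ := lintegral_mono_set hcover
      _ ≤ ∑' m : S, ∫⁻ x in {y | y - γ m ∈ D}, ‖P x‖ₑ := lintegral_iUnion_le _ _
      _ = ∑' m : S, ∫⁻ x in D, ‖P x‖ₑ := by
        congr 1
        ext m
        exact setLIntegral_translate_fundamentalDomain b (fun x γ hγ => by rw [hper x γ hγ]) (hγ m)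
      _ = _ := by
        rw [tsum_fintype, Finset.sum_const, Finset.card_univ, Fintype.card_coe, hScard,
          nsmul_eq_mul]
  have hfin : ∫⁻ x in D, ‖P x‖ₑ ≠ ⊤ := hDint.2.ne
  have e1 : ∫ x in Metric.closedBall 0 r, |P x| =
      (∫⁻ x in Metric.closedBall 0 r, ‖P x‖ₑ).toReal :=
    integral_norm_eq_lintegral_enorm
      (hP.aestronglyMeasurable.restrict)
  have e2 : B = (∫⁻ x in D, ‖P x‖ₑ).toReal :=
    integral_norm_eq_lintegral_enorm hDint.1
  rw [e1]
  refine (ENNReal.toReal_mono (ENNReal.mul_ne_top (ENNReal.natCast_ne_top _) hfin) hle).trans ?_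
  rw [ENNReal.toReal_mul, ENNReal.toReal_natCast, ← e2]
  calc (((2 * N + 1) ^ n : ℕ) : ℝ) * B = (2 * N + 1 : ℝ) ^ n * B := by push_cast; ring
    _ ≤ ((2 * c + 5) * r) ^ n * B :=
      mul_le_mul_of_nonneg_right (pow_le_pow_left₀ (by positivity) hNr' n) hB0
    _ = _ := by rw [mul_pow]; ring

/-- The factor s⁻ⁿ of the average balances the volume growth of the integral of |P|. Only local
integrability and periodicity of P enter, and the bound may depend on x. -/
theorem exists_abs_scaledConv_le_of_periodic (b : Module.Basis (Fin n) ℝ (Space n))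
    {P : Space n → ℝ} (hP : LocallyIntegrable P)
    (hper : ∀ x, ∀ γ ∈ Submodule.span ℤ (range b), P (x + γ) = P x) {K : Space n → ℝ}
    (hK : IsTest K) (x : Space n) :
    ∃ C, ∀ s : ℝ, 1 ≤ s → |scaledConv K s P x| ≤ C := by
  obtain ⟨C, hC0, hC⟩ := exists_integral_closedBall_le_of_periodic b hP hper
  obtain ⟨A, hA0, hA⟩ := hK.exists_bound
  obtain ⟨R, hR0, hR⟩ := hK.exists_radius
  refine ⟨A * (C * (‖x‖ + R + 1) ^ n), fun s hs => ?_⟩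
  have hs0 : 0 < s := by linarith
  set r := (‖x‖ + R + 1) * s with hr
  have hr1 : 1 ≤ r := by
    have := norm_nonneg x
    nlinarith
  have hint : IntegrableOn P (Metric.closedBall 0 r) :=
    hP.integrableOn_isCompact (isCompact_closedBall 0 r)
  have h1 : |∫ y, kerAt K s x y * P y| ≤ A * ∫ y in Metric.closedBall 0 r, |P y| := by
    rw [← integral_const_mul, ← integral_indicator Metric.isClosed_closedBall.measurableSet]
    refine norm_integral_le_of_norm_le (f := fun y => kerAt K s x y * P y) ?_
      (Eventually.of_forall fun y => ?_)
    · rw [integrable_indicator_iff Metric.isClosed_closedBall.measurableSet]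
      exact hint.norm.const_mul A
    · by_cases hy : y ∈ Metric.closedBall (0 : Space n) r
      · rw [indicator_of_mem hy, norm_mul]
        exact mul_le_mul_of_nonneg_right (hA _) (norm_nonneg _)
      · rw [indicator_of_notMem hy]
        have : kerAt K s x y = 0 := by
          by_contra hne
          have h2 := hR _ hne
          rw [norm_smul, norm_inv, Real.norm_of_nonneg hs0.le, inv_mul_le_iff₀ hs0] at h2
          refine hy (mem_closedBall_zero_iff.2 ?_)
          have h3 : ‖y‖ ≤ ‖x‖ + ‖x - y‖ := by
            have := norm_sub_le x (x - y)
            simpa using this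
          have := norm_nonneg x
          nlinarith
        simp [this]
  rw [scaledConv_eq_kerAt K P hs0, abs_mul, abs_of_pos (by positivity)]
  calc _ ≤ (s ^ n)⁻¹ * (A * (C * r ^ n)) :=
        mul_le_mul_of_nonneg_left (h1.trans (mul_le_mul_of_nonneg_left (hC r hr1) hA0))
          (by positivity)
    _ = _ := by rw [hr, mul_pow]; field_simp

/-! ### Continuity, duality and limits of scaled convolutions. -/

theorem continuousOn_integral_mul {X : Type*} [TopologicalSpace X] {K : Space n → ℝ}
    (hK : IsTest K) {S : Set X} {F : X → Space n → ℝ}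
    (hF : ContinuousOn F.uncurry (S ×ˢ univ)) : ContinuousOn (fun x => ∫ y, K y * F x y) S :=
  continuousOn_integral_of_compact_support hK.supp.isCompact
    (f := fun x y => K y * F x y)
    ((hK.continuous.comp continuous_snd).continuousOn.mul hF)
    fun p y _ hy => by rw [image_eq_zero_of_notMem_tsupport hy, zero_mul]

theorem continuous_integral_mul {X : Type*} [TopologicalSpace X] {K : Space n → ℝ}
    (hK : IsTest K) {F : X → Space n → ℝ} (hF : Continuous F.uncurry) :
    Continuous fun x => ∫ y, K y * F x y :=
  continuousOn_univ.1 (continuousOn_integral_mul hK hF.continuousOn)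

theorem continuous_scaledConv_uncurry {K : Space n → ℝ} (hK : IsTest K) {f : Space n → ℝ}
    (hf : Continuous f) : Continuous fun z : ℝ × Space n => scaledConv K z.1 f z.2 :=
  continuous_integral_mul hK (F := fun (z : ℝ × Space n) y => f (z.2 - z.1 • y))
    (hf.comp (by fun_prop))

theorem tendsto_scaledConv {K : Space n → ℝ} (hK : IsTest K) (hK1 : ∫ y, K y = 1)
    {f : Space n → ℝ} (hf : Continuous f) (x : Space n) :
    Tendsto (fun s => scaledConv K s f x) (𝓝 0) (𝓝 (f x)) := by
  have h := ((continuous_scaledConv_uncurry hK hf).comp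
    (continuous_id.prodMk (continuous_const (y := x)))).tendsto 0
  have h0 : scaledConv K 0 f x = f x := by
    simp [scaledConv, integral_mul_const, hK1]
  simpa [Function.comp_def, h0] using h

theorem pd_comp_sub_smul {f : Space n → ℝ} (hf : Differentiable ℝ f) (x : Space n) (s : ℝ)
    (i : Fin n) : pd i (fun y => f (x - s • y)) = fun y => -s * pd i f (x - s • y) := by
  ext y
  have : HasFDerivAt (fun y => f (x - s • y))
      ((fderiv ℝ f (x - s • y)).comp (-(s • ContinuousLinearMap.id ℝ (Space n)))) y :=
    (hf (x - s • y)).hasFDerivAt.comp y (((hasFDerivAt_id y).const_smul s).const_sub x)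
  simp [pd, this.fderiv]

theorem scaledConv_pd {K : Space n → ℝ} (hK : IsTest K) {f : Space n → ℝ} (hf : ContDiff ℝ 1 f)
    (s : ℝ) (x : Space n) (i : Fin n) :
    scaledConv (pd i K) s f x = s * scaledConv K s (pd i f) x := by
  unfold scaledConv
  rw [hK.integral_pd_mul (f := fun y => f (x - s • y)) (hf.comp (by fun_prop)) i,
    pd_comp_sub_smul (hf.differentiable (by simp)), ← integral_const_mul, ← integral_neg]
  refine integral_congr_ae (Eventually.of_forall fun y => ?_)
  simp only
  ring

theorem IsTest.exists_closedBall {χ : Space n → ℝ} (hχ : IsTest χ) {K : Space n → ℝ}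
    (hK : IsTest K) (c : ℝ) :
    ∃ R : ℝ, ∀ s : ℝ, |s| ≤ c → ∀ x y, K y * χ (x - s • y) ≠ 0 → x ∈ Metric.closedBall 0 R := by
  obtain ⟨R₁, h1, h1'⟩ := hχ.exists_radius
  obtain ⟨R₂, h2, h2'⟩ := hK.exists_radius
  refine ⟨R₁ + c * R₂, fun s hs x y hxy => ?_⟩
  rw [mem_closedBall_zero_iff]
  have e1 := h1' _ (right_ne_zero_of_mul hxy)
  have e2 := h2' _ (left_ne_zero_of_mul hxy)
  calc ‖x‖ = ‖(x - s • y) + s • y‖ := by simp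
    _ ≤ ‖x - s • y‖ + |s| * ‖y‖ := (norm_add_le _ _).trans (by rw [norm_smul, Real.norm_eq_abs])
    _ ≤ _ := add_le_add e1 (mul_le_mul hs e2 (norm_nonneg _) ((abs_nonneg _).trans hs))

/-- Fubini and a translation: the adjoint of averaging at scale s is averaging at scale −s. Negative
scales are therefore allowed, and no symmetry of `K` is needed. -/
theorem integral_mul_scaledConv {K χ P : Space n → ℝ} (hK : IsTest K) (hχ : IsTest χ)
    (hP : LocallyIntegrable P) (s : ℝ) :
    ∫ x, χ x * scaledConv K s P x = ∫ x, P x * scaledConv K (-s) χ x := by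
  obtain ⟨R, hR⟩ := hχ.exists_closedBall hK |s|
  set B := Metric.closedBall (0 : Space n) R with hB
  obtain ⟨C, hC0, hC⟩ := hχ.exists_bound
  have hPB : Integrable (B.indicator P) := by
    rw [integrable_indicator_iff Metric.isClosed_closedBall.measurableSet]
    exact hP.integrableOn_isCompact (isCompact_closedBall _ _)
  -- P is cut off to the ball containing every x at which the integrand can be nonzero, since only
  -- the truncation is integrable on the whole space.
  have h0 : Integrable (fun z : Space n × Space n => χ (z.1 + s • z.2) *
      (B.indicator P z.1 * K z.2)) (volume.prod volume) := by
    refine (hPB.mul_prod hK.integrable).bdd_mul (c := C) ?_ ?_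
    · exact (hχ.continuous.comp (by fun_prop)).aestronglyMeasurable
    · exact Eventually.of_forall fun z => hC _
  have h1 : Integrable (fun z : Space n × Space n => K z.2 * (χ (z.1 + s • z.2) * P z.1))
      (volume.prod volume) := by
    refine h0.congr (Eventually.of_forall fun z => ?_)
    by_cases hz : z.1 ∈ B
    · simp only [indicator_of_mem hz]; ring
    · have : K z.2 * χ (z.1 + s • z.2) = 0 := by
        by_contra hne
        exact hz (hR (-s) (by simp) z.1 z.2 (by simpa using hne))
      simp only [indicator_of_notMem hz]
      rw [← mul_assoc (K z.2), this]; ring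
  -- Integrability is transported from `h1` by the measure preserving shear (x, y) ↦ (x − s y, y).
  have h2 : Integrable (fun z : Space n × Space n => K z.2 * (χ z.1 * P (z.1 - s • z.2)))
      (volume.prod volume) := by
    have hmp : MeasurePreserving (fun z : Space n × Space n => (z.1 - s • z.2, z.2))
        (volume.prod volume) (volume.prod volume) := by
      have := MeasurePreserving.skew_product (μc := (volume : Measure (Space n)))
        (μd := (volume : Measure (Space n))) (MeasurePreserving.id (volume : Measure (Space n)))
        (g := fun y x => x - s • y) (by fun_prop)
        (Eventually.of_forall fun y => (measurePreserving_sub_right volume (s • y)).map_eq)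
      exact (Measure.measurePreserving_swap.comp this).comp Measure.measurePreserving_swap
    have := hmp.integrable_comp_of_integrable h1
    refine this.congr (Eventually.of_forall fun z => ?_)
    simp
  calc ∫ x, χ x * scaledConv K s P x = ∫ x, ∫ y, K y * (χ x * P (x - s • y)) := by
        refine integral_congr_ae (Eventually.of_forall fun x => ?_)
        simp only [scaledConv]
        rw [← integral_const_mul]
        refine integral_congr_ae (Eventually.of_forall fun y => ?_)
        simp only
        ring
    _ = ∫ y, ∫ x, K y * (χ x * P (x - s • y)) := integral_integral_swap h2
    _ = ∫ y, ∫ x, K y * (χ (x + s • y) * P x) := by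
        refine integral_congr_ae (Eventually.of_forall fun y => ?_)
        simp only
        rw [← integral_sub_right_eq_self (fun x => K y * (χ (x + s • y) * P x)) (s • y)]
        simp
    _ = ∫ x, ∫ y, K y * (χ (x + s • y) * P x) := (integral_integral_swap h1).symm
    _ = _ := by
        refine integral_congr_ae (Eventually.of_forall fun x => ?_)
        simp only [scaledConv]
        rw [← integral_const_mul]
        refine integral_congr_ae (Eventually.of_forall fun y => ?_)
        simp only [neg_smul, sub_neg_eq_add]
        ring

/-- The mollification is placed on the smooth χ, where it converges pointwise with a uniform bound
and uniformly bounded support; P need only be locally integrable. -/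
theorem tendsto_integral_mul_scaledConv {K χ P : Space n → ℝ} (hK : IsTest K)
    (hK1 : ∫ y, K y = 1) (hχ : IsTest χ) (hP : LocallyIntegrable P) {s : ℕ → ℝ}
    (hs : Tendsto s atTop (𝓝 0)) :
    Tendsto (fun N => ∫ x, P x * scaledConv K (s N) χ x) atTop (𝓝 (∫ x, P x * χ x)) := by
  obtain ⟨R, hR⟩ := hχ.exists_closedBall hK 1
  obtain ⟨R', A, -, hA0, hA⟩ := hK.exists_integral_bound
  obtain ⟨C, hC0, hC⟩ := hχ.exists_bound
  set B := Metric.closedBall (0 : Space n) R with hB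
  have hPB : Integrable (B.indicator P) := by
    rw [integrable_indicator_iff Metric.isClosed_closedBall.measurableSet]
    exact hP.integrableOn_isCompact (isCompact_closedBall _ _)
  refine tendsto_integral_filter_of_dominated_convergence
    (fun x => |B.indicator P x| * (A * C)) ?_ ?_ (hPB.abs.mul_const _) ?_
  · refine Eventually.of_forall fun N => hP.aestronglyMeasurable.mul ?_
    exact ((continuous_scaledConv_uncurry hK hχ.continuous).comp
      (continuous_const.prodMk continuous_id)).aestronglyMeasurable
  · have hev : ∀ᶠ N in atTop, |s N| ≤ 1 := by
      have : ∀ᶠ a in 𝓝 (0 : ℝ), |a| ≤ 1 := by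
        filter_upwards [Metric.closedBall_mem_nhds (0 : ℝ) one_pos] with a ha
        simpa using ha
      exact hs.eventually this
    filter_upwards [hev] with N hN
    refine Eventually.of_forall fun x => ?_
    rw [norm_mul]
    by_cases hx : x ∈ B
    · rw [indicator_of_mem hx]
      exact mul_le_mul_of_nonneg_left (hA _ C fun y _ => hC _) (abs_nonneg _)
    · have : scaledConv K (s N) χ x = 0 := by
        unfold scaledConv
        rw [← integral_zero (Space n) ℝ]
        refine integral_congr_ae (Eventually.of_forall fun y => ?_)
        by_contra hne
        exact hx (hR _ hN x y hne)
      rw [this]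
      simp only [norm_zero, mul_zero]
      positivity
  · refine Eventually.of_forall fun x => ?_
    exact ((tendsto_scaledConv hK hK1 hχ.continuous x).comp hs).const_mul (P x)

/-! ### The telescoping series of the pressure gradient. -/

/-- The mollification at scale `s` of the `l`-th partial derivative of `P`. -/
def gradMean (ψ : Space n → ℝ) (l : Fin n) (s : ℝ) (P : Space n → ℝ) (x : Space n) : ℝ :=
  s⁻¹ * scaledConv (pd l ψ) s P x

theorem scaledConv_comp_half (K P : Space n → ℝ) (s : ℝ) (x : Space n) :
    scaledConv (fun y => K ((2 : ℝ)⁻¹ • y)) s P x = 2 ^ n * scaledConv K (2 * s) P x := by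
  have h := Measure.integral_comp_inv_smul_of_nonneg (volume : Measure (Space n))
    (fun y => K y * P (x - (2 * s) • y)) (zero_le_two (α := ℝ))
  simp only [finrank_euclideanSpace, Fintype.card_fin, smul_eq_mul] at h
  rw [scaledConv, scaledConv, ← h]
  refine integral_congr_ae (Eventually.of_forall fun y => ?_)
  simp only [smul_smul]
  rw [show 2 * s * (2 : ℝ)⁻¹ = s by ring]

/-- Applying ∂ₗ to the identity for ΔW expresses the difference of the two mollified gradients as ∑
∂ᵢ∂ᵢ∂ₗW convolved with P; the Poisson equation then replaces P by the products of velocities. -/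
theorem IsDyadicPotential.gradMean_sub {W ψ : Space n → ℝ} (hW : IsDyadicPotential W ψ) {s : ℝ}
    (hs : 0 < s) {P : Space n → ℝ} (hP : LocallyIntegrable P) (l : Fin n) (x : Space n)
    {u : Space n → Space n}
    (hpoisson : ∑ i, scaledConv (pd i (pd i (pd l W))) s P x =
      -∑ i, ∑ k, scaledConv (pd k (pd i (pd l W))) s (fun y => u y k * u y i) x) :
    gradMean ψ l (2 * s) P x - gradMean ψ l s P x = -pressTerm W l s u x := by
  have hint : ∀ {K : Space n → ℝ}, IsTest K → Integrable fun y => K y * P (x - s • y) := by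
    intro K hK
    have h1 := (hK.kerAt hs x).integrable_mul hP
    have h2 := (h1.comp_sub_left x).comp_smul hs.ne'
    refine h2.congr (Eventually.of_forall fun y => ?_)
    simp [kerAt, smul_smul, inv_mul_cancel₀ hs.ne']
  have hlap : (fun x => ∑ i, pd i (pd i W) x) =
      fun x => (2 ^ n)⁻¹ * ψ ((2 : ℝ)⁻¹ • x) - ψ x := funext hW.laplace
  have hψ2 := hW.test_mean.comp_smul (c := (2 : ℝ)⁻¹) (by norm_num)
  have h1 : ∀ y, ∑ i, pd i (pd i (pd l W)) y =
      (2 ^ n)⁻¹ * (2⁻¹ * pd l ψ ((2 : ℝ)⁻¹ • y)) - pd l ψ y := by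
    intro y
    have e1 : ∀ i, pd i (pd i (pd l W)) = pd l (pd i (pd i W)) := fun i => by
      rw [pd_comm hW.test.smooth i l, pd_comm (hW.test.pd i).smooth i l]
    have e2 := congrFun (congrArg (pd l) hlap) y
    rw [pd_sum _ (fun i _ => ((hW.test.pd i).pd i).differentiable),
      pd_sub (hψ2.smul _).differentiable hW.test_mean.differentiable,
      pd_const_mul _ hψ2.differentiable, pd_comp_smul hW.test_mean.differentiable] at e2
    simp_rw [e1]
    exact e2
  have h2 : ∑ i, scaledConv (pd i (pd i (pd l W))) s P x =
      2⁻¹ * scaledConv (pd l ψ) (2 * s) P x - scaledConv (pd l ψ) s P x := by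
    have e3 : scaledConv (pd l ψ) (2 * s) P x =
        (2 ^ n)⁻¹ * scaledConv (fun y => pd l ψ ((2 : ℝ)⁻¹ • y)) s P x := by
      rw [scaledConv_comp_half, ← mul_assoc, inv_mul_cancel₀ (by positivity), one_mul]
    rw [e3]
    unfold scaledConv
    rw [← integral_finsetSum _ fun i _ => hint (((hW.test.pd l).pd i).pd i)]
    simp_rw [← Finset.sum_mul, h1]
    rw [← integral_const_mul, ← integral_const_mul, ← integral_sub
      (((hint ((hW.test_mean.pd l).comp_smul (by norm_num))).const_mul _).const_mul _)
      (hint (hW.test_mean.pd l))]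
    refine integral_congr_ae (Eventually.of_forall fun y => ?_)
    simp only
    ring
  rw [pressTerm, ← mul_neg, ← hpoisson, h2, gradMean, gradMean, mul_inv]
  ring

/-- Averages of a periodic function stay bounded, and the derivative costs a factor s⁻¹. This
removes any harmonic remainder from the representation of ∇p. -/
theorem tendsto_gradMean_atTop (b : Module.Basis (Fin n) ℝ (Space n)) {P : Space n → ℝ}
    (hP : LocallyIntegrable P)
    (hper : ∀ x, ∀ γ ∈ Submodule.span ℤ (range b), P (x + γ) = P x) {ψ : Space n → ℝ}
    (hψ : IsTest ψ) (l : Fin n) (x : Space n) :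
    Tendsto (fun N : ℕ => gradMean ψ l ((2 : ℝ) ^ N) P x) atTop (𝓝 0) := by
  obtain ⟨C, hC⟩ := exists_abs_scaledConv_le_of_periodic b hP hper (hψ.pd l) x
  have h1 : Tendsto (fun N : ℕ => ((2 : ℝ) ^ N)⁻¹ * C) atTop (𝓝 0) := by
    simpa using (tendsto_inv_atTop_zero.comp
      (tendsto_pow_atTop_atTop_of_one_lt (one_lt_two (α := ℝ)))).mul_const C
  refine squeeze_zero_norm (fun N => ?_) h1
  rw [gradMean, norm_mul, Real.norm_of_nonneg (by positivity)]
  exact mul_le_mul_of_nonneg_left (hC _ (one_le_pow₀ one_le_two)) (by positivity)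

/-- The decay of `g` at +∞ identifies `g 0` with the sum over k ≥ 0, and the remaining steps down to
−N add the negative indices. The bound uniform in N serves as the majorant for dominated
convergence. -/
theorem telescope_int {T g : ℤ → ℝ} {B : ℤ → ℝ} (hB : Summable B) (hT : ∀ k, |T k| ≤ B k)
    (hg : ∀ k, g (k + 1) - g k = -T k) (hlim : Tendsto (fun N : ℕ => g N) atTop (𝓝 0)) :
    Tendsto (fun N : ℕ => g (-N)) atTop (𝓝 (∑' k, T k)) ∧ ∀ N : ℕ, |g (-N)| ≤ ∑' k, B k := by
  have hTs : Summable T := Summable.of_norm_bounded hB hT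
  have hi1 : Function.Injective fun j : ℕ => (j : ℤ) := Nat.cast_injective
  have hi2 : Function.Injective fun j : ℕ => (-(j + 1) : ℤ) := fun a b h => by
    simp only at h; omega
  have s1 : Summable fun j : ℕ => T j := hTs.comp_injective hi1
  have s2 : Summable fun j : ℕ => T (-(j + 1)) := hTs.comp_injective hi2
  have b1 : Summable fun j : ℕ => B j := hB.comp_injective hi1
  have b2 : Summable fun j : ℕ => B (-(j + 1)) := hB.comp_injective hi2
  have hB0 : ∀ k, 0 ≤ B k := fun k => (abs_nonneg _).trans (hT k)
  have e1 : ∀ N : ℕ, ∑ j ∈ Finset.range N, T j = g 0 - g N := by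
    intro N
    have := Finset.sum_range_sub' (fun j : ℕ => g j) N
    rw [Nat.cast_zero] at this
    rw [← this]
    refine Finset.sum_congr rfl fun j _ => ?_
    have := hg j
    push_cast
    linarith
  have e2 : ∀ N : ℕ, ∑ j ∈ Finset.range N, T (-(j + 1)) = g (-N) - g 0 := by
    intro N
    have := Finset.sum_range_sub (fun j : ℕ => g (-j)) N
    simp only [Nat.cast_zero, neg_zero] at this
    rw [← this]
    refine Finset.sum_congr rfl fun j _ => ?_
    have := hg (-(j + 1))
    rw [show (-((j : ℤ) + 1) + 1) = -j by ring] at this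
    push_cast
    linarith
  have h0 : g 0 = ∑' j : ℕ, T j := by
    refine tendsto_nhds_unique ?_ s1.hasSum.tendsto_sum_nat
    simp_rw [e1]
    simpa using hlim.const_sub (g 0)
  have hsum : ∑' k, T k = g 0 + ∑' j : ℕ, T (-(j + 1)) := by
    rw [h0]
    exact (HasSum.of_nat_of_neg_add_one s1.hasSum s2.hasSum).tsum_eq
  have hsumB : ∑' k, B k = (∑' j : ℕ, B j) + ∑' j : ℕ, B (-(j + 1)) :=
    (HasSum.of_nat_of_neg_add_one b1.hasSum b2.hasSum).tsum_eq
  have e3 : ∀ N : ℕ, g (-N) = g 0 + ∑ j ∈ Finset.range N, T (-(j + 1)) := fun N => by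
    rw [e2]; ring
  constructor
  · rw [hsum]
    simp_rw [e3]
    exact s2.hasSum.tendsto_sum_nat.const_add (g 0)
  · intro N
    rw [e3, hsumB]
    refine (abs_add_le _ _).trans (add_le_add ?_ ?_)
    · rw [h0]
      exact tsum_of_norm_bounded (f := fun j : ℕ => T j) b1.hasSum fun j => hT j
    · refine (Finset.abs_sum_le_sum_abs _ _).trans
        ((Finset.sum_le_sum fun j _ => hT _).trans ?_)
      exact b2.sum_le_tsum _ fun j _ => hB0 _

/-- The pressure `P` and the velocity field `u` satisfy the Poisson equation
`-Δ P = ∑ᵢⱼ ∂ᵢ∂ⱼ (uⁱ uʲ)` and `div u = 0` when tested against the dilated kernels. -/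
structure IsPressureSlice (W : Space n → ℝ) (u : Space n → Space n) (P : Space n → ℝ) : Prop where
  integrable : LocallyIntegrable P
  divFree : ∀ (k : ℤ) (a l : Fin n), ScaledDivFree (pd a (pd l W)) ((2 : ℝ) ^ k) u
  poisson : ∀ (k : ℤ) (l : Fin n) (x : Space n),
    ∑ i, scaledConv (pd i (pd i (pd l W))) ((2 : ℝ) ^ k) P x =
      -∑ i, ∑ j, scaledConv (pd j (pd i (pd l W))) ((2 : ℝ) ^ k) (fun y => u y j * u y i) x

/-- The limit of ∫ χ · `gradMean` at scale 2⁻ᴺ is computed in two ways: pointwise through the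
telescoping series, and by moving both mollification and derivative onto χ. -/
theorem IsPressureSlice.integral_pd_mul {W ψ : Space n → ℝ} (hW : IsDyadicPotential W ψ)
    {u : Space n → Space n} {P : Space n → ℝ} (h : IsPressureSlice W u P)
    (b : Module.Basis (Fin n) ℝ (Space n))
    (hper : ∀ x, ∀ γ ∈ Submodule.span ℤ (range b), P (x + γ) = P x) {M α : ℝ} (hα : 1 / 2 < α)
    (huc : Continuous u) (hu : ∀ i, HolderBound M α fun x => u x i) {χ : Space n → ℝ}
    (hχ : IsTest χ) (l : Fin n) :
    ∫ x, pd l χ x * P x = -∫ x, χ x * gradPress W l u x := by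
  obtain ⟨C, hC0, hC⟩ := exists_abs_pressTerm_le hW.test (M := M) (show 0 < α by linarith)
  have hB : Summable fun k : ℤ => C * scaleWeight (2 * α - 1) ((2 : ℝ) ^ k) :=
    (summable_scaleWeight (by linarith)).mul_left C
  have hpos : ∀ k : ℤ, (0 : ℝ) < 2 ^ k := fun k => by positivity
  have key := fun x => telescope_int (T := fun k => pressTerm W l ((2 : ℝ) ^ k) u x)
    (g := fun k => gradMean ψ l ((2 : ℝ) ^ k) P x) hB
    (fun k => hC u huc hu _ (hpos k) l (fun a => h.divFree k a l) x)
    (fun k => by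
      have := hW.gradMean_sub (hpos k) h.integrable l x (h.poisson k l x)
      rw [← this, zpow_add_one₀ two_ne_zero, mul_comm _ (2 : ℝ)])
    (by simpa using tendsto_gradMean_atTop b h.integrable hper hW.test_mean l x)
  have hcont : ∀ k : ℤ, Continuous (gradMean ψ l ((2 : ℝ) ^ k) P) := fun k =>
    (continuous_scaledConv (hW.test_mean.pd l) (hpos k) h.integrable).const_mul _
  have lim1 : Tendsto (fun N : ℕ => ∫ x, χ x * gradMean ψ l ((2 : ℝ) ^ (-(N : ℤ))) P x) atTop
      (𝓝 (∫ x, χ x * gradPress W l u x)) := by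
    refine tendsto_integral_filter_of_dominated_convergence
      (fun x => |χ x| * ∑' k : ℤ, C * scaleWeight (2 * α - 1) ((2 : ℝ) ^ k)) ?_ ?_
      (hχ.integrable.abs.mul_const _) ?_
    · exact Eventually.of_forall fun N => (hχ.continuous.mul (hcont _)).aestronglyMeasurable
    · refine Eventually.of_forall fun N => Eventually.of_forall fun x => ?_
      rw [norm_mul]
      exact mul_le_mul_of_nonneg_left ((key x).2 N) (abs_nonneg _)
    · exact Eventually.of_forall fun x => (key x).1.const_mul _
  have hlim0 : Tendsto (fun N : ℕ => -((2 : ℝ) ^ (-(N : ℤ)))) atTop (𝓝 0) := by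
    have : Tendsto (fun N : ℕ => ((2 : ℝ)⁻¹) ^ N) atTop (𝓝 0) :=
      tendsto_pow_atTop_nhds_zero_of_lt_one (by norm_num) (by norm_num)
    simpa using this.neg
  have lim2 := (tendsto_integral_mul_scaledConv hW.test_mean hW.integral_mean (hχ.pd l)
    h.integrable hlim0).neg
  -- Duality turns the scale s into −s; the derivative moved from ψ to χ yields −s, which cancels
  -- the prefactor s⁻¹ up to sign.
  have e : ∀ N : ℕ, ∫ x, χ x * gradMean ψ l ((2 : ℝ) ^ (-(N : ℤ))) P x =
      -∫ x, P x * scaledConv ψ (-((2 : ℝ) ^ (-(N : ℤ)))) (pd l χ) x := by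
    intro N
    have hne := (hpos (-(N : ℤ))).ne'
    set s := (2 : ℝ) ^ (-(N : ℤ)) with hs
    calc _ = s⁻¹ * ∫ x, χ x * scaledConv (pd l ψ) s P x := by
          rw [← integral_const_mul]
          refine integral_congr_ae (Eventually.of_forall fun x => ?_)
          simp only [gradMean]
          ring
      _ = s⁻¹ * ∫ x, -s * (P x * scaledConv ψ (-s) (pd l χ) x) := by
          rw [integral_mul_scaledConv (hW.test_mean.pd l) hχ h.integrable]
          congr 1
          refine integral_congr_ae (Eventually.of_forall fun x => ?_)
          simp only
          rw [scaledConv_pd hW.test_mean (hχ.smooth.of_le (by simp))]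
          ring
      _ = _ := by
          rw [integral_const_mul]
          field_simp
  have := tendsto_nhds_unique lim1 (lim2.congr fun N => (e N).symm)
  rw [this, neg_neg]
  simp_rw [mul_comm (P _)]

/-- Bound and Hölder continuity of the pressure gradient of a Hölder continuous field. -/
theorem exists_holderBound_gradPress {W : Space n → ℝ} (hW : IsTest W) {M α θ : ℝ}
    (hθ : 0 < θ) (hθα : θ < 2 * α - 1) (hα : α < 1) :
    ∃ C, 0 ≤ C ∧ ∀ u : Space n → Space n, Continuous u → (∀ i, HolderBound M α fun x => u x i) →
      (∀ (k : ℤ) (a l : Fin n), ScaledDivFree (pd a (pd l W)) ((2 : ℝ) ^ k) u) →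
      ∀ l, HolderBound C θ (gradPress W l u) := by
  obtain ⟨C₁, hC₁0, hC₁⟩ := exists_abs_pressTerm_le hW (M := M) (show 0 < α by linarith)
  -- θ ≤ α holds because θ < 2α − 1 < α, the last step by α < 1.
  obtain ⟨C₂, hC₂0, hC₂⟩ := exists_abs_pressTerm_sub_le hW (M := M) hθ
    (show θ ≤ α by linarith)
  have hpos : ∀ k : ℤ, (0 : ℝ) < 2 ^ k := fun k => by positivity
  have s1 := (summable_scaleWeight (show 0 < 2 * α - 1 by linarith)).mul_left C₁
  have s2 := (summable_scaleWeight (show 0 < 2 * α - 1 - θ by linarith)).mul_left C₂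
  set S₁ := ∑' k : ℤ, C₁ * scaleWeight (2 * α - 1) ((2 : ℝ) ^ k) with hS₁
  set S₂ := ∑' k : ℤ, C₂ * scaleWeight (2 * α - 1 - θ) ((2 : ℝ) ^ k) with hS₂
  have h1 : 0 ≤ S₁ := tsum_nonneg fun k => mul_nonneg hC₁0 (scaleWeight_nonneg _ (hpos k))
  have h2 : 0 ≤ S₂ := tsum_nonneg fun k => mul_nonneg hC₂0 (scaleWeight_nonneg _ (hpos k))
  refine ⟨S₁ + S₂, by positivity, fun u huc hu hdiv l => ⟨fun x => ?_, fun x y => ?_⟩⟩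
  · have := tsum_of_norm_bounded s1.hasSum
      (f := fun k : ℤ => pressTerm W l ((2 : ℝ) ^ k) u x)
      fun k => hC₁ u huc hu _ (hpos k) l (fun a => hdiv k a l) x
    exact le_trans this (by linarith)
  · have hsum : ∀ x, Summable fun k : ℤ => pressTerm W l ((2 : ℝ) ^ k) u x := fun x =>
      Summable.of_norm_bounded s1 fun k => hC₁ u huc hu _ (hpos k) l (fun a => hdiv k a l) x
    have := tsum_of_norm_bounded (s2.mul_right (‖x - y‖ ^ θ)).hasSum
      (f := fun k : ℤ => pressTerm W l ((2 : ℝ) ^ k) u x - pressTerm W l ((2 : ℝ) ^ k) u y)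
      fun k => hC₂ u huc hu _ (hpos k) l (fun a => hdiv k a l) x y
    rw [(hsum x).tsum_sub (hsum y), tsum_mul_right] at this
    refine le_trans this (mul_le_mul_of_nonneg_right (by linarith) (by positivity))

namespace IsEulerSolution

variable {I : Opens ℝ} {v : SpaceTime n → Space n} {p : SpaceTime n → ℝ}

theorem ae_isPressureSlice (h : IsEulerSolution I v p) (hi : HasIntegrableTerms I v p)
    {W : Space n → ℝ} (hW : IsTest W) :
    ∀ᵐ t, t ∈ I → IsPressureSlice W (fun x => v (t, x)) fun x => p (t, x) := by
  have hpos : ∀ k : ℤ, (0 : ℝ) < 2 ^ k := fun k => by positivity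
  filter_upwards [ae_locallyIntegrable_slice hi.pressure,
    ae_all_iff.2 fun k : ℤ => ae_all_iff.2 fun a => ae_all_iff.2 fun l =>
      h.ae_scaledConv_divergence hi ((hW.pd l).pd a) (hpos k),
    ae_all_iff.2 fun k : ℤ => ae_all_iff.2 fun l =>
      h.ae_scaledConv_poisson hi (hW.pd l) (hpos k)] with t h1 h2 h3 htI
  exact ⟨h1 htI, fun k a l => h2 k a l htI, fun k l => h3 k l htI⟩

end IsEulerSolution

/-! ### Continuity of the velocity in time. -/

theorem exists_continuousOn_extension {X Y : Type*} [PseudoMetricSpace X] [MetricSpace Y]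
    [CompleteSpace Y] {f : X → Y} {E I : Set X} (hI : I ⊆ closure E)
    (hf : ∀ ε > 0, ∃ δ > 0, ∀ s ∈ E, ∀ t ∈ E, dist s t < δ → dist (f s) (f t) < ε) :
    ∃ g : X → Y, ContinuousOn g I ∧ ∀ t ∈ E, g t = f t := by
  have hlim : ∀ x ∈ I, ∃ y, Tendsto f (𝓝[E] x) (𝓝 y) := by
    intro x hx
    have : (𝓝[E] x).NeBot := mem_closure_iff_nhdsWithin_neBot.1 (hI hx)
    refine cauchy_map_iff_exists_tendsto.1 (Metric.cauchy_iff.2 ⟨inferInstance, fun ε hε => ?_⟩)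
    obtain ⟨δ, hδ, h⟩ := hf ε hε
    refine ⟨f '' (Metric.ball x (δ / 2) ∩ E), image_mem_map (inter_mem
      (mem_nhdsWithin_of_mem_nhds (Metric.ball_mem_nhds x (half_pos hδ))) self_mem_nhdsWithin), ?_⟩
    rintro _ ⟨s, hs, rfl⟩ _ ⟨t, ht, rfl⟩
    refine h s hs.2 t ht.2 ?_
    have h1 := Metric.mem_ball.1 hs.1
    have h2 := Metric.mem_ball'.1 ht.1
    linarith [dist_triangle s x t]
  refine ⟨extendFrom E f, continuousOn_extendFrom hI hlim, fun t ht => ?_⟩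
  have hfc : ContinuousOn f E := by
    rw [Metric.continuousOn_iff]
    intro t ht ε hε
    obtain ⟨δ, hδ, h⟩ := hf ε hε
    exact ⟨δ, hδ, fun s hs hst => h s hs t ht hst⟩
  exact extendFrom_extends hfc t ht

theorem exists_abs_scaledConv_le {K : Space n → ℝ} (hK : IsTest K) :
    ∃ A, 0 ≤ A ∧ ∀ (f : Space n → ℝ) (B : ℝ), (∀ x, |f x| ≤ B) → ∀ s x,
      |scaledConv K s f x| ≤ A * B := by
  obtain ⟨R, A, -, hA, hb⟩ := hK.exists_integral_bound
  exact ⟨A, hA, fun f B hf s x => hb _ _ fun y _ => hf _⟩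

theorem exists_abs_scaledConv_sub_le {ψ : Space n → ℝ} (hψ : IsTest ψ) (hψ1 : ∫ y, ψ y = 1)
    {M α : ℝ} (hα : 0 < α) :
    ∃ C, 0 ≤ C ∧ ∀ f : Space n → ℝ, HolderBound M α f → ∀ s, 0 < s → ∀ x,
      |scaledConv ψ s f x - f x| ≤ C * min 1 s ^ α := by
  obtain ⟨R, A, hR, hA, hb⟩ := hψ.exists_integral_bound
  have hR0 : 0 < R := by linarith
  refine ⟨A * (2 * |M| * R ^ α), by positivity, fun f hf s hs x => ?_⟩
  have h1 : scaledConv ψ s f x - f x = ∫ y, ψ y * (f (x - s • y) - f x) := by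
    simp_rw [mul_sub]
    rw [integral_sub (hψ.integrable_mul_comp (hf.continuous hα) s x)
      (hψ.integrable.mul_const _), integral_mul_const, hψ1, one_mul]
    rfl
  rw [h1, mul_assoc]
  refine hb _ _ fun y hy => ?_
  rw [abs_of_nonneg hf.nonneg]
  exact hf.abs_diff_le hα.le hR hs x hy

theorem closure_superset_of_ae {I E : Set ℝ} (hI : IsOpen I) (hE : ∀ᵐ t, t ∈ I → t ∈ E) :
    I ⊆ closure (I ∩ E) := by
  have hd := Measure.dense_of_ae hE
  intro t ht
  rw [mem_closure_iff]
  intro o ho hto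
  obtain ⟨r, hr, hr'⟩ := hd.inter_open_nonempty (o ∩ I) (ho.inter hI) ⟨t, hto, ht⟩
  exact ⟨r, hr.1, hr.2, hr' hr.2⟩

namespace IsEulerSolution

variable {I : Opens ℝ} {v : SpaceTime n → Space n} {p : SpaceTime n → ℝ}

/-- Almost every time slice of the pressure gradient is the function `gradPress`. -/
theorem ae_integral_pd_mul_pressure (h : IsEulerSolution I v p) (hi : HasIntegrableTerms I v p)
    {W ψ : Space n → ℝ} (hW : IsDyadicPotential W ψ) (b : Module.Basis (Fin n) ℝ (Space n))
    (hper : IsPeriodic b I p) {M α : ℝ} (hα : 1 / 2 < α)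
    (hvc : ∀ t ∈ I, Continuous fun x => v (t, x))
    (hv : ∀ t ∈ I, ∀ i, HolderBound M α fun x => v (t, x) i) :
    ∀ᵐ t, t ∈ I → ∀ (χ : Space n → ℝ), IsTest χ → ∀ l,
      ∫ x, pd l χ x * p (t, x) = -∫ x, χ x * gradPress W l (fun x => v (t, x)) x := by
  filter_upwards [h.ae_isPressureSlice hi hW.test] with t ht htI χ hχ l
  exact (ht htI).integral_pd_mul hW b (hper t htI) hα (hvc t htI) (hv t htI) hχ l

/-- The pressure contribution is bounded through `gradPress`, since p itself has no uniform bound.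
The constant depends on the scale s but not on t or x. -/
theorem exists_ae_abs_force_le (h : IsEulerSolution I v p) (hi : HasIntegrableTerms I v p)
    {W ψ : Space n → ℝ} (hW : IsDyadicPotential W ψ) (b : Module.Basis (Fin n) ℝ (Space n))
    (hper : IsPeriodic b I p) {M α : ℝ} (hα : 1 / 2 < α) (hα1 : α < 1)
    (hvc : ∀ t ∈ I, Continuous fun x => v (t, x))
    (hv : ∀ t ∈ I, ∀ i, HolderBound M α fun x => v (t, x) i) {s : ℝ} (hs : 0 < s) :
    ∃ C, ∀ᵐ t, t ∈ I → ∀ x i,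
      |(∑ k, ∫ y, pd k (kerAt ψ s x) y * (v (t, y) k * v (t, y) i)) +
        ∫ y, pd i (kerAt ψ s x) y * p (t, y)| ≤ C := by
  -- Any exponent in (0, 2α − 1) would do here; only the supremum bound is used.
  obtain ⟨Q, hQ0, hQ⟩ := exists_holderBound_gradPress hW.test (M := M)
    (show 0 < (2 * α - 1) / 2 by linarith) (show (2 * α - 1) / 2 < 2 * α - 1 by linarith) hα1
  choose A hA0 hA using fun k => exists_abs_scaledConv_le (hW.test_mean.pd k)
  obtain ⟨A', hA'0, hA'⟩ := exists_abs_scaledConv_le hW.test_mean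
  refine ⟨(∑ k, s⁻¹ * (s ^ n * (A k * (M * M)))) + s ^ n * (A' * Q), ?_⟩
  filter_upwards [h.ae_isPressureSlice hi hW.test,
    h.ae_integral_pd_mul_pressure hi hW b hper hα hvc hv] with t h1 h2 htI x i
  have hM := (hv t htI i).nonneg
  refine (abs_add_le _ _).trans (add_le_add ?_ ?_)
  · refine (Finset.abs_sum_le_sum_abs _ _).trans (Finset.sum_le_sum fun k _ => ?_)
    rw [integral_pd_kerAt_mul hW.test_mean hs, abs_mul, abs_neg, abs_of_pos (inv_pos.2 hs),
      abs_mul, abs_of_pos (pow_pos hs n)]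
    have := hA k (fun y => v (t, y) k * v (t, y) i) (M * M) (fun y => by
      rw [abs_mul]
      exact mul_le_mul ((hv t htI k).bound y) ((hv t htI i).bound y) (abs_nonneg _) hM) s x
    gcongr
  · rw [h2 htI _ (hW.test_mean.kerAt hs x) i, abs_neg, integral_kerAt_mul _ _ hs, abs_mul,
      abs_of_pos (pow_pos hs n)]
    have := hA' (gradPress W i fun x => v (t, x)) Q
      (hQ _ (hvc t htI) (hv t htI) (h1 htI).divFree i).bound s x
    gcongr

/-- At fixed scale the mollified velocity is, for almost every time, a primitive of a bounded force.
Centres from a dense sequence give a single set of good times, and continuity in x extends the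
Lipschitz bound to all centres. -/
theorem exists_ae_abs_scaledConv_sub_le (h : IsEulerSolution I v p)
    (hI : (I : Set ℝ).OrdConnected) (hi : HasIntegrableTerms I v p)
    {W ψ : Space n → ℝ} (hW : IsDyadicPotential W ψ) (b : Module.Basis (Fin n) ℝ (Space n))
    (hper : IsPeriodic b I p) {M α : ℝ} (hα : 1 / 2 < α) (hα1 : α < 1)
    (hvc : ∀ t ∈ I, Continuous fun x => v (t, x))
    (hv : ∀ t ∈ I, ∀ i, HolderBound M α fun x => v (t, x) i) {s : ℝ} (hs : 0 < s) {t₀ : ℝ}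
    (ht₀ : t₀ ∈ I) :
    ∃ C, 0 ≤ C ∧ ∃ E : Set ℝ, (∀ᵐ t, t ∈ I → t ∈ E) ∧ ∀ t ∈ (I : Set ℝ) ∩ E,
      ∀ t' ∈ (I : Set ℝ) ∩ E, ∀ x i,
        |scaledConv ψ s (fun y => v (t, y) i) x - scaledConv ψ s (fun y => v (t', y) i) x| ≤
          C * |t - t'| := by
  obtain ⟨C, hC⟩ := h.exists_ae_abs_force_le hi hW b hper hα hα1 hvc hv hs
  choose c hc using fun (m : ℕ) (i : Fin n) => h.ae_momentum_pairing hI hi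
    (hW.test_mean.kerAt hs (denseSeq (Space n) m)) i ht₀
  refine ⟨(s ^ n)⁻¹ * |C|, by positivity, {t | ∀ (m : ℕ) (i : Fin n),
    ∫ y, kerAt ψ s (denseSeq (Space n) m) y * v (t, y) i = c m i + ∫ r in t₀..t,
      ((∑ k, ∫ y, pd k (kerAt ψ s (denseSeq (Space n) m)) y * (v (r, y) k * v (r, y) i)) +
        ∫ y, pd i (kerAt ψ s (denseSeq (Space n) m)) y * p (r, y))}, ?_, ?_⟩
  · filter_upwards [ae_all_iff.2 fun m => ae_all_iff.2 fun i => hc m i] with t ht htI m i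
    exact ht m i htI
  · rintro t ⟨htI, ht⟩ t' ⟨htI', ht'⟩ x i
    have hcont : ∀ t ∈ I, Continuous fun x => scaledConv ψ s (fun y => v (t, y) i) x :=
      fun t ht => continuous_scaledConv hW.test_mean hs
        (((hv t ht i).continuous (by linarith)).locallyIntegrable)
    have hclosed : IsClosed {x | |scaledConv ψ s (fun y => v (t, y) i) x -
        scaledConv ψ s (fun y => v (t', y) i) x| ≤ (s ^ n)⁻¹ * |C| * |t - t'|} :=
      isClosed_le ((hcont t htI).sub (hcont t' htI')).abs continuous_const
    refine (denseRange_denseSeq (Space n)).induction_on x hclosed fun m => ?_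
    rw [scaledConv_eq_kerAt _ _ hs, scaledConv_eq_kerAt _ _ hs, ← mul_sub, abs_mul,
      abs_of_pos (by positivity), mul_assoc, ht m i, ht' m i, add_sub_add_left_eq_sub]
    refine mul_le_mul_of_nonneg_left ?_ (by positivity)
    have hint := locallyIntegrableOn_force hi (hW.test_mean.kerAt hs (denseSeq (Space n) m)) i
    rw [intervalIntegral.integral_interval_sub_left
      (intervalIntegrable_of_locallyIntegrableOn hI hint ht₀ htI)
      (intervalIntegrable_of_locallyIntegrableOn hI hint ht₀ htI')]
    rw [← Real.norm_eq_abs (∫ r in t'..t, _)]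
    apply intervalIntegral.norm_integral_le_of_norm_le_const_ae
    filter_upwards [hC] with r hr hr'
    exact (hr (hI.uIcc_subset htI' htI (uIoc_subset_uIcc hr')) _ i).trans (le_abs_self C)

/-- An ε/3 argument: a scale is fixed at which mollification changes every slice by less than ε/3
uniformly in time, and the Lipschitz constant of that scale then determines δ. -/
theorem exists_ae_uniform (h : IsEulerSolution I v p)
    (hI : (I : Set ℝ).OrdConnected) (hi : HasIntegrableTerms I v p)
    {W ψ : Space n → ℝ} (hW : IsDyadicPotential W ψ) (b : Module.Basis (Fin n) ℝ (Space n))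
    (hper : IsPeriodic b I p) {M α : ℝ} (hα : 1 / 2 < α) (hα1 : α < 1)
    (hvc : ∀ t ∈ I, Continuous fun x => v (t, x))
    (hv : ∀ t ∈ I, ∀ i, HolderBound M α fun x => v (t, x) i) {t₀ : ℝ} (ht₀ : t₀ ∈ I) :
    ∃ E : Set ℝ, (∀ᵐ t, t ∈ I → t ∈ E) ∧ ∀ ε > 0, ∃ δ > 0, ∀ t ∈ (I : Set ℝ) ∩ E,
      ∀ t' ∈ (I : Set ℝ) ∩ E, dist t t' < δ → ∀ i x, |v (t, x) i - v (t', x) i| ≤ ε := by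
  have hpos : ∀ m : ℕ, (0 : ℝ) < (2⁻¹ : ℝ) ^ m := fun m => by positivity
  choose C hC0 E hE hEC using fun m : ℕ =>
    h.exists_ae_abs_scaledConv_sub_le hI hi hW b hper hα hα1 hvc hv (hpos m) ht₀
  obtain ⟨A, hA0, hA⟩ := exists_abs_scaledConv_sub_le hW.test_mean hW.integral_mean
    (M := M) (show 0 < α by linarith)
  refine ⟨⋂ m, E m, ?_, fun ε hε => ?_⟩
  · filter_upwards [ae_all_iff.2 hE] with t ht htI
    exact mem_iInter.2 fun m => ht m htI
  · have hlim : Tendsto (fun m : ℕ => A * ((2⁻¹ : ℝ) ^ m) ^ α) atTop (𝓝 0) := by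
      have h1 : Tendsto (fun m : ℕ => (2⁻¹ : ℝ) ^ m) atTop (𝓝 0) :=
        tendsto_pow_atTop_nhds_zero_of_lt_one (by norm_num) (by norm_num)
      have h2 := (h1.rpow_const (p := α) (Or.inr (by linarith))).const_mul A
      rwa [Real.zero_rpow (by linarith), mul_zero] at h2
    obtain ⟨m, hm⟩ := (hlim.eventually (gt_mem_nhds (show 0 < ε / 3 by positivity))).exists
    refine ⟨ε / 3 / (C m + 1), by have := hC0 m; positivity, ?_⟩
    rintro t ⟨htI, ht⟩ t' ⟨htI', ht'⟩ hd i x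
    have e1 := hEC m t ⟨htI, mem_iInter.1 ht m⟩ t' ⟨htI', mem_iInter.1 ht' m⟩ x i
    have e2 := hA _ (hv t htI i) _ (hpos m) x
    have e3 := hA _ (hv t' htI' i) _ (hpos m) x
    have hmin : min 1 ((2⁻¹ : ℝ) ^ m) = (2⁻¹ : ℝ) ^ m :=
      min_eq_right (pow_le_one₀ (by norm_num) (by norm_num))
    rw [hmin] at e2 e3
    have e4 : C m * |t - t'| ≤ ε / 3 := by
      rw [Real.dist_eq, lt_div_iff₀ (by have := hC0 m; positivity)] at hd
      have := abs_nonneg (t - t')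
      nlinarith
    rw [abs_le] at e1 e2 e3 ⊢
    constructor <;> linarith [e1.1, e1.2, e2.1, e2.2, e3.1, e3.2]

/-- A solution of class `L^∞ C^α` agrees at almost every time with a continuous one. -/
theorem exists_continuous_version (h : IsEulerSolution I v p)
    (hI : (I : Set ℝ).OrdConnected) (hi : HasIntegrableTerms I v p)
    {W ψ : Space n → ℝ} (hW : IsDyadicPotential W ψ) (b : Module.Basis (Fin n) ℝ (Space n))
    (hper : IsPeriodic b I p) (hvper : IsPeriodic b I v) {M α : ℝ} (hα : 1 / 2 < α) (hα1 : α < 1)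
    (hvc : ∀ t ∈ I, Continuous fun x => v (t, x))
    (hv : ∀ t ∈ I, ∀ i, HolderBound M α fun x => v (t, x) i) {t₀ : ℝ} (ht₀ : t₀ ∈ I) :
    ∃ u : SpaceTime n → Space n, ContinuousOn u (slab n I) ∧
      (∀ t ∈ I, ∀ i, HolderBound M α fun x => u (t, x) i) ∧ IsPeriodic b I u ∧
      ∀ᵐ t, t ∈ I → ∀ x, v (t, x) = u (t, x) := by
  obtain ⟨E, hE, hEu⟩ := h.exists_ae_uniform hI hi hW b hper hα hα1 hvc hv ht₀
  have hα0 : 0 < α := by linarith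
  -- The slices are regarded as points of the complete space of bounded continuous functions, so
  -- that uniform continuity on the good times yields an extension to `I`. The value 0 outside `I`
  -- plays no role.
  let B : Fin n → ℝ → BoundedContinuousFunction (Space n) ℝ := fun i t =>
    open Classical in if ht : t ∈ I then BoundedContinuousFunction.ofNormedAddCommGroup
      (fun x => v (t, x) i) ((hv t ht i).continuous hα0) M ((hv t ht i).bound) else 0
  have hB : ∀ i, ∀ t ∈ I, ∀ x, B i t x = v (t, x) i := by
    intro i t ht x
    simp [B, ht]
  have hcl : (I : Set ℝ) ⊆ closure ((I : Set ℝ) ∩ E) := closure_superset_of_ae I.isOpen hE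
  have hext : ∀ i, ∃ g : ℝ → BoundedContinuousFunction (Space n) ℝ, ContinuousOn g I ∧
      ∀ t ∈ (I : Set ℝ) ∩ E, g t = B i t := by
    intro i
    refine exists_continuousOn_extension hcl fun ε hε => ?_
    obtain ⟨δ, hδ, hd⟩ := hEu (ε / 2) (half_pos hε)
    refine ⟨δ, hδ, fun s hs t ht hst => lt_of_le_of_lt ?_ (half_lt_self hε)⟩
    refine (BoundedContinuousFunction.dist_le (half_pos hε).le).2 fun x => ?_
    rw [hB i s hs.1, hB i t ht.1, Real.dist_eq]
    exact hd s hs t ht hst i x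
  choose g hgc hgE using hext
  have hge : ∀ i, ∀ t ∈ (I : Set ℝ) ∩ E, ∀ x, g i t x = v (t, x) i := fun i t ht x => by
    rw [hgE i t ht, hB i t ht.1]
  have hgx : ∀ i x, ContinuousOn (fun t => g i t x) I := fun i x =>
    (BoundedContinuousFunction.evalCLM ℝ x).continuous.comp_continuousOn (hgc i)
  -- Closed conditions valid at the good times persist on all of `I`; bounds, Hölder estimates and
  -- periodicity of the extension are obtained in this way.
  have hmem : ∀ {S : Set ℝ} {f : ℝ → ℝ}, IsClosed S → ContinuousOn f I →
      (∀ t ∈ (I : Set ℝ) ∩ E, f t ∈ S) → ∀ t ∈ I, f t ∈ S := by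
    intro S f hS hf hfE t ht
    have h1 : f t ∈ closure (f '' ((I : Set ℝ) ∩ E)) := by
      refine ((hf t ht).mono inter_subset_left).mem_closure_image (hcl ht)
    exact hS.closure_subset_iff.2 (image_subset_iff.2 hfE) h1
  refine ⟨fun z => WithLp.toLp 2 fun i => g i z.1 z.2, ?_, fun t ht i => ⟨fun x => ?_,
    fun x y => ?_⟩, fun t ht x γ hγ => ?_, ?_⟩
  · refine (PiLp.continuous_toLp 2 _).comp_continuousOn (continuousOn_pi.2 fun i => ?_)
    exact continuous_eval.comp_continuousOn
      ((((hgc i).comp continuousOn_fst fun z hz => hz.1)).prodMk continuousOn_snd)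
  · exact hmem (S := {r | |r| ≤ M}) (isClosed_le continuous_abs continuous_const) (hgx i x)
      (fun t ht => by rw [hge i t ht x]; exact (hv t ht.1 i).bound x) t ht
  · exact hmem (S := {r | |r| ≤ M * ‖x - y‖ ^ α}) (isClosed_le continuous_abs continuous_const)
      ((hgx i x).sub (hgx i y))
      (fun t ht => by
        show |g i t x - g i t y| ≤ _
        rw [hge i t ht, hge i t ht]
        exact (hv t ht.1 i).holder x y) t ht
  · ext i
    have := hmem (S := {0}) isClosed_singleton ((hgx i (x + γ)).sub (hgx i x))
      (fun t ht => by
        show g i t (x + γ) - g i t x = 0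
        rw [hge i t ht, hge i t ht, hvper t ht.1 x γ hγ, sub_self]) t ht
    simpa [sub_eq_zero] using this
  · filter_upwards [hE] with t ht htI x
    ext i
    exact (hge i t ⟨htI, ht htI⟩ x).symm

end IsEulerSolution

variable {I : Opens ℝ}

/-! ### The equations at every time for the continuous velocity. -/

/-- A continuous velocity field `u` with pressure gradient `q` that solves the Euler equations
weakly in space and classically in time, with Hölder bounds on both fields. -/
structure IsHolderFlow (I : Opens ℝ) (u q : SpaceTime n → Space n) (M α N θ : ℝ) : Prop where
  continuousOn : ContinuousOn u (slab n I)
  continuousOn_force : ContinuousOn q (slab n I)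
  holder : ∀ t ∈ I, ∀ i, HolderBound M α fun x => u (t, x) i
  holder_force : ∀ t ∈ I, ∀ i, HolderBound N θ fun x => q (t, x) i
  div : ∀ t ∈ I, ∀ χ, IsTest χ → ∑ k, ∫ x, pd k χ x * u (t, x) k = 0
  momentum : ∀ t ∈ I, ∀ χ, IsTest χ → ∀ i, HasDerivAt (fun t => ∫ x, χ x * u (t, x) i)
    ((∑ k, ∫ x, pd k χ x * (u (t, x) k * u (t, x) i)) - ∫ x, χ x * q (t, x) i) t
  poisson : ∀ t ∈ I, ∀ χ, IsTest χ → ∑ i, ∫ x, pd i χ x * q (t, x) i =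
    ∑ i, ∑ k, ∫ x, pd k (pd i χ) x * (u (t, x) k * u (t, x) i)

theorem continuousOn_pairing {χ : Space n → ℝ} (hχ : IsTest χ) {f : SpaceTime n → ℝ}
    (hf : ContinuousOn f (slab n I)) : ContinuousOn (fun t => ∫ x, χ x * f (t, x)) I :=
  continuousOn_integral_mul hχ (F := fun t x => f (t, x)) hf

theorem continuousOn_scaledConv_slice {K : Space n → ℝ} (hK : IsTest K) (s : ℝ)
    {f : SpaceTime n → ℝ} (hf : ContinuousOn f (slab n I)) :
    ContinuousOn (fun z : SpaceTime n => scaledConv K s (fun y => f (z.1, y)) z.2) (slab n I) :=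
  continuousOn_integral_mul hK (F := fun (z : SpaceTime n) y => f (z.1, z.2 - s • y))
    (hf.comp (by fun_prop) fun z hz => ⟨hz.1.1, mem_univ _⟩)

theorem eqOn_of_ae_eq {f g : ℝ → ℝ} (hf : ContinuousOn f I) (hg : ContinuousOn g I)
    (h : ∀ᵐ t, t ∈ I → f t = g t) : ∀ t ∈ I, f t = g t :=
  Measure.eqOn_open_of_ae_eq (μ := volume)
    ((ae_restrict_iff' I.isOpen.measurableSet).2 h) I.isOpen hf hg

theorem hasDerivAt_of_ae_eq_primitive (hI : (I : Set ℝ).OrdConnected) {f g : ℝ → ℝ}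
    (hf : ContinuousOn f I) (hg : ContinuousOn g I) {c t₀ : ℝ} (ht₀ : t₀ ∈ I)
    (h : ∀ᵐ t, t ∈ I → f t = c + ∫ r in t₀..t, g r) : ∀ t ∈ I, HasDerivAt f (g t) t := by
  have hint : ∀ t ∈ I, IntervalIntegrable g volume t₀ t := fun t ht =>
    (hg.mono (hI.uIcc_subset ht₀ ht)).intervalIntegrable
  have hd : ∀ t ∈ I, HasDerivAt (fun t => c + ∫ r in t₀..t, g r) (g t) t := fun t ht =>
    (intervalIntegral.integral_hasDerivAt_right (hint t ht)
      (hg.stronglyMeasurableAtFilter I.isOpen t ht)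
      (hg.continuousAt (I.isOpen.mem_nhds ht))).const_add c
  have heq := eqOn_of_ae_eq hf (fun t ht => (hd t ht).continuousAt.continuousWithinAt) h
  intro t ht
  refine (hd t ht).congr_of_eventuallyEq ?_
  filter_upwards [I.isOpen.mem_nhds ht] with r hr using heq r hr

theorem scaledDivFree_of_pairing {u : Space n → Space n}
    (h : ∀ χ, IsTest χ → ∑ k, ∫ x, pd k χ x * u x k = 0) {K : Space n → ℝ} (hK : IsTest K)
    {s : ℝ} (hs : 0 < s) : ScaledDivFree K s u := by
  intro x
  have := h _ (hK.kerAt hs x)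
  simp only [integral_pd_kerAt_mul hK hs, ← Finset.mul_sum] at this
  have hne' : s ^ n ≠ 0 := pow_ne_zero _ hs.ne'
  simpa [hne', hs.ne'] using this

/-- The Weierstrass test: each dyadic term is continuous on the slab and its bound by `scaleWeight
(2α − 1)` is summable and independent of the point. -/
theorem continuousOn_gradPress {W : Space n → ℝ} (hW : IsTest W) {M α : ℝ} (hα : 1 / 2 < α)
    {u : SpaceTime n → Space n} (huc : ContinuousOn u (slab n I))
    (hu : ∀ t ∈ I, ∀ i, HolderBound M α fun x => u (t, x) i)
    (hdiv : ∀ t ∈ I, ∀ χ, IsTest χ → ∑ k, ∫ x, pd k χ x * u (t, x) k = 0) (l : Fin n) :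
    ContinuousOn (fun z : SpaceTime n => gradPress W l (fun x => u (z.1, x)) z.2)
      (slab n I) := by
  obtain ⟨C, hC0, hC⟩ := exists_abs_pressTerm_le hW (M := M) (show 0 < α by linarith)
  have hpos : ∀ k : ℤ, (0 : ℝ) < 2 ^ k := fun k => by positivity
  have hB : Summable fun k : ℤ => C * scaleWeight (2 * α - 1) ((2 : ℝ) ^ k) :=
    (summable_scaleWeight (by linarith)).mul_left C
  have hus : ∀ t ∈ I, Continuous fun x => u (t, x) := fun t ht =>
    huc.comp_continuous (by fun_prop) fun x => ⟨ht, mem_univ _⟩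
  have hc : ∀ i, ContinuousOn (fun z => u z i) (slab n I) := fun i =>
    (EuclideanSpace.proj (𝕜 := ℝ) i).continuous.comp_continuousOn huc
  refine continuousOn_tsum (fun k => ?_) hB fun k z hz => ?_
  · refine continuousOn_const.mul (continuousOn_finsetSum _ fun i _ =>
      continuousOn_finsetSum _ fun j _ => ?_)
    exact continuousOn_scaledConv_slice (((hW.pd l).pd i).pd j) _ ((hc j).mul (hc i))
  · exact hC _ (hus _ hz.1) (hu _ hz.1) _ (hpos k) l
      (fun a => scaledDivFree_of_pairing (hdiv _ hz.1) ((hW.pd l).pd a) (hpos k)) _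

/-- The pressure gradient of the space-time velocity field `u`. -/
def forceField (W : Space n → ℝ) (u : SpaceTime n → Space n) (z : SpaceTime n) : Space n :=
  WithLp.toLp 2 fun l => gradPress W l (fun x => u (z.1, x)) z.2

theorem gradPress_add_period {W : Space n → ℝ} {l : Fin n} {u : Space n → Space n} {γ : Space n}
    (hu : ∀ x, u (x + γ) = u x) (x : Space n) : gradPress W l u (x + γ) = gradPress W l u x := by
  simp only [gradPress, pressTerm, scaledConv, add_sub_right_comm, hu]

theorem isPeriodic_forceField {W : Space n → ℝ} {u : SpaceTime n → Space n}
    {b : Module.Basis (Fin n) ℝ (Space n)} (hu : IsPeriodic b I u) :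
    IsPeriodic b I (forceField W u) := by
  intro t ht x γ hγ
  ext l
  exact gradPress_add_period (fun x => hu t ht x γ hγ) x

/-- After v is replaced by u, the divergence and Poisson identities compare continuous functions of
time, so validity almost everywhere becomes validity everywhere. The integrated momentum equation
has a continuous integrand and can be differentiated classically. -/
theorem IsEulerSolution.isHolderFlow {v : SpaceTime n → Space n} {p : SpaceTime n → ℝ}
    (h : IsEulerSolution I v p) (hI : (I : Set ℝ).OrdConnected) (hi : HasIntegrableTerms I v p)
    {W ψ : Space n → ℝ} (hW : IsDyadicPotential W ψ) (b : Module.Basis (Fin n) ℝ (Space n))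
    (hper : IsPeriodic b I p) {M α : ℝ} (hα : 1 / 2 < α) (hα1 : α < 1)
    (hvc : ∀ t ∈ I, Continuous fun x => v (t, x))
    (hv : ∀ t ∈ I, ∀ i, HolderBound M α fun x => v (t, x) i)
    {u : SpaceTime n → Space n} (huc : ContinuousOn u (slab n I))
    (hu : ∀ t ∈ I, ∀ i, HolderBound M α fun x => u (t, x) i)
    (hvu : ∀ᵐ t, t ∈ I → ∀ x, v (t, x) = u (t, x)) {θ : ℝ} (hθ : 0 < θ)
    (hθα : θ < 2 * α - 1) {t₀ : ℝ} (ht₀ : t₀ ∈ I) :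
    ∃ N, IsHolderFlow I u (forceField W u) M α N θ := by
  have hc : ∀ i, ContinuousOn (fun z => u z i) (slab n I) := fun i =>
    (EuclideanSpace.proj (𝕜 := ℝ) i).continuous.comp_continuousOn huc
  have hus : ∀ t ∈ I, Continuous fun x => u (t, x) := fun t ht =>
    huc.comp_continuous (by fun_prop) fun x => ⟨ht, mem_univ _⟩
  have hdiv : ∀ t ∈ I, ∀ χ, IsTest χ → ∑ k, ∫ x, pd k χ x * u (t, x) k = 0 := by
    intro t ht χ hχ
    refine eqOn_of_ae_eq (I := I) (f := fun t => ∑ k, ∫ x, pd k χ x * u (t, x) k) (g := fun _ => 0)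
      (continuousOn_finsetSum _ fun k _ => continuousOn_pairing (hχ.pd k) (hc k))
      continuousOn_const ?_ t ht
    filter_upwards [h.ae_divergence_pairing hi hχ, hvu] with t h1 h2 htI
    simpa only [h2 htI] using h1 htI
  have hq : ∀ i, ContinuousOn (fun z => forceField W u z i) (slab n I) := fun i =>
    continuousOn_gradPress hW.test hα huc hu hdiv i
  have hpos : ∀ k : ℤ, (0 : ℝ) < 2 ^ k := fun k => by positivity
  obtain ⟨N, -, hN⟩ := exists_holderBound_gradPress hW.test (M := M) hθ hθα hα1
  have hpress := h.ae_integral_pd_mul_pressure hi hW b hper hα hvc hv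
  refine ⟨N, huc, (PiLp.continuous_toLp 2 _).comp_continuousOn (continuousOn_pi.2 hq), hu,
    fun t ht i => ?_, hdiv, fun t ht χ hχ i => ?_, fun t ht χ hχ => ?_⟩
  · exact hN _ (hus t ht) (hu t ht)
      (fun k a l => scaledDivFree_of_pairing (hdiv t ht) ((hW.test.pd l).pd a) (hpos k)) i
  · obtain ⟨c, hct⟩ := h.ae_momentum_pairing hI hi hχ i ht₀
    refine hasDerivAt_of_ae_eq_primitive hI (continuousOn_pairing hχ (hc i))
      (g := fun t => (∑ k, ∫ x, pd k χ x * (u (t, x) k * u (t, x) i)) -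
        ∫ x, χ x * forceField W u (t, x) i)
      ((continuousOn_finsetSum _ fun k _ => continuousOn_pairing (hχ.pd k)
        ((hc k).mul (hc i))).sub (continuousOn_pairing hχ (hq i))) ht₀ (c := c) ?_ t ht
    filter_upwards [hct, hvu] with t h1 h2 htI
    have e1 := h1 htI
    simp only [h2 htI] at e1
    rw [e1]
    congr 1
    refine intervalIntegral.integral_congr_ae ?_
    filter_upwards [hvu, hpress] with r h3 h4 hr
    have hrI := hI.uIcc_subset ht₀ htI (uIoc_subset_uIcc hr)
    rw [h4 hrI χ hχ i, ← sub_eq_add_neg]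
    simp only [h3 hrI]
    rfl
  · refine eqOn_of_ae_eq (I := I)
      (f := fun t => ∑ i, ∫ x, pd i χ x * forceField W u (t, x) i)
      (g := fun t => ∑ i, ∑ k, ∫ x, pd k (pd i χ) x * (u (t, x) k * u (t, x) i))
      (continuousOn_finsetSum _ fun i _ => continuousOn_pairing (hχ.pd i) (hq i))
      (continuousOn_finsetSum _ fun i _ => continuousOn_finsetSum _ fun k _ =>
        continuousOn_pairing ((hχ.pd i).pd k) ((hc k).mul (hc i))) ?_ t ht
    filter_upwards [h.ae_poisson_pairing hi hχ, hpress, hvu] with t h1 h2 h3 htI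
    have h4 := h1 htI
    simp only [h2 htI _ (hχ.pd _), h3 htI, Finset.sum_neg_distrib] at h4
    exact neg_injective h4

/-! ### Smoothness of mollified functions. -/

theorem scaledConv_eq_convolution (K f : Space n → ℝ) {s : ℝ} (hs : 0 < s) :
    scaledConv K s f = fun x => (s ^ n)⁻¹ *
      convolution f (fun y => K (s⁻¹ • y)) (ContinuousLinearMap.mul ℝ ℝ) volume x := by
  ext x
  rw [scaledConv_eq_kerAt K f hs]
  simp [convolution, kerAt, mul_comm]

theorem contDiff_scaledConv {K : Space n → ℝ} (hK : IsTest K) {s : ℝ} (hs : 0 < s)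
    {f : Space n → ℝ} (hf : LocallyIntegrable f) : ContDiff ℝ ∞ (scaledConv K s f) := by
  have h := hK.comp_smul (inv_ne_zero hs.ne')
  rw [scaledConv_eq_convolution K f hs]
  exact contDiff_const.mul
    (h.supp.contDiff_convolution_right (ContinuousLinearMap.mul ℝ ℝ) hf h.smooth)

theorem pd_scaledConv {K : Space n → ℝ} (hK : IsTest K) {s : ℝ} (hs : 0 < s)
    {f : Space n → ℝ} (hf : LocallyIntegrable f) (i : Fin n) (x : Space n) :
    pd i (scaledConv K s f) x = s⁻¹ * scaledConv (pd i K) s f x := by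
  have h := hK.comp_smul (inv_ne_zero hs.ne')
  have h1 := (h.supp.hasFDerivAt_convolution_right (ContinuousLinearMap.mul ℝ ℝ) hf
    (h.smooth.of_le (by simp)) x).const_mul (s ^ n)⁻¹
  rw [scaledConv_eq_convolution K f hs, pd, h1.fderiv, _root_.smul_apply,
    convolution_precompR_apply _ hf (h.supp.fderiv ℝ) (h.smooth.continuous_fderiv (by simp)),
    scaledConv_eq_convolution _ f hs]
  have e : (fun a => fderiv ℝ (fun y => K (s⁻¹ • y)) a (EuclideanSpace.single i 1)) =
      fun a => s⁻¹ • pd i K (s⁻¹ • a) := pd_comp_smul hK.differentiable s⁻¹ i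
  simp only [e]
  have := congrFun (convolution_smul (𝕜 := ℝ) (L := ContinuousLinearMap.mul ℝ ℝ)
    (μ := volume) (f := f) (g := fun a => pd i K (s⁻¹ • a)) (y := s⁻¹)) x
  simp only [Pi.smul_def] at this
  rw [this]
  simp only [smul_eq_mul]
  ring

variable {I : Opens ℝ}

/-! ### Uniform approximation on the slab. -/

/-- The sequence `a` of bounded continuous functions on the slab converges uniformly to `b`. -/
structure UnifApprox (I : Opens ℝ) (a : ℕ → SpaceTime n → ℝ) (b : SpaceTime n → ℝ) : Prop where
  cont : ∀ m, ContinuousOn (a m) (slab n I)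
  cont_lim : ContinuousOn b (slab n I)
  bounded : ∃ B, 0 ≤ B ∧ ∀ m, ∀ z ∈ slab n I, |a m z| ≤ B
  bounded_lim : ∃ B, 0 ≤ B ∧ ∀ z ∈ slab n I, |b z| ≤ B
  unif : ∀ ε > 0, ∀ᶠ m in atTop, ∀ z ∈ slab n I, |a m z - b z| ≤ ε

namespace UnifApprox

variable {a a' : ℕ → SpaceTime n → ℝ} {b b' : SpaceTime n → ℝ}

theorem of_rate {e : ℕ → ℝ} (he : Tendsto e atTop (𝓝 0))
    (hc : ∀ m, ContinuousOn (a m) (slab n I)) (hb : ContinuousOn b (slab n I)) {B : ℝ}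
    (hB : ∀ z ∈ slab n I, |b z| ≤ B) (h : ∀ m, ∀ z ∈ slab n I, |a m z - b z| ≤ e m) :
    UnifApprox I a b where
  cont := hc
  cont_lim := hb
  bounded := by
    obtain ⟨E, hE⟩ := he.bddAbove_range
    refine ⟨|E + B|, abs_nonneg _, fun m z hz => ?_⟩
    have h1 : e m ≤ E := hE ⟨m, rfl⟩
    have h2 := h m z hz
    have h3 := hB z hz
    refine le_trans ?_ (le_abs_self _)
    calc |a m z| = |(a m z - b z) + b z| := by ring_nf
      _ ≤ _ := (abs_add_le _ _).trans (by linarith)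
  bounded_lim := ⟨|B|, abs_nonneg _, fun z hz => (hB z hz).trans (le_abs_self _)⟩
  unif := fun ε hε => by
    filter_upwards [he.eventually (gt_mem_nhds hε)] with m hm z hz
    exact (h m z hz).trans hm.le

theorem add (h : UnifApprox I a b) (h' : UnifApprox I a' b') :
    UnifApprox I (fun m z => a m z + a' m z) fun z => b z + b' z where
  cont := fun m => (h.cont m).add (h'.cont m)
  cont_lim := h.cont_lim.add h'.cont_lim
  bounded := by
    obtain ⟨B, h0, hB⟩ := h.bounded
    obtain ⟨B', h0', hB'⟩ := h'.bounded
    exact ⟨B + B', by positivity, fun m z hz =>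
      (abs_add_le _ _).trans (add_le_add (hB m z hz) (hB' m z hz))⟩
  bounded_lim := by
    obtain ⟨B, h0, hB⟩ := h.bounded_lim
    obtain ⟨B', h0', hB'⟩ := h'.bounded_lim
    exact ⟨B + B', by positivity, fun z hz =>
      (abs_add_le _ _).trans (add_le_add (hB z hz) (hB' z hz))⟩
  unif := fun ε hε => by
    filter_upwards [h.unif _ (half_pos hε), h'.unif _ (half_pos hε)] with m h1 h2 z hz
    rw [add_sub_add_comm]
    exact (abs_add_le _ _).trans (by linarith [h1 z hz, h2 z hz])

theorem mul (h : UnifApprox I a b) (h' : UnifApprox I a' b') :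
    UnifApprox I (fun m z => a m z * a' m z) fun z => b z * b' z where
  cont := fun m => (h.cont m).mul (h'.cont m)
  cont_lim := h.cont_lim.mul h'.cont_lim
  bounded := by
    obtain ⟨B, h0, hB⟩ := h.bounded
    obtain ⟨B', h0', hB'⟩ := h'.bounded
    exact ⟨B * B', by positivity, fun m z hz => by
      rw [abs_mul]
      exact mul_le_mul (hB m z hz) (hB' m z hz) (abs_nonneg _) h0⟩
  bounded_lim := by
    obtain ⟨B, h0, hB⟩ := h.bounded_lim
    obtain ⟨B', h0', hB'⟩ := h'.bounded_lim
    exact ⟨B * B', by positivity, fun z hz => by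
      rw [abs_mul]
      exact mul_le_mul (hB z hz) (hB' z hz) (abs_nonneg _) h0⟩
  unif := fun ε hε => by
    obtain ⟨B, h0, hB⟩ := h.bounded
    obtain ⟨B', h0', hB'⟩ := h'.bounded_lim
    have e0 : 0 < ε / (B + B' + 1) := by positivity
    filter_upwards [h.unif _ e0, h'.unif _ e0] with m h1 h2 z hz
    have e1 : a m z * a' m z - b z * b' z = a m z * (a' m z - b' z) + b' z * (a m z - b z) := by
      ring
    rw [e1]
    calc _ ≤ B * (ε / (B + B' + 1)) + B' * (ε / (B + B' + 1)) := by
          refine (abs_add_le _ _).trans (add_le_add ?_ ?_)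
          · rw [abs_mul]
            exact mul_le_mul (hB m z hz) (h2 z hz) (abs_nonneg _) h0
          · rw [abs_mul]
            exact mul_le_mul (hB' z hz) (h1 z hz) (abs_nonneg _) h0'
      _ = (B + B') * ε / (B + B' + 1) := by ring
      _ ≤ ε := by
          rw [div_le_iff₀ (by positivity)]
          nlinarith

theorem const (hc : ContinuousOn b (slab n I)) {B : ℝ} (hB : ∀ z ∈ slab n I, |b z| ≤ B) :
    UnifApprox I (fun _ => b) b :=
  of_rate (e := fun _ => 0) tendsto_const_nhds (fun _ => hc) hc hB fun m z _ => by simp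

theorem tendstoUniformlyOn_pairing (h : UnifApprox I a b) {χ : Space n → ℝ} (hχ : IsTest χ) :
    TendstoUniformlyOn (fun m t => ∫ x, χ x * a m (t, x)) (fun t => ∫ x, χ x * b (t, x))
      atTop I := by
  obtain ⟨R, A, -, hA, hb⟩ := hχ.exists_integral_bound
  rw [Metric.tendstoUniformlyOn_iff]
  intro ε hε
  filter_upwards [h.unif (ε / (2 * (A + 1))) (by positivity)] with m hm t ht
  have hsl : ∀ {f : SpaceTime n → ℝ}, ContinuousOn f (slab n I) →
      Integrable fun x => χ x * f (t, x) := fun hf => hχ.integrable_mul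
    (hf.comp_continuous (by fun_prop) fun x => ⟨ht, mem_univ _⟩).locallyIntegrable
  rw [dist_comm, Real.dist_eq, ← integral_sub (hsl (h.cont m)) (hsl h.cont_lim)]
  simp_rw [← mul_sub]
  refine (hb _ _ fun y _ => hm (t, y) ⟨ht, mem_univ _⟩).trans_lt ?_
  calc A * (ε / (2 * (A + 1))) = A * ε / (2 * (A + 1)) := by ring
    _ < ε := by
      rw [div_lt_iff₀ (by positivity)]
      nlinarith

end UnifApprox

/-! ### The balance law for products of velocity components. -/

theorem hasDerivAt_integral_mul {χ : Space n → ℝ} (hχ : IsTest χ) {F F' : SpaceTime n → ℝ}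
    (hF : ContinuousOn F (slab n I)) (hF' : ContinuousOn F' (slab n I))
    (hd : ∀ t ∈ I, ∀ x, HasDerivAt (fun t => F (t, x)) (F' (t, x)) t) :
    ∀ t ∈ I, HasDerivAt (fun t => ∫ x, χ x * F (t, x)) (∫ x, χ x * F' (t, x)) t := by
  intro t ht
  obtain ⟨δ, hδ, hball⟩ := Metric.nhds_basis_closedBall.mem_iff.1 (I.isOpen.mem_nhds ht)
  have hsl : ∀ r ∈ I, ∀ {f : SpaceTime n → ℝ}, ContinuousOn f (slab n I) →
      Integrable fun x => χ x * f (r, x) := fun r hr f hf => hχ.integrable_mul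
    (hf.comp_continuous (by fun_prop) fun x => ⟨hr, mem_univ _⟩).locallyIntegrable
  obtain ⟨B, hB⟩ := ((isCompact_closedBall t δ).prod hχ.supp.isCompact).exists_bound_of_continuousOn
    (hF'.mono fun z hz => ⟨hball hz.1, mem_univ _⟩)
  refine (hasDerivAt_integral_of_dominated_loc_of_deriv_le (bound := fun x => |χ x| * B)
    (F := fun t x => χ x * F (t, x)) (F' := fun t x => χ x * F' (t, x))
    (Metric.ball_mem_nhds t hδ) ?_ (hsl t ht hF) (hsl t ht hF').aestronglyMeasurable ?_
    (hχ.integrable.abs.mul_const B) ?_).2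
  · filter_upwards [I.isOpen.mem_nhds ht] with r hr using (hsl r hr hF).aestronglyMeasurable
  · refine Eventually.of_forall fun x r hr => ?_
    by_cases hx : x ∈ tsupport χ
    · rw [norm_mul]
      exact mul_le_mul_of_nonneg_left (hB (r, x) ⟨Metric.ball_subset_closedBall hr, hx⟩)
        (abs_nonneg _)
    · simp [image_eq_zero_of_notMem_tsupport hx]
  · exact Eventually.of_forall fun x r hr =>
      (hd r (hball (Metric.ball_subset_closedBall hr)) x).const_mul _

/-- The commutator of mollification and transport at scale `s`. -/
def commutator (ψ : Space n → ℝ) (s : ℝ) (u : Space n → Space n) (i : Fin n) (x : Space n) : ℝ :=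
  s⁻¹ * ∑ k, ∫ y, pd k ψ y * ((u (x - s • y) k - u x k) * (u (x - s • y) i - u x i))

/-- Expanding the product of increments in `commutator` gives the mollified flux, minus the
transport of the mollified component, minus a multiple of the mollified divergence, which vanishes.
-/
theorem sum_scaledConv_mul_eq {ψ : Space n → ℝ} (hψ : IsTest ψ) {s : ℝ} (hs : 0 < s)
    {u : Space n → Space n} (hu : Continuous u) (hdiv : ScaledDivFree ψ s u) (i : Fin n)
    (x : Space n) :
    s⁻¹ * ∑ k, scaledConv (pd k ψ) s (fun y => u y k * u y i) x =
      commutator ψ s u i x + ∑ k, u x k * pd k (scaledConv ψ s fun y => u y i) x := by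
  have hc : ∀ i, Continuous fun y => u y i := fun i => by fun_prop
  have h1 : ∀ k, ∫ y, pd k ψ y * ((u (x - s • y) k - u x k) * (u (x - s • y) i - u x i)) =
      scaledConv (pd k ψ) s (fun y => u y k * u y i) x -
        u x k * scaledConv (pd k ψ) s (fun y => u y i) x -
        u x i * scaledConv (pd k ψ) s (fun y => u y k) x := by
    intro k
    rw [integral_mul_diff_mul_diff (hψ.pd k) (hc k) (hc i), hψ.integral_pd, mul_zero, add_zero]
  simp_rw [commutator, h1, Finset.sum_sub_distrib, ← Finset.mul_sum, hdiv x,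
    pd_scaledConv hψ hs (hc i).locallyIntegrable]
  simp_rw [mul_left_comm (u x _) s⁻¹, ← Finset.mul_sum]
  ring

/-- The weak divergence identity is tested with χ f g; smoothness of f and g makes this an
admissible test function, while u is only continuous. -/
theorem integral_mul_transport {χ f g : Space n → ℝ} (hχ : IsTest χ) (hf : ContDiff ℝ ∞ f)
    (hg : ContDiff ℝ ∞ g) {u : Space n → Space n} (hu : Continuous u)
    (hdiv : ∀ χ, IsTest χ → ∑ k, ∫ x, pd k χ x * u x k = 0) :
    ∑ k, ∫ x, χ x * (u x k * (pd k f x * g x + f x * pd k g x)) =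
      -∑ k, ∫ x, pd k χ x * (u x k * (f x * g x)) := by
  have hc : ∀ i, Continuous fun y => u y i := fun i => by fun_prop
  have hdf := hf.differentiable (by simp)
  have hdg := hg.differentiable (by simp)
  have hpc : ∀ {f : Space n → ℝ}, ContDiff ℝ ∞ f → ∀ k, Continuous (pd k f) := fun hf k =>
    (hf.continuous_fderiv (by simp)).clm_apply continuous_const
  have h0 := hdiv _ (hχ.mul (hf.mul hg))
  rw [eq_neg_iff_add_eq_zero, ← Finset.sum_add_distrib, ← h0]
  refine Finset.sum_congr rfl fun k _ => ?_
  have := hpc hf k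
  have := hpc hg k
  have := hc k
  have := hf.continuous
  have := hg.continuous
  rw [← integral_add (hχ.integrable_mul (Continuous.locallyIntegrable (by fun_prop)))
    ((hχ.pd k).integrable_mul (Continuous.locallyIntegrable (by fun_prop)))]
  refine integral_congr_ae (Eventually.of_forall fun x => ?_)
  simp only
  rw [pd_mul hχ.differentiable (hdf.fun_mul hdg), pd_mul hdf hdg]
  ring

theorem integral_mul_balance {χ f g a b : Space n → ℝ} (hχ : IsTest χ) (hf : ContDiff ℝ ∞ f)
    (hg : ContDiff ℝ ∞ g) (ha : Continuous a) (hb : Continuous b) {u : Space n → Space n}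
    (hu : Continuous u) (hdiv : ∀ χ, IsTest χ → ∑ k, ∫ x, pd k χ x * u x k = 0) :
    ∫ x, χ x * (-(a x + ∑ k, u x k * pd k f x) * g x + f x * -(b x + ∑ k, u x k * pd k g x)) =
      (∑ k, ∫ x, pd k χ x * (u x k * (f x * g x))) +
        ∫ x, χ x * (-1 * (a x * g x + f x * b x)) := by
  have hc : ∀ i, Continuous fun y => u y i := fun i => by fun_prop
  have hpc : ∀ {f : Space n → ℝ}, ContDiff ℝ ∞ f → ∀ k, Continuous (pd k f) := fun hf k =>
    (hf.continuous_fderiv (by simp)).clm_apply continuous_const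
  have cf := hf.continuous
  have cg := hg.continuous
  have htr := integral_mul_transport hχ hf hg hu hdiv
  rw [← neg_eq_iff_eq_neg] at htr
  have hi : ∀ k ∈ Finset.univ,
      Integrable fun x => χ x * (u x k * (pd k f x * g x + f x * pd k g x)) := fun k _ =>
    hχ.integrable_mul (Continuous.locallyIntegrable
      ((hc k).mul (((hpc hf k).mul cg).add (cf.mul (hpc hg k)))))
  rw [← htr, ← integral_finsetSum _ hi, ← integral_neg,
    ← integral_add (by exact (integrable_finsetSum _ hi).neg)
      (hχ.integrable_mul (Continuous.locallyIntegrable (by fun_prop)))]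
  refine integral_congr_ae (Eventually.of_forall fun x => ?_)
  have e : ∑ k, χ x * (u x k * (pd k f x * g x + f x * pd k g x)) =
      χ x * ((∑ k, u x k * pd k f x) * g x + f x * ∑ k, u x k * pd k g x) := by
    rw [Finset.sum_mul, Finset.mul_sum, ← Finset.sum_add_distrib, Finset.mul_sum]
    exact Finset.sum_congr rfl fun k _ => by ring
  simp only
  rw [e]
  ring

/-- The estimate of Constantin, E and Titi: two Hölder increments against one lost derivative. -/
theorem exists_abs_commutator_le {ψ : Space n → ℝ} (hψ : IsTest ψ) {M α : ℝ} (hα : 0 ≤ α) :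
    ∃ C, 0 ≤ C ∧ ∀ u : Space n → Space n, (∀ i, HolderBound M α fun x => u x i) →
      ∀ s, 0 < s → ∀ i x, |commutator ψ s u i x| ≤ C * scaleWeight (2 * α - 1) s := by
  choose C hC0 hC using fun k : Fin n =>
    exists_abs_integral_diff_mul_diff_le (M := M) (α := α) (M' := M) (α' := α) (hψ.pd k) hα hα
  refine ⟨∑ k, C k, Finset.sum_nonneg fun k _ => hC0 k, fun u hu s hs i x => ?_⟩
  have hm : 0 < min 1 s := lt_min one_pos hs
  have h3 : scaleWeight (2 * α - 1) s = s⁻¹ * (min 1 s ^ α * min 1 s ^ α) := by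
    rw [scaleWeight, ← Real.rpow_add hm]; ring_nf
  rw [commutator, abs_mul, abs_of_pos (inv_pos.2 hs), h3, mul_left_comm]
  refine mul_le_mul_of_nonneg_left ?_ (inv_nonneg.2 hs.le)
  rw [Finset.sum_mul]
  exact (Finset.abs_sum_le_sum_abs _ _).trans
    (Finset.sum_le_sum fun k _ => hC k _ _ (hu k) (hu i) s hs x)

theorem tendsto_two_inv_pow : Tendsto (fun m : ℕ => (2⁻¹ : ℝ) ^ m) atTop (𝓝 0) :=
  tendsto_pow_atTop_nhds_zero_of_lt_one (by norm_num) (by norm_num)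

theorem min_one_two_inv_pow (m : ℕ) : min 1 ((2⁻¹ : ℝ) ^ m) = (2⁻¹ : ℝ) ^ m :=
  min_eq_right (pow_le_one₀ (by norm_num) (by norm_num))

variable {I : Opens ℝ}

theorem continuous_slice_of_continuousOn {Y : Type*} [TopologicalSpace Y] {f : SpaceTime n → Y}
    (hf : ContinuousOn f (slab n I)) {t : ℝ} (ht : t ∈ I) : Continuous fun x => f (t, x) :=
  hf.comp_continuous (by fun_prop) fun _ => ⟨ht, mem_univ _⟩

theorem unifApprox_scaledConv {ψ : Space n → ℝ} (hψ : IsTest ψ) (hψ1 : ∫ y, ψ y = 1) {M α : ℝ}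
    (hα : 0 < α) {f : SpaceTime n → ℝ} (hf : ContinuousOn f (slab n I))
    (hh : ∀ t ∈ I, HolderBound M α fun x => f (t, x)) :
    UnifApprox I (fun m z => scaledConv ψ ((2⁻¹ : ℝ) ^ m) (fun y => f (z.1, y)) z.2) f := by
  obtain ⟨A, hA0, hA⟩ := exists_abs_scaledConv_sub_le hψ hψ1 (M := M) hα
  have hlim : Tendsto (fun m : ℕ => A * ((2⁻¹ : ℝ) ^ m) ^ α) atTop (𝓝 0) := by
    have h2 := (tendsto_two_inv_pow.rpow_const (p := α) (Or.inr hα.le)).const_mul A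
    rwa [Real.zero_rpow hα.ne', mul_zero] at h2
  refine UnifApprox.of_rate hlim (fun m => continuousOn_scaledConv_slice hψ _ hf) hf
    (fun z hz => (hh z.1 hz.1).bound z.2) fun m z hz => ?_
  have := hA _ (hh z.1 hz.1) _ (show (0 : ℝ) < 2⁻¹ ^ m by positivity) z.2
  rwa [min_one_two_inv_pow] at this

namespace IsHolderFlow

variable {u q : SpaceTime n → Space n} {M α N θ : ℝ}

theorem continuousOn_apply (h : IsHolderFlow I u q M α N θ) (i : Fin n) :
    ContinuousOn (fun z => u z i) (slab n I) :=
  (EuclideanSpace.proj (𝕜 := ℝ) i).continuous.comp_continuousOn h.continuousOn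

theorem continuousOn_force_apply (h : IsHolderFlow I u q M α N θ) (i : Fin n) :
    ContinuousOn (fun z => q z i) (slab n I) :=
  (EuclideanSpace.proj (𝕜 := ℝ) i).continuous.comp_continuousOn h.continuousOn_force

theorem continuous_slice (h : IsHolderFlow I u q M α N θ) {t : ℝ} (ht : t ∈ I) :
    Continuous fun x => u (t, x) :=
  continuous_slice_of_continuousOn h.continuousOn ht

theorem continuous_slice_apply (h : IsHolderFlow I u q M α N θ) {t : ℝ} (ht : t ∈ I) (i : Fin n) :
    Continuous fun x => u (t, x) i :=
  continuous_slice_of_continuousOn (h.continuousOn_apply i) ht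

theorem continuous_force_slice_apply (h : IsHolderFlow I u q M α N θ) {t : ℝ} (ht : t ∈ I)
    (i : Fin n) : Continuous fun x => q (t, x) i :=
  continuous_slice_of_continuousOn (h.continuousOn_force_apply i) ht

theorem scaledDivFree (h : IsHolderFlow I u q M α N θ) {t : ℝ} (ht : t ∈ I) {K : Space n → ℝ}
    (hK : IsTest K) {s : ℝ} (hs : 0 < s) : ScaledDivFree K s fun x => u (t, x) :=
  scaledDivFree_of_pairing (h.div t ht) hK hs

theorem hasDerivAt_scaledConv (h : IsHolderFlow I u q M α N θ) {ψ : Space n → ℝ} (hψ : IsTest ψ)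
    {s : ℝ} (hs : 0 < s) {t : ℝ} (ht : t ∈ I) (i : Fin n) (x : Space n) :
    HasDerivAt (fun t => scaledConv ψ s (fun y => u (t, y) i) x)
      (-(s⁻¹ * ∑ k, scaledConv (pd k ψ) s (fun y => u (t, y) k * u (t, y) i) x) -
        scaledConv ψ s (fun y => q (t, y) i) x) t := by
  have h1 := (h.momentum t ht _ (hψ.kerAt hs x) i).const_mul (s ^ n)⁻¹
  simp only [integral_pd_kerAt_mul hψ hs, integral_kerAt_mul _ _ hs] at h1
  have hne : s ^ n ≠ 0 := pow_ne_zero _ hs.ne'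
  simp only [inv_mul_cancel_left₀ hne, ← Finset.mul_sum, mul_sub] at h1
  refine h1.congr_deriv ?_
  field_simp

theorem continuousOn_commutator (h : IsHolderFlow I u q M α N θ) {ψ : Space n → ℝ}
    (hψ : IsTest ψ) (s : ℝ) (i : Fin n) :
    ContinuousOn (fun z : SpaceTime n => commutator ψ s (fun x => u (z.1, x)) i z.2)
      (slab n I) := by
  refine continuousOn_const.mul (continuousOn_finsetSum _ fun k _ => ?_)
  have hsh : ∀ j, ContinuousOn (fun w : SpaceTime n × Space n => u (w.1.1, w.1.2 - s • w.2) j)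
      ((slab n I : Set (SpaceTime n)) ×ˢ univ) := fun j =>
    (h.continuousOn_apply j).comp (f := fun w : SpaceTime n × Space n => (w.1.1, w.1.2 - s • w.2))
      (by fun_prop) fun w hw => ⟨hw.1.1, mem_univ _⟩
  have hfix : ∀ j, ContinuousOn (fun w : SpaceTime n × Space n => u w.1 j)
      ((slab n I : Set (SpaceTime n)) ×ˢ univ) := fun j =>
    (h.continuousOn_apply j).comp continuousOn_fst fun w hw => hw.1
  exact continuousOn_integral_mul (hψ.pd k) (F := fun (z : SpaceTime n) y =>
    (u (z.1, z.2 - s • y) k - u z k) * (u (z.1, z.2 - s • y) i - u z i))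
    (((hsh k).sub (hfix k)).mul ((hsh i).sub (hfix i)))

theorem unifApprox_commutator (h : IsHolderFlow I u q M α N θ) (hα : 1 / 2 < α)
    {ψ : Space n → ℝ} (hψ : IsTest ψ) (i : Fin n) :
    UnifApprox I (fun m z => commutator ψ ((2⁻¹ : ℝ) ^ m) (fun x => u (z.1, x)) i z.2)
      fun _ => 0 := by
  obtain ⟨C, hC0, hC⟩ := exists_abs_commutator_le hψ (M := M) (show 0 ≤ α by linarith)
  have hlim : Tendsto (fun m : ℕ => C * ((2⁻¹ : ℝ) ^ m) ^ (2 * α - 1)) atTop (𝓝 0) := by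
    have h2 := (tendsto_two_inv_pow.rpow_const (p := 2 * α - 1)
      (Or.inr (by linarith))).const_mul C
    rwa [Real.zero_rpow (by linarith), mul_zero] at h2
  refine UnifApprox.of_rate (B := 0) hlim (fun m => h.continuousOn_commutator hψ _ i)
    continuousOn_const (fun z _ => by simp) fun m z hz => ?_
  have hp : (0 : ℝ) < 2⁻¹ ^ m := by positivity
  rw [sub_zero]
  refine (hC _ (h.holder z.1 hz.1) _ hp i z.2).trans (le_of_eq ?_)
  rw [scaleWeight, min_one_two_inv_pow, Real.rpow_add hp, Real.rpow_one,
    inv_mul_cancel_left₀ hp.ne']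

/-- The mollified components are differentiable in time and smooth in space, so the ordinary product
rule applies. The transport part is integrated by parts with `integral_mul_balance`, leaving the
commutators and mollified forces as sources. -/
theorem hasDerivAt_pairing_mollified (h : IsHolderFlow I u q M α N θ) {ψ χ : Space n → ℝ}
    (hψ : IsTest ψ) (hχ : IsTest χ) {s : ℝ} (hs : 0 < s) (i j : Fin n) :
    ∀ t ∈ I, HasDerivAt (fun t => ∫ x, χ x *
        (scaledConv ψ s (fun y => u (t, y) i) x * scaledConv ψ s (fun y => u (t, y) j) x))
      ((∑ k, ∫ x, pd k χ x * (u (t, x) k *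
        (scaledConv ψ s (fun y => u (t, y) i) x * scaledConv ψ s (fun y => u (t, y) j) x))) +
        ∫ x, χ x * (-1 * ((commutator ψ s (fun x => u (t, x)) i x +
            scaledConv ψ s (fun y => q (t, y) i) x) * scaledConv ψ s (fun y => u (t, y) j) x +
          scaledConv ψ s (fun y => u (t, y) i) x * (commutator ψ s (fun x => u (t, x)) j x +
            scaledConv ψ s (fun y => q (t, y) j) x)))) t := by
  have hU : ∀ i, ContinuousOn (fun z : SpaceTime n => scaledConv ψ s (fun y => u (z.1, y) i) z.2)
      (slab n I) := fun i => continuousOn_scaledConv_slice hψ s (h.continuousOn_apply i)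
  have hQ : ∀ i, ContinuousOn (fun z : SpaceTime n => scaledConv ψ s (fun y => q (z.1, y) i) z.2)
      (slab n I) := fun i => continuousOn_scaledConv_slice hψ s (h.continuousOn_force_apply i)
  have hA : ∀ i, ContinuousOn (fun z : SpaceTime n =>
      (-(s⁻¹ * ∑ k, scaledConv (pd k ψ) s (fun y => u (z.1, y) k * u (z.1, y) i) z.2) -
        scaledConv ψ s (fun y => q (z.1, y) i) z.2)) (slab n I) := fun i =>
    (continuousOn_const.mul (continuousOn_finsetSum _ fun k _ => continuousOn_scaledConv_slice
      (hψ.pd k) s ((h.continuousOn_apply k).mul (h.continuousOn_apply i)))).neg.sub (hQ i)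
  intro t ht
  have key := hasDerivAt_integral_mul hχ (F := fun z => scaledConv ψ s (fun y => u (z.1, y) i) z.2 *
      scaledConv ψ s (fun y => u (z.1, y) j) z.2) (F' := fun z =>
        (-(s⁻¹ * ∑ k, scaledConv (pd k ψ) s (fun y => u (z.1, y) k * u (z.1, y) i) z.2) -
          scaledConv ψ s (fun y => q (z.1, y) i) z.2) * scaledConv ψ s (fun y => u (z.1, y) j) z.2 +
        scaledConv ψ s (fun y => u (z.1, y) i) z.2 *
          (-(s⁻¹ * ∑ k, scaledConv (pd k ψ) s (fun y => u (z.1, y) k * u (z.1, y) j) z.2) -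
          scaledConv ψ s (fun y => q (z.1, y) j) z.2)) ((hU i).mul (hU j))
    (((hA i).mul (hU j)).add ((hU i).mul (hA j)))
    (fun t ht x => (h.hasDerivAt_scaledConv hψ hs ht i x).mul
      (h.hasDerivAt_scaledConv hψ hs ht j x)) t ht
  refine key.congr_deriv ?_
  have huc := h.continuous_slice ht
  have hc : ∀ i, Continuous fun y => u (t, y) i := fun i => h.continuous_slice_apply ht i
  have hsm : ∀ i, ContDiff ℝ ∞ (scaledConv ψ s fun y => u (t, y) i) := fun i =>
    contDiff_scaledConv hψ hs (hc i).locallyIntegrable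
  have hR : ∀ i, Continuous fun x => commutator ψ s (fun x => u (t, x)) i x +
      scaledConv ψ s (fun y => q (t, y) i) x := fun i =>
    (continuous_slice_of_continuousOn (h.continuousOn_commutator hψ s i) ht).add
      (continuous_slice_of_continuousOn (hQ i) ht)
  refine Eq.trans ?_ (integral_mul_balance hχ (hsm i) (hsm j) (hR i) (hR j) huc (h.div t ht))
  have e : ∀ i x, -(s⁻¹ * ∑ k, scaledConv (pd k ψ) s (fun y => u (t, y) k * u (t, y) i) x) -
      scaledConv ψ s (fun y => q (t, y) i) x =
      -((commutator ψ s (fun x => u (t, x)) i x + scaledConv ψ s (fun y => q (t, y) i) x) +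
        ∑ k, u (t, x) k * pd k (scaledConv ψ s fun y => u (t, y) i) x) := by
    intro i x
    rw [sum_scaledConv_mul_eq hψ hs huc (h.scaledDivFree ht hψ hs)]
    ring
  refine integral_congr_ae (Eventually.of_forall fun x => ?_)
  simp only [e]

/-- The local balance law of the tensor `u ⊗ u`. -/
theorem hasDerivAt_pairing_mul (h : IsHolderFlow I u q M α N θ) (hα : 1 / 2 < α) (hθ : 0 < θ)
    {ψ χ : Space n → ℝ} (hψ : IsTest ψ) (hψ1 : ∫ y, ψ y = 1) (hχ : IsTest χ) (i j : Fin n) :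
    ∀ t ∈ I, HasDerivAt (fun t => ∫ x, χ x * (u (t, x) i * u (t, x) j))
      ((∑ k, ∫ x, pd k χ x * (u (t, x) k * (u (t, x) i * u (t, x) j))) +
        ∫ x, χ x * (-1 * (q (t, x) i * u (t, x) j + u (t, x) i * q (t, x) j))) t := by
  have hU := fun i => unifApprox_scaledConv hψ hψ1 (show 0 < α by linarith)
    (h.continuousOn_apply i) fun t ht => h.holder t ht i
  have hQ := fun i => unifApprox_scaledConv hψ hψ1 hθ
    (h.continuousOn_force_apply i) fun t ht => h.holder_force t ht i
  have hC := fun i => h.unifApprox_commutator hα hψ i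
  have hu : ∀ k, UnifApprox I (fun _ z => u z k) fun z => u z k := fun k =>
    UnifApprox.const (h.continuousOn_apply k) fun z hz => (h.holder z.1 hz.1 k).bound z.2
  -- The factor −1 is treated as a constant sequence so that the source term is built from sums and
  -- products of `UnifApprox` alone.
  have h1 : UnifApprox I (fun (_ : ℕ) (_ : SpaceTime n) => (-1 : ℝ)) fun _ => -1 :=
    UnifApprox.const (B := 1) continuousOn_const fun z _ => by simp
  intro t ht
  have hs : ∀ m : ℕ, (0 : ℝ) < 2⁻¹ ^ m := fun m => by positivity
  have e1 := fun k => ((hu k).mul ((hU i).mul (hU j))).tendstoUniformlyOn_pairing (hχ.pd k)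
  have e2 := (h1.mul ((((hC i).add (hQ i)).mul (hU j)).add
    ((hU i).mul ((hC j).add (hQ j))))).tendstoUniformlyOn_pairing hχ
  have e3 := ((hU i).mul (hU j)).tendstoUniformlyOn_pairing hχ
  have e4 : TendstoUniformlyOn (fun (m : ℕ) t => ∑ k, ∫ x, pd k χ x * (u (t, x) k *
      (scaledConv ψ ((2⁻¹ : ℝ) ^ m) (fun y => u (t, y) i) x *
        scaledConv ψ ((2⁻¹ : ℝ) ^ m) (fun y => u (t, y) j) x)))
      (fun t => ∑ k, ∫ x, pd k χ x * (u (t, x) k * (u (t, x) i * u (t, x) j))) atTop I := by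
    induction (Finset.univ : Finset (Fin n)) using Finset.induction_on with
    | empty =>
      refine Metric.tendstoUniformlyOn_iff.2 fun ε hε => Eventually.of_forall fun m t _ => ?_
      simpa using hε
    | insert a s ha ih =>
      simp_rw [Finset.sum_insert ha]
      exact (e1 a).add ih
  -- The derivatives converge uniformly in time while the functions converge pointwise, so the limit
  -- is differentiable with the limiting derivative; the commutators disappear.
  have := hasDerivAt_of_tendstoUniformlyOn I.isOpen (e4.add e2)
    (Eventually.of_forall fun m t ht => h.hasDerivAt_pairing_mollified hψ hχ (hs m) i j t ht)
    (fun t ht => e3.tendsto_at ht) ht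
  simp only [zero_add] at this
  exact this

end IsHolderFlow

variable {I : Opens ℝ}

/-! ### The material derivative of one dyadic term. -/

/-- The material derivative of `pressTerm`, for the velocity `u` and the pressure gradient `q`. -/
def pressRate (W : Space n → ℝ) (l : Fin n) (s : ℝ) (u q : Space n → Space n) (x : Space n) : ℝ :=
  s⁻¹ * ∑ i, ∑ j, (-(s⁻¹ * ∑ k, ∫ y, pd k (pd j (pd i (pd l W))) y *
      ((u (x - s • y) k - u x k) * (u (x - s • y) j - u x j) * (u (x - s • y) i - u x i))) -
    (∫ y, pd j (pd i (pd l W)) y * ((q (x - s • y) j - q x j) * (u (x - s • y) i - u x i))) -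
    ∫ y, pd j (pd i (pd l W)) y * ((u (x - s • y) j - u x j) * (q (x - s • y) i - q x i)))

/-- The time derivative of `pressTerm`. -/
def pressTimeRate (W : Space n → ℝ) (l : Fin n) (s : ℝ) (u q : Space n → Space n)
    (x : Space n) : ℝ :=
  s⁻¹ * ∑ i, ∑ j, (-(s⁻¹ * ∑ k, scaledConv (pd k (pd j (pd i (pd l W)))) s
      (fun y => u y k * u y j * u y i) x) -
    scaledConv (pd j (pd i (pd l W))) s (fun y => q y j * u y i) x -
    scaledConv (pd j (pd i (pd l W))) s (fun y => u y j * q y i) x)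

theorem integral_mul_diff_mul_diff_mul_diff {K : Space n → ℝ} (hK : IsTest K)
    {f g h : Space n → ℝ} (hf : Continuous f) (hg : Continuous g) (hh : Continuous h) (s : ℝ)
    (x : Space n) :
    ∫ y, K y * ((f (x - s • y) - f x) * (g (x - s • y) - g x) * (h (x - s • y) - h x)) =
      scaledConv K s (fun y => f y * g y * h y) x - f x * scaledConv K s (fun y => g y * h y) x -
        g x * scaledConv K s (fun y => f y * h y) x - h x * scaledConv K s (fun y => f y * g y) x +
        f x * g x * scaledConv K s h x + f x * h x * scaledConv K s g x +
        g x * h x * scaledConv K s f x - f x * g x * h x * ∫ y, K y := by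
  have i1 := hK.integrable_mul_comp ((hf.fun_mul hg).fun_mul hh) s x
  have i2 := (hK.integrable_mul_comp (hg.fun_mul hh) s x).const_mul (f x)
  have i3 := (hK.integrable_mul_comp (hf.fun_mul hh) s x).const_mul (g x)
  have i4 := (hK.integrable_mul_comp (hf.fun_mul hg) s x).const_mul (h x)
  have i5 := (hK.integrable_mul_comp hh s x).const_mul (f x * g x)
  have i6 := (hK.integrable_mul_comp hg s x).const_mul (f x * h x)
  have i7 := (hK.integrable_mul_comp hf s x).const_mul (g x * h x)
  have i8 := hK.integrable.const_mul (f x * g x * h x)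
  simp only [scaledConv, ← integral_const_mul]
  rw [← integral_sub i1 i2, ← integral_sub (by exact i1.sub i2) i3,
    ← integral_sub (by exact (i1.sub i2).sub i3) i4,
    ← integral_add (by exact ((i1.sub i2).sub i3).sub i4) i5,
    ← integral_add (by exact (((i1.sub i2).sub i3).sub i4).add i5) i6,
    ← integral_add (by exact ((((i1.sub i2).sub i3).sub i4).add i5).add i6) i7,
    ← integral_sub (by exact (((((i1.sub i2).sub i3).sub i4).add i5).add i6).add i7) i8]
  refine integral_congr_ae (Eventually.of_forall fun y => ?_)
  simp only
  ring

theorem contDiff_pressTerm {W : Space n → ℝ} (hW : IsTest W) (l : Fin n) {s : ℝ} (hs : 0 < s)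
    {u : Space n → Space n} (hu : ∀ i, Continuous fun x => u x i) :
    ContDiff ℝ ∞ (pressTerm W l s u) :=
  contDiff_const.mul (ContDiff.sum fun i _ => ContDiff.sum fun j _ =>
    contDiff_scaledConv (((hW.pd l).pd i).pd j) hs ((hu j).mul (hu i)).locallyIntegrable)

theorem pd_pressTerm {W : Space n → ℝ} (hW : IsTest W) (l : Fin n) {s : ℝ} (hs : 0 < s)
    {u : Space n → Space n} (hu : ∀ i, Continuous fun x => u x i) (k : Fin n) (x : Space n) :
    pd k (pressTerm W l s u) x = s⁻¹ * ∑ i, ∑ j, s⁻¹ *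
      scaledConv (pd k (pd j (pd i (pd l W)))) s (fun y => u y j * u y i) x := by
  have hd : ∀ i j, Differentiable ℝ
      (scaledConv (pd j (pd i (pd l W))) s fun y => u y j * u y i) := fun i j =>
    (contDiff_scaledConv (((hW.pd l).pd i).pd j) hs
      ((hu j).mul (hu i)).locallyIntegrable).differentiable (by simp)
  have hd' : ∀ i, Differentiable ℝ fun x => ∑ j,
      scaledConv (pd j (pd i (pd l W))) s (fun y => u y j * u y i) x := fun i =>
    Differentiable.fun_sum fun j _ => hd i j
  have e : pressTerm W l s u = fun x => s⁻¹ * ∑ i, ∑ j,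
      scaledConv (pd j (pd i (pd l W))) s (fun y => u y j * u y i) x := rfl
  rw [e, pd_const_mul _ (Differentiable.fun_sum fun i _ => hd' i), pd_sum _ fun i _ => hd' i]
  simp only
  congr 1
  refine Finset.sum_congr rfl fun i _ => ?_
  rw [pd_sum _ fun j _ => hd i j]
  exact Finset.sum_congr rfl fun j _ => pd_scaledConv (((hW.pd l).pd i).pd j) hs
    ((hu j).mul (hu i)).locallyIntegrable k x

/-- The Poisson equation tested with a dilated kernel: one derivative on the left and two on the
right leave a single factor −s⁻¹. -/
theorem sum_scaledConv_force {u q : Space n → Space n}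
    (hp : ∀ χ, IsTest χ → ∑ i, ∫ x, pd i χ x * q x i =
      ∑ i, ∑ k, ∫ x, pd k (pd i χ) x * (u x k * u x i))
    {K : Space n → ℝ} (hK : IsTest K) {s : ℝ} (hs : 0 < s) (x : Space n) :
    ∑ i, scaledConv (pd i K) s (fun y => q y i) x =
      -(s⁻¹ * ∑ i, ∑ k, scaledConv (pd k (pd i K)) s (fun y => u y k * u y i) x) := by
  have := hp _ (hK.kerAt hs x)
  simp only [integral_pd_kerAt_mul hK hs, integral_pd_pd_kerAt_mul hK hs, ← Finset.mul_sum] at this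
  have hne' : s ^ n ≠ 0 := pow_ne_zero _ hs.ne'
  field_simp at this ⊢
  linarith

/-- The increments in `pressRate` are expanded. Terms with a single velocity factor under the
convolution vanish by incompressibility (`z1` to `z5`). Among those of the triple product with two
velocity factors under it, the one with uᵏ outside is the transport term (`t1`); those with uⁱ or uʲ
outside cancel, through the Poisson equation (`p1`, `p2`), against the terms in which q alone is
convolved. Commuting the derivatives brings the contracted index to the outermost place. -/
theorem pressTimeRate_add_transport {W : Space n → ℝ} (hW : IsTest W) (l : Fin n) {s : ℝ}
    (hs : 0 < s) {u q : Space n → Space n} (hu : ∀ i, Continuous fun x => u x i)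
    (hq : ∀ i, Continuous fun x => q x i)
    (hdiv : ∀ χ, IsTest χ → ∑ k, ∫ x, pd k χ x * u x k = 0)
    (hp : ∀ χ, IsTest χ → ∑ i, ∫ x, pd i χ x * q x i =
      ∑ i, ∑ k, ∫ x, pd k (pd i χ) x * (u x k * u x i)) (x : Space n) :
    pressTimeRate W l s u q x + ∑ k, u x k * pd k (pressTerm W l s u) x =
      pressRate W l s u q x := by
  have hK := fun i j => ((hW.pd l).pd i).pd j
  have c2 : ∀ i j, pd j (pd i (pd l W)) = pd i (pd j (pd l W)) := fun i j =>
    pd_comm (hW.pd l).smooth j i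
  have c3 : ∀ i j k, pd k (pd j (pd i (pd l W))) = pd j (pd k (pd i (pd l W))) := fun i j k =>
    pd_comm ((hW.pd l).pd i).smooth k j
  have c4 : ∀ i j k, pd k (pd j (pd i (pd l W))) = pd i (pd k (pd j (pd l W))) := fun i j k => by
    rw [c2 i j, c3 j i k]
  have d := fun {K} (hK : IsTest K) => scaledDivFree_of_pairing hdiv hK hs x
  have e3 : ∀ i j k, ∫ y, pd k (pd j (pd i (pd l W))) y * ((u (x - s • y) k - u x k) *
      (u (x - s • y) j - u x j) * (u (x - s • y) i - u x i)) = _ := fun i j k =>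
    integral_mul_diff_mul_diff_mul_diff ((hK i j).pd k) (hu k) (hu j) (hu i) s x
  have e2 : ∀ i j, ∫ y, pd j (pd i (pd l W)) y * ((q (x - s • y) j - q x j) *
      (u (x - s • y) i - u x i)) = _ := fun i j =>
    integral_mul_diff_mul_diff (hK i j) (hq j) (hu i) s x
  have e2' : ∀ i j, ∫ y, pd j (pd i (pd l W)) y * ((u (x - s • y) j - u x j) *
      (q (x - s • y) i - q x i)) = _ := fun i j =>
    integral_mul_diff_mul_diff (hK i j) (hu j) (hq i) s x
  have z1 : ∑ i, ∑ j, ∑ k, u x k * u x j *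
      scaledConv (pd k (pd j (pd i (pd l W)))) s (fun y => u y i) x = 0 := by
    rw [Finset.sum_comm]
    refine Finset.sum_eq_zero fun j _ => ?_
    rw [Finset.sum_comm]
    refine Finset.sum_eq_zero fun k _ => ?_
    simp_rw [c4 _ j k, ← Finset.mul_sum, d ((hK j k)), mul_zero]
  have z2 : ∑ i, ∑ j, ∑ k, u x k * u x i *
      scaledConv (pd k (pd j (pd i (pd l W)))) s (fun y => u y j) x = 0 := by
    refine Finset.sum_eq_zero fun i _ => ?_
    rw [Finset.sum_comm]
    refine Finset.sum_eq_zero fun k _ => ?_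
    simp_rw [c3 i _ k, ← Finset.mul_sum, d ((hK i k)), mul_zero]
  have z3 : ∑ i, ∑ j, ∑ k, u x j * u x i *
      scaledConv (pd k (pd j (pd i (pd l W)))) s (fun y => u y k) x = 0 := by
    refine Finset.sum_eq_zero fun i _ => Finset.sum_eq_zero fun j _ => ?_
    simp_rw [← Finset.mul_sum, d ((hK i j)), mul_zero]
  have z4 : ∑ i, ∑ j, q x j * scaledConv (pd j (pd i (pd l W))) s (fun y => u y i) x = 0 := by
    rw [Finset.sum_comm]
    refine Finset.sum_eq_zero fun j _ => ?_
    simp_rw [c2 _ j, ← Finset.mul_sum, d ((hW.pd l).pd j), mul_zero]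
  have z5 : ∑ i, ∑ j, q x i * scaledConv (pd j (pd i (pd l W))) s (fun y => u y j) x = 0 := by
    refine Finset.sum_eq_zero fun i _ => ?_
    simp_rw [← Finset.mul_sum, d ((hW.pd l).pd i), mul_zero]
  have p1 : ∑ i, ∑ j, u x i * scaledConv (pd j (pd i (pd l W))) s (fun y => q y j) x =
      -(s⁻¹ * ∑ i, ∑ j, ∑ k, u x i *
        scaledConv (pd k (pd j (pd i (pd l W)))) s (fun y => u y k * u y j) x) := by
    rw [Finset.mul_sum, ← Finset.sum_neg_distrib]
    refine Finset.sum_congr rfl fun i _ => ?_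
    simp_rw [← Finset.mul_sum, sum_scaledConv_force hp ((hW.pd l).pd i) hs]
    ring
  have p2 : ∑ i, ∑ j, u x j * scaledConv (pd j (pd i (pd l W))) s (fun y => q y i) x =
      -(s⁻¹ * ∑ i, ∑ j, ∑ k, u x j *
        scaledConv (pd k (pd j (pd i (pd l W)))) s (fun y => u y k * u y i) x) := by
    rw [Finset.sum_comm, Finset.sum_comm (f := fun i j => ∑ k, u x j *
        scaledConv (pd k (pd j (pd i (pd l W)))) s (fun y => u y k * u y i) x),
      Finset.mul_sum, ← Finset.sum_neg_distrib]
    refine Finset.sum_congr rfl fun j _ => ?_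
    simp_rw [c2 _ j, ← Finset.mul_sum, sum_scaledConv_force hp ((hW.pd l).pd j) hs]
    ring
  have t1 : ∑ k, u x k * pd k (pressTerm W l s u) x = s⁻¹ * (s⁻¹ * ∑ i, ∑ j, ∑ k, u x k *
      scaledConv (pd k (pd j (pd i (pd l W)))) s (fun y => u y j * u y i) x) := by
    simp_rw [pd_pressTerm hW l hs hu, ← Finset.mul_sum, mul_left_comm (u x _) s⁻¹,
      ← Finset.mul_sum]
    congr 2
    simp_rw [Finset.mul_sum]
    rw [Finset.sum_comm]
    exact Finset.sum_congr rfl fun i _ => Finset.sum_comm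
  rw [t1, pressRate, pressTimeRate]
  simp only [e3, e2, e2', (hK _ _).integral_pd, ((hW.pd l).pd _).integral_pd, mul_zero, add_zero,
    sub_zero]
  simp only [Finset.sum_add_distrib, Finset.sum_sub_distrib, ← Finset.mul_sum,
    Finset.sum_neg_distrib] at z1 z2 z3 z4 z5 p1 p2 ⊢
  linear_combination s⁻¹ * (s⁻¹ * z1 + s⁻¹ * z2 + s⁻¹ * z3 - z4 - z5 - p1 - p2)

variable {I : Opens ℝ} {u q : SpaceTime n → Space n} {M α N θ : ℝ}

/-! ### The transport identity against space-time test functions. -/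

theorem continuous_mul_of_tsupport_subset {X : Type*} [TopologicalSpace X] {φ F : X → ℝ}
    {U : Set X} (hU : IsOpen U) (hφ : Continuous φ) (hs : tsupport φ ⊆ U)
    (hF : ContinuousOn F U) : Continuous fun x => φ x * F x := by
  rw [continuous_iff_continuousAt]
  intro x
  by_cases hx : x ∈ tsupport φ
  · exact hφ.continuousAt.mul (hF.continuousAt (hU.mem_nhds (hs hx)))
  · refine ContinuousAt.congr (continuousAt_const (y := (0 : ℝ))) ?_
    filter_upwards [(isClosed_tsupport φ).isOpen_compl.mem_nhds hx] with y hy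
    simp [image_eq_zero_of_notMem_tsupport hy]

theorem continuous_fderiv_apply {φ : SpaceTime n → ℝ} (hφ : ContDiff ℝ ∞ φ) (w : SpaceTime n) :
    Continuous fun z => fderiv ℝ φ z w :=
  (hφ.continuous_fderiv (by simp)).clm_apply continuous_const

theorem isTest_slice {φ : SpaceTime n → ℝ} (hφ : ContDiff ℝ ∞ φ) (hc : HasCompactSupport φ)
    (t : ℝ) : IsTest fun x => φ (t, x) :=
  ⟨hφ.comp (by fun_prop), HasCompactSupport.of_support_subset_isCompact
    (hc.isCompact.image continuous_snd) fun x hx => ⟨(t, x), subset_tsupport _ hx, rfl⟩⟩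

theorem pd_slice {φ : SpaceTime n → ℝ} (hφ : ContDiff ℝ ∞ φ) (t : ℝ) (k : Fin n) (x : Space n) :
    pd k (fun x => φ (t, x)) x =
      fderiv ℝ φ (t, x) ((0 : ℝ), EuclideanSpace.single k (1 : ℝ)) := by
  have : HasFDerivAt (fun x => φ (t, x)) _ x :=
    (hφ.differentiable (by simp) (t, x)).hasFDerivAt.comp x (hasFDerivAt_prodMk_right t x)
  rw [pd, this.fderiv]
  rfl

/-- Weak form of the material derivative of a function `T` that is differentiable in time and
smooth in space. -/
theorem IsHolderFlow.integral_transport (h : IsHolderFlow I u q M α N θ) {T H G : SpaceTime n → ℝ}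
    (hT : ContinuousOn T (slab n I)) (hH : ContinuousOn H (slab n I))
    (hG : ContinuousOn G (slab n I))
    (hd : ∀ t ∈ I, ∀ x, HasDerivAt (fun t => T (t, x)) (H (t, x)) t)
    (hsm : ∀ t ∈ I, ContDiff ℝ ∞ fun x => T (t, x))
    (hHG : ∀ t ∈ I, ∀ x, H (t, x) + ∑ k, u (t, x) k * pd k (fun x => T (t, x)) x = G (t, x))
    {φ : SpaceTime n → ℝ} (hφ : ContDiff ℝ ∞ φ) (hc : HasCompactSupport φ)
    (hs : tsupport φ ⊆ slab n I) :
    (∫ z, fderiv ℝ φ z ((1 : ℝ), (0 : Space n)) * T z) +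
      ∑ j, ∫ z, fderiv ℝ φ z ((0 : ℝ), EuclideanSpace.single j (1 : ℝ)) * (u z j * T z) =
      -∫ z, φ z * G z := by
  have hU := (slab n I).isOpen
  have hdc := continuous_fderiv_apply hφ
  have hdcs : ∀ w : SpaceTime n, HasCompactSupport fun z => fderiv ℝ φ z w := fun w =>
    hc.fderiv_apply ℝ w
  have hds : ∀ w : SpaceTime n, tsupport (fun z => fderiv ℝ φ z w) ⊆ slab n I := fun w =>
    (tsupport_fderiv_apply_subset ℝ w).trans hs
  have hzero : ∀ t ∉ I, ∀ x, φ (t, x) = 0 := fun t ht x =>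
    image_eq_zero_of_notMem_tsupport fun hx => ht (hs hx).1
  have hint : ∀ {g F : SpaceTime n → ℝ}, Continuous g → HasCompactSupport g →
      tsupport g ⊆ slab n I → ContinuousOn F (slab n I) → Integrable fun z => g z * F z :=
    fun hg hgc hgs hF => (continuous_mul_of_tsupport_subset hU hg hgs hF).integrable_of_hasCompactSupport
      hgc.mul_right
  have i1 : Integrable fun z => fderiv ℝ φ z ((1 : ℝ), (0 : Space n)) * T z :=
    hint (hdc _) (hdcs _) (hds _) hT
  have i2 : Integrable fun z => φ z * H z := hint hφ.continuous hc hs hH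
  have i3 : ∀ j ∈ Finset.univ, Integrable fun z =>
      fderiv ℝ φ z ((0 : ℝ), EuclideanSpace.single j (1 : ℝ)) * (u z j * T z) := fun j _ =>
    hint (hdc _) (hdcs _) (hds _) ((h.continuousOn_apply j).mul hT)
  have i4 : Integrable fun z => φ z * (G z - H z) := hint hφ.continuous hc hs (hG.sub hH)
  have slice_time : ∀ {g F : SpaceTime n → ℝ}, Continuous g → HasCompactSupport g →
      tsupport g ⊆ slab n I → ContinuousOn F (slab n I) → ∀ x,
      Integrable fun t => g (t, x) * F (t, x) := fun hg hgc hgs hF x =>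
    ((continuous_mul_of_tsupport_subset hU hg hgs hF).comp
      (continuous_id.prodMk continuous_const)).integrable_of_hasCompactSupport
        (HasCompactSupport.of_support_subset_isCompact (hgc.isCompact.image continuous_fst)
          fun t ht => ⟨(t, x), subset_tsupport _ (left_ne_zero_of_mul ht), rfl⟩)
  -- Integrating in t first, the integrand is the t-derivative of φ T, which has compact support in
  -- time.
  have time : ∫ z, (fderiv ℝ φ z ((1 : ℝ), (0 : Space n)) * T z + φ z * H z) = 0 := by
    have hi : Integrable fun z => fderiv ℝ φ z ((1 : ℝ), (0 : Space n)) * T z + φ z * H z :=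
      i1.add i2
    rw [Measure.volume_eq_prod] at hi ⊢
    rw [integral_prod_symm _ hi]
    refine integral_eq_zero_of_ae (Eventually.of_forall fun x => ?_)
    refine integral_eq_zero_of_hasDerivAt_of_integrable (f := fun t => φ (t, x) * T (t, x))
      (fun t => ?_) ((slice_time (hdc _) (hdcs _) (hds _) hT x).add
        (slice_time hφ.continuous hc hs hH x)) (slice_time hφ.continuous hc hs hT x)
    by_cases ht : t ∈ I
    · exact ((hφ.differentiable (by simp) (t, x)).hasFDerivAt.comp_hasDerivAt t
        ((hasDerivAt_id t).prodMk (hasDerivAt_const t x))).mul (hd t ht x)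
    -- Outside `I` nothing is known about T, but φ vanishes near (t, x), so the product is locally
    -- zero.
    · have hx : (t, x) ∉ tsupport φ := fun hx => ht (hs hx).1
      have h0 : fderiv ℝ φ (t, x) = 0 := image_eq_zero_of_notMem_tsupport fun hx' =>
        hx (tsupport_fderiv_subset ℝ hx')
      rw [h0, hzero t ht x]
      refine ((hasDerivAt_const t (0 : ℝ)).congr_of_eventuallyEq ?_).congr_deriv (by simp)
      have hev : ∀ᶠ r in 𝓝 t, (r, x) ∈ (tsupport φ)ᶜ :=
        (Continuous.prodMk_left x).continuousAt.eventually_mem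
          ((isClosed_tsupport φ).isOpen_compl.mem_nhds hx)
      filter_upwards [hev] with r hr
      rw [image_eq_zero_of_notMem_tsupport hr, zero_mul]
  -- Integrating in x first, this is the weak divergence identity at time t tested with φ(t, ·) T(t,
  -- ·).
  have space : ∫ z, ((∑ j, fderiv ℝ φ z ((0 : ℝ), EuclideanSpace.single j (1 : ℝ)) * (u z j * T z)) +
      φ z * (G z - H z)) = 0 := by
    have hi : Integrable fun z => (∑ j, fderiv ℝ φ z ((0 : ℝ), EuclideanSpace.single j (1 : ℝ)) *
        (u z j * T z)) + φ z * (G z - H z) := (integrable_finsetSum _ i3).add i4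
    rw [Measure.volume_eq_prod] at hi ⊢
    rw [integral_prod _ hi]
    refine integral_eq_zero_of_ae (Eventually.of_forall fun t => ?_)
    by_cases ht : t ∈ I
    · have hφt := isTest_slice hφ hc t
      have hpd := pd_slice hφ t
      have hdiv := h.div t ht _ (hφt.mul (hsm t ht))
      rw [← integral_finsetSum] at hdiv
      · refine Eq.trans (integral_congr_ae (Eventually.of_forall fun x => ?_)) hdiv
        simp only
        rw [← hHG t ht x, add_sub_cancel_left, Finset.mul_sum, ← Finset.sum_add_distrib]
        refine Finset.sum_congr rfl fun k _ => ?_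
        rw [pd_mul hφt.differentiable ((hsm t ht).differentiable (by simp))]
        simp only [hpd]
        ring
      · intro k _
        exact ((hφt.mul (hsm t ht)).pd k).integrable_mul
          (h.continuous_slice_apply ht k).locallyIntegrable
    · have h0 : ∀ x, fderiv ℝ φ (t, x) = 0 := fun x => image_eq_zero_of_notMem_tsupport
        fun hx' => ht (hs (tsupport_fderiv_subset ℝ hx')).1
      simp [h0, hzero t ht]
  rw [integral_add i1 i2] at time
  rw [integral_add (integrable_finsetSum _ i3) i4,
    integral_finsetSum _ i3] at space
  have e : ∫ z, φ z * G z = (∫ z, φ z * H z) + ∫ z, φ z * (G z - H z) := by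
    rw [← integral_add i2 i4]
    refine integral_congr_ae (Eventually.of_forall fun z => ?_)
    simp only
    ring
  linarith

variable {I : Opens ℝ} {u q : SpaceTime n → Space n} {M α N θ : ℝ}

/-! ### Summing the material derivatives over all scales. -/

theorem scaledConv_neg_add {K : Space n → ℝ} (hK : IsTest K) {f g : Space n → ℝ}
    (hf : Continuous f) (hg : Continuous g) (s : ℝ) (x : Space n) :
    scaledConv K s (fun y => -1 * (f y + g y)) x = -scaledConv K s f x - scaledConv K s g x := by
  have i1 := hK.integrable_mul_comp hf s x
  have i2 := hK.integrable_mul_comp hg s x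
  simp only [scaledConv]
  rw [← integral_neg, ← integral_sub (by exact i1.neg) i2]
  refine integral_congr_ae (Eventually.of_forall fun y => ?_)
  simp only
  ring

theorem exists_abs_integral_diff_mul_diff_mul_diff_le {K : Space n → ℝ} (hK : IsTest K) {M α : ℝ}
    (hα : 0 ≤ α) :
    ∃ C, 0 ≤ C ∧ ∀ (f g h : Space n → ℝ), HolderBound M α f → HolderBound M α g →
      HolderBound M α h → ∀ s, 0 < s → ∀ x, |∫ y, K y *
        ((f (x - s • y) - f x) * (g (x - s • y) - g x) * (h (x - s • y) - h x))| ≤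
        C * (min 1 s ^ α * min 1 s ^ α * min 1 s ^ α) := by
  obtain ⟨R, A, hR, hA, hb⟩ := hK.exists_integral_bound
  refine ⟨A * |(2 * M * R ^ α) ^ 3|, by positivity, fun f g h hf hg hh s hs x => ?_⟩
  have hm : 0 < min 1 s := lt_min one_pos hs
  have hM := hf.nonneg
  have hR0 : 0 < R := by linarith
  rw [abs_of_nonneg (by positivity : 0 ≤ (2 * M * R ^ α) ^ 3), mul_assoc]
  refine hb _ _ fun y hy => ?_
  rw [abs_mul, abs_mul]
  calc _ ≤ (2 * M * R ^ α * min 1 s ^ α) * (2 * M * R ^ α * min 1 s ^ α) *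
        (2 * M * R ^ α * min 1 s ^ α) := by
        have h1 := hf.abs_diff_le hα hR hs x hy
        have h2 := hg.abs_diff_le hα hR hs x hy
        have h3 := hh.abs_diff_le hα hR hs x hy
        gcongr
    _ = _ := by ring

/-- Equality holds for s ≤ 1. For s ≥ 1 the left side is s⁻² and the weight is s⁻¹, which already
suffices for summability. -/
theorem inv_mul_inv_mul_rpow_le (α : ℝ) {s : ℝ} (hs : 0 < s) :
    s⁻¹ * (s⁻¹ * (min 1 s ^ α * min 1 s ^ α * min 1 s ^ α)) ≤ scaleWeight (3 * α - 2) s := by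
  have hm : 0 < min 1 s := lt_min one_pos hs
  have h1 : min 1 s ^ α * min 1 s ^ α * min 1 s ^ α =
      min 1 s * min 1 s ^ (1 + (3 * α - 2)) := by
    rw [← Real.rpow_add hm, ← Real.rpow_add hm]
    nth_rewrite 2 [← Real.rpow_one (min 1 s)]
    rw [← Real.rpow_add hm]
    ring_nf
  rw [h1, scaleWeight]
  refine mul_le_mul_of_nonneg_left ?_ (inv_nonneg.2 hs.le)
  rw [← mul_assoc]
  refine mul_le_of_le_one_left (by positivity) ?_
  rw [inv_mul_le_iff₀ hs, mul_one]
  exact min_le_right _ _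

/-- Three velocity increments against s⁻² give the exponent 3α − 2; a velocity and a force increment
against s⁻¹ give α + θ − 1. Neither exponent is assumed positive here. -/
theorem exists_abs_pressRate_le {W : Space n → ℝ} (hW : IsTest W) {M α N θ : ℝ} (hα : 0 ≤ α)
    (hθ : 0 ≤ θ) :
    ∃ C, 0 ≤ C ∧ ∀ u q : Space n → Space n, (∀ i, HolderBound M α fun x => u x i) →
      (∀ i, HolderBound N θ fun x => q x i) → ∀ s, 0 < s → ∀ l x,
        |pressRate W l s u q x| ≤
          C * (scaleWeight (3 * α - 2) s + scaleWeight (α + θ - 1) s) := by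
  choose A hA0 hA using fun l i j k : Fin n => exists_abs_integral_diff_mul_diff_mul_diff_le
    (M := M) (((((hW.pd l).pd i).pd j).pd k)) hα
  choose B hB0 hB using fun l i j : Fin n => exists_abs_integral_diff_mul_diff_le
    (M := N) (α := θ) (M' := M) (α' := α) (((hW.pd l).pd i).pd j) hθ hα
  choose D hD0 hD using fun l i j : Fin n => exists_abs_integral_diff_mul_diff_le
    (M := M) (α := α) (M' := N) (α' := θ) (((hW.pd l).pd i).pd j) hα hθ
  have hE0 : ∀ l i j, 0 ≤ (∑ k, A l i j k) + B l i j + D l i j := fun l i j =>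
    add_nonneg (add_nonneg (Finset.sum_nonneg fun k _ => hA0 l i j k) (hB0 l i j)) (hD0 l i j)
  have hF0 : ∀ l, 0 ≤ ∑ i, ∑ j, ((∑ k, A l i j k) + B l i j + D l i j) := fun l =>
    Finset.sum_nonneg fun i _ => Finset.sum_nonneg fun j _ => hE0 l i j
  refine ⟨∑ l, ∑ i, ∑ j, ((∑ k, A l i j k) + B l i j + D l i j),
    Finset.sum_nonneg fun l _ => hF0 l, fun u q hu hq s hs l x => ?_⟩
  have hm : 0 < min 1 s := lt_min one_pos hs
  set X := min 1 s ^ α * min 1 s ^ α * min 1 s ^ α with hX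
  set Y := min 1 s ^ α * min 1 s ^ θ with hY
  have hX0 : 0 ≤ X := by positivity
  have hY0 : 0 ≤ Y := by positivity
  have hs0 : 0 < s⁻¹ := inv_pos.2 hs
  have hterm : ∀ i j, |-(s⁻¹ * ∑ k, ∫ y, pd k (pd j (pd i (pd l W))) y *
      ((u (x - s • y) k - u x k) * (u (x - s • y) j - u x j) * (u (x - s • y) i - u x i))) -
      (∫ y, pd j (pd i (pd l W)) y * ((q (x - s • y) j - q x j) * (u (x - s • y) i - u x i))) -
      ∫ y, pd j (pd i (pd l W)) y * ((u (x - s • y) j - u x j) * (q (x - s • y) i - q x i))| ≤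
      ((∑ k, A l i j k) + B l i j + D l i j) * (s⁻¹ * X + Y) := by
    intro i j
    have h1 : |∑ k, ∫ y, pd k (pd j (pd i (pd l W))) y *
        ((u (x - s • y) k - u x k) * (u (x - s • y) j - u x j) * (u (x - s • y) i - u x i))| ≤
        (∑ k, A l i j k) * X := by
      rw [Finset.sum_mul]
      exact (Finset.abs_sum_le_sum_abs _ _).trans (Finset.sum_le_sum fun k _ =>
        hA l i j k _ _ _ (hu k) (hu j) (hu i) s hs x)
    have h2 := hB l i j _ _ (hq j) (hu i) s hs x
    have h3 := hD l i j _ _ (hu j) (hq i) s hs x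
    rw [mul_comm (min 1 s ^ θ), ← hY] at h2
    have hA' : 0 ≤ ∑ k, A l i j k := Finset.sum_nonneg fun k _ => hA0 l i j k
    calc _ ≤ s⁻¹ * ((∑ k, A l i j k) * X) + B l i j * Y + D l i j * Y := by
          refine (abs_sub _ _).trans (add_le_add ((abs_sub _ _).trans (add_le_add ?_ h2)) h3)
          rw [abs_neg, abs_mul, abs_of_pos hs0]
          exact mul_le_mul_of_nonneg_left h1 hs0.le
      _ ≤ s⁻¹ * ((∑ k, A l i j k) * X) + B l i j * Y + D l i j * Y +
          ((∑ k, A l i j k) * Y + B l i j * (s⁻¹ * X) + D l i j * (s⁻¹ * X)) := by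
          have := hB0 l i j
          have := hD0 l i j
          exact le_add_of_nonneg_right (by positivity)
      _ = _ := by ring
  rw [pressRate, abs_mul, abs_of_pos hs0]
  have h2 : ∑ i, ∑ j, ((∑ k, A l i j k) + B l i j + D l i j) ≤
      ∑ l, ∑ i, ∑ j, ((∑ k, A l i j k) + B l i j + D l i j) :=
    Finset.single_le_sum (f := fun l => ∑ i, ∑ j, ((∑ k, A l i j k) + B l i j + D l i j))
      (fun l _ => hF0 l) (Finset.mem_univ l)
  have hY' : s⁻¹ * Y = scaleWeight (α + θ - 1) s := by
    rw [scaleWeight, hY, ← Real.rpow_add hm]; ring_nf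
  have hX' := inv_mul_inv_mul_rpow_le α hs
  calc _ ≤ s⁻¹ * ((∑ i, ∑ j, ((∑ k, A l i j k) + B l i j + D l i j)) * (s⁻¹ * X + Y)) := by
        refine mul_le_mul_of_nonneg_left ?_ hs0.le
        simp_rw [Finset.sum_mul]
        refine (Finset.abs_sum_le_sum_abs _ _).trans (Finset.sum_le_sum fun i _ => ?_)
        refine (Finset.abs_sum_le_sum_abs _ _).trans (Finset.sum_le_sum fun j _ => ?_)
        exact hterm i j
    _ = (∑ i, ∑ j, ((∑ k, A l i j k) + B l i j + D l i j)) * (s⁻¹ * (s⁻¹ * X) + s⁻¹ * Y) := by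
        ring
    _ ≤ _ := by
        have hn : 0 ≤ s⁻¹ * (s⁻¹ * X) + s⁻¹ * Y := by positivity
        exact mul_le_mul h2 (by linarith) hn
          (Finset.sum_nonneg fun l _ => hF0 l)

theorem hasSum_integral_mul_of_bounded {φ : SpaceTime n → ℝ} (hφ : Continuous φ)
    (hc : HasCompactSupport φ) (hs : tsupport φ ⊆ slab n I) {F : ℤ → SpaceTime n → ℝ}
    (hF : ∀ k, ContinuousOn (F k) (slab n I)) {B : ℤ → ℝ} (hB : Summable B)
    (hFB : ∀ k, ∀ z ∈ slab n I, |F k z| ≤ B k) :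
    HasSum (fun k => ∫ z, φ z * F k z) (∫ z, φ z * ∑' k, F k z) := by
  have hz : ∀ z ∉ slab n I, φ z = 0 := fun z hz =>
    image_eq_zero_of_notMem_tsupport fun h => hz (hs h)
  refine hasSum_integral_of_dominated_convergence (fun k z => |φ z| * B k) (fun k => ?_)
    (fun k => Eventually.of_forall fun z => ?_) (Eventually.of_forall fun z => hB.mul_left _) ?_
    (Eventually.of_forall fun z => ?_)
  · exact (continuous_mul_of_tsupport_subset (slab n I).isOpen hφ hs
      (hF k)).aestronglyMeasurable
  · by_cases h : z ∈ slab n I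
    · rw [norm_mul]
      exact mul_le_mul_of_nonneg_left (hFB k z h) (abs_nonneg _)
    · simp [hz z h]
  · simp_rw [tsum_mul_left]
    exact (hφ.integrable_of_hasCompactSupport hc).abs.mul_const _
  · by_cases h : z ∈ slab n I
    · have h1 : Summable fun k => F k z := Summable.of_norm_bounded hB fun k => hFB k z h
      exact h1.hasSum.mul_left (φ z)
    · simp [hz z h]

/-- The material derivative of the pressure gradient `forceField W u` when `q` is that gradient. -/
def forceRate (W : Space n → ℝ) (u q : SpaceTime n → Space n) (z : SpaceTime n) : Space n :=
  WithLp.toLp 2 fun l => ∑' k : ℤ,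
    pressRate W l ((2 : ℝ) ^ k) (fun x => u (z.1, x)) (fun x => q (z.1, x)) z.2

theorem isPeriodic_forceRate {W : Space n → ℝ} {b : Module.Basis (Fin n) ℝ (Space n)}
    (hu : IsPeriodic b I u) (hq : IsPeriodic b I q) : IsPeriodic b I (forceRate W u q) := by
  intro t ht x γ hγ
  ext l
  simp only [forceRate, pressRate, add_sub_right_comm, hu t ht _ γ hγ, hq t ht _ γ hγ]

namespace IsHolderFlow

/-- A convolution of uʲuⁱ is, up to the factor s⁻ⁿ, a pairing with a dilated kernel, so the balance
law for products applies with that kernel as test function. -/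
theorem hasDerivAt_pressTerm (h : IsHolderFlow I u q M α N θ) (hα : 1 / 2 < α) (hθ : 0 < θ)
    {W ψ : Space n → ℝ} (hW : IsTest W) (hψ : IsTest ψ) (hψ1 : ∫ y, ψ y = 1) {s : ℝ}
    (hs : 0 < s) (l : Fin n) {t : ℝ} (ht : t ∈ I) (x : Space n) :
    HasDerivAt (fun t => pressTerm W l s (fun y => u (t, y)) x)
      (pressTimeRate W l s (fun y => u (t, y)) (fun y => q (t, y)) x) t := by
  refine HasDerivAt.const_mul _ (HasDerivAt.fun_sum fun i _ => HasDerivAt.fun_sum fun j _ => ?_)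
  have hK := ((hW.pd l).pd i).pd j
  have hne : s ^ n ≠ 0 := pow_ne_zero _ hs.ne'
  have h1 := (h.hasDerivAt_pairing_mul hα hθ hψ hψ1 (hK.kerAt hs x) j i t ht).const_mul
    (s ^ n)⁻¹
  simp only [integral_pd_kerAt_mul hK hs, integral_kerAt_mul _ _ hs,
    inv_mul_cancel_left₀ hne] at h1
  refine h1.congr_deriv ?_
  rw [scaledConv_neg_add hK
    ((h.continuous_force_slice_apply ht j).fun_mul (h.continuous_slice_apply ht i))
    ((h.continuous_slice_apply ht j).fun_mul (h.continuous_force_slice_apply ht i))]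
  simp only [← Finset.mul_sum, mul_assoc]
  field_simp
  ring

theorem continuousOn_pressTerm (h : IsHolderFlow I u q M α N θ) {W : Space n → ℝ} (hW : IsTest W)
    (l : Fin n) (s : ℝ) :
    ContinuousOn (fun z : SpaceTime n => pressTerm W l s (fun y => u (z.1, y)) z.2)
      (slab n I) :=
  continuousOn_const.mul (continuousOn_finsetSum _ fun i _ => continuousOn_finsetSum _ fun j _ =>
    continuousOn_scaledConv_slice (((hW.pd l).pd i).pd j) _
      ((h.continuousOn_apply j).mul (h.continuousOn_apply i)))

theorem continuousOn_pressTimeRate (h : IsHolderFlow I u q M α N θ) {W : Space n → ℝ}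
    (hW : IsTest W) (l : Fin n) (s : ℝ) :
    ContinuousOn (fun z : SpaceTime n => pressTimeRate W l s (fun y => u (z.1, y))
      (fun y => q (z.1, y)) z.2) (slab n I) :=
  have hu := h.continuousOn_apply
  have hq := h.continuousOn_force_apply
  continuousOn_const.mul (continuousOn_finsetSum _ fun i _ => continuousOn_finsetSum _ fun j _ =>
    ((continuousOn_const.mul (continuousOn_finsetSum _ fun k _ =>
      continuousOn_scaledConv_slice ((((hW.pd l).pd i).pd j).pd k) _
        (((hu k).mul (hu j)).mul (hu i)))).neg.sub
      (continuousOn_scaledConv_slice (((hW.pd l).pd i).pd j) _ ((hq j).mul (hu i)))).sub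
      (continuousOn_scaledConv_slice (((hW.pd l).pd i).pd j) _ ((hu j).mul (hq i))))

theorem continuousOn_pressRate (h : IsHolderFlow I u q M α N θ) {W : Space n → ℝ}
    (hW : IsTest W) (l : Fin n) (s : ℝ) :
    ContinuousOn (fun z : SpaceTime n => pressRate W l s (fun y => u (z.1, y))
      (fun y => q (z.1, y)) z.2) (slab n I) := by
  have hd : ∀ {f : SpaceTime n → ℝ}, ContinuousOn f (slab n I) →
      ContinuousOn (fun w : SpaceTime n × Space n => f (w.1.1, w.1.2 - s • w.2) - f w.1)
        ((slab n I : Set (SpaceTime n)) ×ˢ univ) := fun hf =>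
    (hf.comp (f := fun w : SpaceTime n × Space n => (w.1.1, w.1.2 - s • w.2))
      (by fun_prop) fun w hw => ⟨hw.1.1, mem_univ _⟩).sub
      (hf.comp continuousOn_fst fun w hw => hw.1)
  have hu := fun i => hd (h.continuousOn_apply i)
  have hq := fun i => hd (h.continuousOn_force_apply i)
  refine continuousOn_const.mul (continuousOn_finsetSum _ fun i _ =>
    continuousOn_finsetSum _ fun j _ => ContinuousOn.sub (ContinuousOn.sub
      (continuousOn_const.mul (continuousOn_finsetSum _ fun k _ => ?_)).neg ?_) ?_)
  · exact continuousOn_integral_mul ((((hW.pd l).pd i).pd j).pd k) (F := fun (z : SpaceTime n) y =>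
      (u (z.1, z.2 - s • y) k - u z k) * (u (z.1, z.2 - s • y) j - u z j) *
        (u (z.1, z.2 - s • y) i - u z i)) (((hu k).mul (hu j)).mul (hu i))
  · exact continuousOn_integral_mul (((hW.pd l).pd i).pd j) (F := fun (z : SpaceTime n) y =>
      (q (z.1, z.2 - s • y) j - q z j) * (u (z.1, z.2 - s • y) i - u z i)) ((hq j).mul (hu i))
  · exact continuousOn_integral_mul (((hW.pd l).pd i).pd j) (F := fun (z : SpaceTime n) y =>
      (u (z.1, z.2 - s • y) j - u z j) * (q (z.1, z.2 - s • y) i - q z i)) ((hu j).mul (hq i))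

/-- The place where 2/3 enters: both 3α − 2 and α + θ − 1 must be positive for the series of rates
to converge uniformly. -/
theorem continuousOn_forceRate (h : IsHolderFlow I u q M α N θ) {W : Space n → ℝ}
    (hW : IsTest W) (hα : 2 / 3 < α) (hθ : 0 < θ) (hαθ : 1 < α + θ) :
    ContinuousOn (forceRate W u q) (slab n I) := by
  obtain ⟨C, hC0, hC⟩ := exists_abs_pressRate_le hW (M := M) (N := N)
    (show 0 ≤ α by linarith) hθ.le
  refine (PiLp.continuous_toLp 2 _).comp_continuousOn (continuousOn_pi.2 fun l => ?_)
  refine continuousOn_tsum (fun k => h.continuousOn_pressRate hW l _)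
    (((summable_scaleWeight (show 0 < 3 * α - 2 by linarith)).add
      (summable_scaleWeight (show 0 < α + θ - 1 by linarith))).mul_left C) fun k z hz => ?_
  exact hC _ _ (h.holder z.1 hz.1) (h.holder_force z.1 hz.1) _ (by positivity) l z.2

/-- Sum and integral are exchanged in every term by the uniform majorants; the flux terms use in
addition that the components of u are bounded by `M`. -/
theorem integral_transport_tsum (h : IsHolderFlow I u q M α N θ) {T G : ℤ → SpaceTime n → ℝ}
    {B B' : ℤ → ℝ} (hT : ∀ k, ContinuousOn (T k) (slab n I)) (hB : Summable B)
    (hTB : ∀ k, ∀ z ∈ slab n I, |T k z| ≤ B k) (hG : ∀ k, ContinuousOn (G k) (slab n I))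
    (hB' : Summable B') (hGB : ∀ k, ∀ z ∈ slab n I, |G k z| ≤ B' k) {φ : SpaceTime n → ℝ}
    (hφ : ContDiff ℝ ∞ φ) (hc : HasCompactSupport φ) (hs : tsupport φ ⊆ slab n I)
    (hTG : ∀ k, (∫ z, fderiv ℝ φ z ((1 : ℝ), (0 : Space n)) * T k z) +
      ∑ j, ∫ z, fderiv ℝ φ z ((0 : ℝ), EuclideanSpace.single j (1 : ℝ)) * (u z j * T k z) =
      -∫ z, φ z * G k z) :
    (∫ z, fderiv ℝ φ z ((1 : ℝ), (0 : Space n)) * ∑' k, T k z) +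
      ∑ j, ∫ z, fderiv ℝ φ z ((0 : ℝ), EuclideanSpace.single j (1 : ℝ)) *
        (u z j * ∑' k, T k z) = -∫ z, φ z * ∑' k, G k z := by
  have hdc := continuous_fderiv_apply hφ
  have hdcs : ∀ w : SpaceTime n, HasCompactSupport fun z => fderiv ℝ φ z w := fun w =>
    hc.fderiv_apply ℝ w
  have hds : ∀ w : SpaceTime n, tsupport (fun z => fderiv ℝ φ z w) ⊆ slab n I := fun w =>
    (tsupport_fderiv_apply_subset ℝ w).trans hs
  have s1 := hasSum_integral_mul_of_bounded (hdc ((1 : ℝ), (0 : Space n))) (hdcs _) (hds _)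
    hT hB hTB
  have s2 : ∀ j, HasSum (fun k => ∫ z, fderiv ℝ φ z ((0 : ℝ), EuclideanSpace.single j (1 : ℝ)) *
      (u z j * T k z)) (∫ z, fderiv ℝ φ z ((0 : ℝ), EuclideanSpace.single j (1 : ℝ)) *
        (u z j * ∑' k, T k z)) := by
    intro j
    have := hasSum_integral_mul_of_bounded
      (hdc ((0 : ℝ), EuclideanSpace.single j (1 : ℝ))) (hdcs _) (hds _)
      (F := fun k z => u z j * T k z) (fun k => (h.continuousOn_apply j).mul (hT k))
      (hB.mul_left M) fun k z hz => by
        rw [abs_mul]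
        exact mul_le_mul ((h.holder z.1 hz.1 j).bound z.2) (hTB k z hz) (abs_nonneg _)
          (h.holder z.1 hz.1 j).nonneg
    simpa only [tsum_mul_left] using this
  have s3 := (hasSum_integral_mul_of_bounded hφ.continuous hc hs hG hB' hGB).neg
  simp_rw [← hTG] at s3
  exact (s1.add (hasSum_sum fun j _ => s2 j)).unique s3

theorem integral_transport_pressTerm (h : IsHolderFlow I u q M α N θ) {W ψ : Space n → ℝ}
    (hW : IsTest W) (hψ : IsTest ψ) (hψ1 : ∫ y, ψ y = 1) (hα : 1 / 2 < α) (hθ : 0 < θ)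
    {φ : SpaceTime n → ℝ} (hφ : ContDiff ℝ ∞ φ) (hc : HasCompactSupport φ)
    (hs : tsupport φ ⊆ slab n I) {s : ℝ} (hs0 : 0 < s) (l : Fin n) :
    (∫ z, fderiv ℝ φ z ((1 : ℝ), (0 : Space n)) * pressTerm W l s (fun y => u (z.1, y)) z.2) +
      ∑ j, ∫ z, fderiv ℝ φ z ((0 : ℝ), EuclideanSpace.single j (1 : ℝ)) *
        (u z j * pressTerm W l s (fun y => u (z.1, y)) z.2) =
      -∫ z, φ z * pressRate W l s (fun y => u (z.1, y)) (fun y => q (z.1, y)) z.2 := by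
  have hsm : ∀ t ∈ I, ContDiff ℝ ∞ fun x => pressTerm W l s (fun y => u (t, y)) x :=
    fun t ht => contDiff_pressTerm hW l hs0 fun i => h.continuous_slice_apply ht i
  have htr : ∀ t ∈ I, ∀ x, pressTimeRate W l s (fun y => u (t, y)) (fun y => q (t, y)) x +
      ∑ k, u (t, x) k * pd k (fun x => pressTerm W l s (fun y => u (t, y)) x) x =
      pressRate W l s (fun y => u (t, y)) (fun y => q (t, y)) x := fun t ht x =>
    pressTimeRate_add_transport hW l hs0 (fun i => h.continuous_slice_apply ht i)
      (fun i => h.continuous_force_slice_apply ht i) (h.div t ht) (h.poisson t ht) x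
  exact h.integral_transport
    (T := fun z => pressTerm W l s (fun y => u (z.1, y)) z.2)
    (H := fun z => pressTimeRate W l s (fun y => u (z.1, y)) (fun y => q (z.1, y)) z.2)
    (G := fun z => pressRate W l s (fun y => u (z.1, y)) (fun y => q (z.1, y)) z.2)
    (h.continuousOn_pressTerm hW l s)
    (h.continuousOn_pressTimeRate hW l s) (h.continuousOn_pressRate hW l s)
    (fun t ht x => h.hasDerivAt_pressTerm hα hθ hW hψ hψ1 hs0 l ht x) hsm htr hφ hc hs

/-- The material derivative of the pressure gradient is `forceRate`, in weak form. -/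
theorem integral_transport_gradPress (h : IsHolderFlow I u q M α N θ) {W ψ : Space n → ℝ}
    (hW : IsTest W) (hψ : IsTest ψ) (hψ1 : ∫ y, ψ y = 1) (hα : 2 / 3 < α) (hθ : 0 < θ)
    (hαθ : 1 < α + θ) {φ : SpaceTime n → ℝ} (hφ : ContDiff ℝ ∞ φ) (hc : HasCompactSupport φ)
    (hs : tsupport φ ⊆ slab n I) (l : Fin n) :
    (∫ z, fderiv ℝ φ z ((1 : ℝ), (0 : Space n)) * forceField W u z l) +
      ∑ j, ∫ z, fderiv ℝ φ z ((0 : ℝ), EuclideanSpace.single j (1 : ℝ)) *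
        (u z j * forceField W u z l) = -∫ z, φ z * forceRate W u q z l := by
  have hpos : ∀ k : ℤ, (0 : ℝ) < 2 ^ k := fun k => by positivity
  obtain ⟨C, hC0, hC⟩ := exists_abs_pressTerm_le hW (M := M) (show 0 < α by linarith)
  obtain ⟨D, hD0, hD⟩ := exists_abs_pressRate_le hW (M := M) (N := N)
    (show 0 ≤ α by linarith) hθ.le
  refine h.integral_transport_tsum
    (T := fun k z => pressTerm W l ((2 : ℝ) ^ k) (fun y => u (z.1, y)) z.2)
    (G := fun k z => pressRate W l ((2 : ℝ) ^ k) (fun y => u (z.1, y)) (fun y => q (z.1, y)) z.2)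
    (fun k => h.continuousOn_pressTerm hW l _)
    ((summable_scaleWeight (show 0 < 2 * α - 1 by linarith)).mul_left C)
    (fun k z hz => hC _ (h.continuous_slice hz.1) (h.holder z.1 hz.1) _ (hpos k) l
      (fun a => h.scaledDivFree hz.1 ((hW.pd l).pd a) (hpos k)) z.2)
    (fun k => h.continuousOn_pressRate hW l _)
    (((summable_scaleWeight (show 0 < 3 * α - 2 by linarith)).add
      (summable_scaleWeight (show 0 < α + θ - 1 by linarith))).mul_left D)
    (fun k z hz => hD _ _ (h.holder z.1 hz.1) (h.holder_force z.1 hz.1) _ (hpos k) l z.2)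
    hφ hc hs fun k => ?_
  exact h.integral_transport_pressTerm hW hψ hψ1 (by linarith) hθ hφ hc hs (hpos k) l

end IsHolderFlow

variable {I : Opens ℝ}

/-! ### Back to the distributions of the statement. -/

theorem timeHolderNorm_bounds {α : ℝ≥0} {v : SpaceTime n → Space n}
    (hv : timeHolderNorm I α v < ⊤) :
    ∃ M : ℝ, ∀ t ∈ I, (∀ x, ‖v (t, x)‖ ≤ M) ∧ ∀ i, HolderBound M α fun x => v (t, x) i := by
  have hne : timeHolderNorm I α v ≠ ⊤ := hv.ne
  refine ⟨(timeHolderNorm I α v).toReal, fun t ht => ?_⟩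
  have hle : holderNorm α (fun x => v (t, x)) ≤ timeHolderNorm I α v :=
    le_iSup₂ (f := fun t (_ : t ∈ I) => holderNorm α fun x => v (t, x)) t ht
  have hb : ∀ x, ‖v (t, x)‖ ≤ (timeHolderNorm I α v).toReal := fun x => by
    have h1 : ‖v (t, x)‖ₑ ≤ timeHolderNorm I α v :=
      ((le_iSup (fun x => ‖v (t, x)‖ₑ) x).trans le_self_add).trans hle
    simpa using ENNReal.toReal_mono hne h1
  have hh : eHolderNorm α (fun x => v (t, x)) ≤ timeHolderNorm I α v := le_add_self.trans hle
  have hmem : MemHolder α fun x => v (t, x) := eHolderNorm_lt_top.1 (hh.trans_lt hv)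
  have hd : ∀ x y, ‖v (t, x) - v (t, y)‖ ≤
      (timeHolderNorm I α v).toReal * ‖x - y‖ ^ (α : ℝ) := fun x y => by
    have h1 := hmem.holderWith.dist_le x y
    rw [dist_eq_norm, dist_eq_norm] at h1
    refine h1.trans (mul_le_mul_of_nonneg_right ?_ (by positivity))
    have := ENNReal.toReal_mono hne hh
    rwa [← hmem.coe_nnHolderNorm_eq_eHolderNorm] at this
  exact ⟨hb, fun i => ⟨fun x => (PiLp.norm_apply_le (v (t, x)) i).trans (hb x),
    fun x y => (PiLp.norm_apply_le (v (t, x) - v (t, y)) i).trans (hd x y)⟩⟩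

theorem locallyIntegrableOn_of_norm_le {F : Type*} [NormedAddCommGroup F] {f : SpaceTime n → F}
    (hf : AEStronglyMeasurable f (volume.restrict (slab n I))) {C : ℝ}
    (hC : ∀ z ∈ slab n I, ‖f z‖ ≤ C) : LocallyIntegrableOn f (slab n I) := by
  refine locallyIntegrableOn_of_locallyIntegrable_restrict
    ((locallyIntegrable_const C).mono hf ?_)
  refine (ae_restrict_iff' (slab n I).isOpen.measurableSet).2 (Eventually.of_forall fun z hz => ?_)
  exact (hC z hz).trans (le_abs_self C)

theorem hasIntegrableTerms_of_norm_le {v : SpaceTime n → Space n} {p : SpaceTime n → ℝ}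
    (hv : AEStronglyMeasurable v (volume.restrict (slab n I)))
    (hp : LocallyIntegrableOn p (slab n I)) {M : ℝ} (hM : ∀ z ∈ slab n I, ‖v z‖ ≤ M) :
    HasIntegrableTerms I v p := by
  have hvi : ∀ i, AEStronglyMeasurable (fun z => v z i) (volume.restrict (slab n I)) := fun i =>
    (EuclideanSpace.proj (𝕜 := ℝ) i).continuous.comp_aestronglyMeasurable hv
  have hMi : ∀ i, ∀ z ∈ slab n I, ‖v z i‖ ≤ M := fun i z hz =>
    (PiLp.norm_apply_le (v z) i).trans (hM z hz)
  refine ⟨locallyIntegrableOn_of_norm_le hv hM, fun i => locallyIntegrableOn_of_norm_le (hvi i)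
    (hMi i), fun i => locallyIntegrableOn_of_norm_le ((hvi i).smul hv) (C := M * M)
    fun z hz => ?_, fun i j => locallyIntegrableOn_of_norm_le ((hvi i).mul (hvi j)) (C := M * M)
    fun z hz => ?_, hp⟩
  · rw [norm_smul]
    exact mul_le_mul (hMi i z hz) (hM z hz) (norm_nonneg _) ((norm_nonneg _).trans (hM z hz))
  · rw [norm_mul]
    exact mul_le_mul (hMi i z hz) (hMi j z hz) (norm_nonneg _) ((norm_nonneg _).trans (hM z hz))

theorem integrable_smul_of_tsupport_subset {F : Type*} [NormedAddCommGroup F] [NormedSpace ℝ F]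
    {g : SpaceTime n → ℝ} (hg : Continuous g) (hc : HasCompactSupport g)
    (hs : tsupport g ⊆ slab n I) {f : SpaceTime n → F} (hf : LocallyIntegrableOn f (slab n I)) :
    Integrable fun z => g z • f z := by
  have h1 : IntegrableOn (fun z => g z • f z) (tsupport g) :=
    (hf.integrableOn_compact_subset hs hc.isCompact).continuousOn_smul hg.continuousOn hc.isCompact
  refine (integrableOn_iff_integrable_of_support_subset ?_).1 h1
  intro z hz
  exact subset_tsupport _ fun h0 => hz (by simp [h0])

theorem euclidean_integral_apply {X : Type*} [MeasurableSpace X] {μ : Measure X}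
    {f : X → Space n} (hf : Integrable f μ) (i : Fin n) : (∫ z, f z ∂μ) i = ∫ z, f z i ∂μ :=
  ((EuclideanSpace.proj i : Space n →L[ℝ] ℝ).integral_comp_comm hf).symm

theorem tsupport_test_subset (φ : 𝓓(slab n I, ℝ)) : tsupport φ ⊆ slab n I := φ.tsupport_subset'

theorem toDist_neg {F : Type*} [NormedAddCommGroup F] [NormedSpace ℝ F] {f : SpaceTime n → F}
    (hf : LocallyIntegrableOn f (slab n I)) : toDist I (-f) = -toDist I f := by
  ext φ
  rw [toDist_apply I _ hf.neg, _root_.neg_apply, toDist_apply I _ hf, ← integral_neg]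
  simp

theorem matDeriv_neg {F : Type*} [NormedAddCommGroup F] [NormedSpace ℝ F]
    {v : SpaceTime n → Space n} {f : SpaceTime n → F} (hf : LocallyIntegrableOn f (slab n I))
    (hvf : ∀ j, LocallyIntegrableOn (fun z => v z j • f z) (slab n I)) :
    matDeriv I v (-f) = -matDeriv I v f := by
  have hvf' : ∀ j, LocallyIntegrableOn (fun z => v z j • (-f) z) (slab n I) := fun j => by
    simp only [Pi.neg_apply, smul_neg]
    exact (hvf j).neg
  ext φ
  rw [matDeriv_apply hf.neg hvf', _root_.neg_apply, matDeriv_apply hf hvf]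
  simp only [Pi.neg_apply, smul_neg, integral_neg, Finset.sum_neg_distrib]
  abel

/-- Fubini reduces the identity to time slices; for almost every t the slice of φ is an admissible
test function in the weak formula for ∇p. -/
theorem IsEulerSolution.grad_toDist {v : SpaceTime n → Space n} {p : SpaceTime n → ℝ}
    (h : IsEulerSolution I v p) (hi : HasIntegrableTerms I v p) {W ψ : Space n → ℝ}
    (hW : IsDyadicPotential W ψ) (b : Module.Basis (Fin n) ℝ (Space n))
    (hper : IsPeriodic b I p) {M α : ℝ} (hα : 1 / 2 < α)
    (hvc : ∀ t ∈ I, Continuous fun x => v (t, x))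
    (hv : ∀ t ∈ I, ∀ i, HolderBound M α fun x => v (t, x) i) {u : SpaceTime n → Space n}
    (hvu : ∀ᵐ t, t ∈ I → ∀ x, v (t, x) = u (t, x))
    (hq : ContinuousOn (forceField W u) (slab n I)) :
    grad (toDist I p) = toDist I (forceField W u) := by
  have hql := hq.locallyIntegrableOn (μ := volume) (slab n I).isOpen.measurableSet
  ext φ i
  have hφ := φ.contDiff
  have hc := φ.hasCompactSupport
  have hs := tsupport_test_subset φ
  have i1 := integrable_smul_of_tsupport_subset hφ.continuous hc hs hql
  have i2 : Integrable fun z => fderiv ℝ φ z ((0 : ℝ), EuclideanSpace.single i (1 : ℝ)) * p z :=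
    integrable_smul_of_tsupport_subset (continuous_fderiv_apply hφ _) (hc.fderiv_apply ℝ _)
      ((tsupport_fderiv_apply_subset ℝ _).trans hs) hi.pressure
  have i3 : Integrable fun z => φ z * forceField W u z i :=
    (EuclideanSpace.proj i : Space n →L[ℝ] ℝ).integrable_comp i1
  rw [grad_apply hi.pressure, toDist_apply I _ hql, euclidean_integral_apply i1]
  simp only [PiLp.smul_apply, smul_eq_mul]
  rw [Measure.volume_eq_prod] at i2 i3 ⊢
  rw [integral_prod _ i2, integral_prod _ i3, ← integral_neg]
  refine integral_congr_ae ?_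
  filter_upwards [h.ae_integral_pd_mul_pressure hi hW b hper hα hvc hv, hvu] with t h1 h2
  by_cases ht : t ∈ I
  · have h3 := h1 ht _ (isTest_slice hφ hc t) i
    simp only [pd_slice hφ, h2 ht] at h3
    rw [h3, neg_neg]
    rfl
  · have hz : ∀ x, (t, x) ∉ tsupport φ := fun x hx => ht (hs hx).1
    have h0 : ∀ x, fderiv ℝ φ (t, x) = 0 := fun x => image_eq_zero_of_notMem_tsupport
      fun hx' => hz x (tsupport_fderiv_subset ℝ hx')
    simp [h0, image_eq_zero_of_notMem_tsupport (hz _)]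

/-- The fields v and u agree almost everywhere in space-time on the slab, so v may be exchanged for
u under the integrals; what remains is the weak transport identity, component by component. -/
theorem IsHolderFlow.matDeriv_forceField {u : SpaceTime n → Space n} {W ψ : Space n → ℝ}
    {M α N θ : ℝ} (h : IsHolderFlow I u (forceField W u) M α N θ) (hW : IsTest W)
    (hψ : IsTest ψ) (hψ1 : ∫ y, ψ y = 1) (hα : 2 / 3 < α) (hθ : 0 < θ) (hαθ : 1 < α + θ)
    {v : SpaceTime n → Space n} (hvu : ∀ᵐ t, t ∈ I → ∀ x, v (t, x) = u (t, x))
    (hvq : ∀ j, LocallyIntegrableOn (fun z => v z j • forceField W u z) (slab n I)) :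
    matDeriv I v (forceField W u) = toDist I (forceRate W u (forceField W u)) := by
  have hql := h.continuousOn_force.locallyIntegrableOn (μ := volume)
    (slab n I).isOpen.measurableSet
  have hgl := (h.continuousOn_forceRate hW hα hθ hαθ).locallyIntegrableOn (μ := volume)
    (slab n I).isOpen.measurableSet
  have hae : ∀ᵐ z : SpaceTime n, z ∈ slab n I → v z = u z := by
    rw [Measure.volume_eq_prod]
    filter_upwards [Measure.quasiMeasurePreserving_fst.ae hvu] with z hz hzI
    exact hz hzI.1 z.2
  ext φ l
  have hφ := φ.contDiff
  have hc := φ.hasCompactSupport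
  have hs := tsupport_test_subset φ
  have hds : ∀ w : SpaceTime n, tsupport (fun z => fderiv ℝ φ z w) ⊆ slab n I := fun w =>
    (tsupport_fderiv_apply_subset ℝ w).trans hs
  have hint : ∀ (w : SpaceTime n) {f : SpaceTime n → Space n}, LocallyIntegrableOn f (slab n I) →
      Integrable fun z => fderiv ℝ φ z w • f z := fun w f hf =>
    integrable_smul_of_tsupport_subset (continuous_fderiv_apply hφ _) (hc.fderiv_apply ℝ _)
      (hds w) hf
  rw [matDeriv_apply hql hvq, toDist_apply I _ hgl, euclidean_integral_apply
    (integrable_smul_of_tsupport_subset hφ.continuous hc hs hgl)]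
  simp only [PiLp.sub_apply, PiLp.neg_apply, WithLp.ofLp_sum, Finset.sum_apply]
  rw [euclidean_integral_apply (hint _ hql),
    Finset.sum_congr rfl fun j _ => euclidean_integral_apply (hint _ (hvq j)) l]
  simp only [PiLp.smul_apply, smul_eq_mul]
  have key := h.integral_transport_gradPress hW hψ hψ1 hα hθ hαθ hφ hc hs l
  have e : ∀ j, ∫ z, fderiv ℝ φ z ((0 : ℝ), EuclideanSpace.single j (1 : ℝ)) *
      (v z j * forceField W u z l) =
      ∫ z, fderiv ℝ φ z ((0 : ℝ), EuclideanSpace.single j (1 : ℝ)) *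
        (u z j * forceField W u z l) := by
    intro j
    refine integral_congr_ae ?_
    filter_upwards [hae] with z hz
    by_cases hzI : z ∈ slab n I
    · rw [hz hzI]
    · have h0 : fderiv ℝ φ z = 0 := image_eq_zero_of_notMem_tsupport
        fun hx' => hzI (hs (tsupport_fderiv_subset ℝ hx'))
      simp [h0]
  simp only [e]
  linarith

theorem dist_eq_of_isEmpty {F : Type*} [NormedAddCommGroup F] [NormedSpace ℝ F]
    (hI : (I : Set ℝ) = ∅) (S T : 𝓓'(slab n I, F)) : S = T := by
  ext φ
  have : φ = 0 := by
    ext z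
    refine image_eq_zero_of_notMem_tsupport fun hz => ?_
    have := (tsupport_test_subset φ hz).1
    rw [hI] at this
    exact this
  rw [this, map_zero, map_zero]

end Development

end EulerFlow

end

theorem theorem1p2 (n : ℕ) (hn : 2 ≤ n) (b : Module.Basis (Fin n) ℝ (EulerFlow.Space n))
    (I : Opens ℝ) (hI : (I : Set ℝ).OrdConnected)
    (α : ℝ≥0) (hα : 2 / 3 < α) (hα1 : α < 1)
    (v : EulerFlow.SpaceTime n → EulerFlow.Space n) (p : EulerFlow.SpaceTime n → ℝ)
    (hv_per : EulerFlow.IsPeriodic b I v) (hp_per : EulerFlow.IsPeriodic b I p)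
    (hv_meas : AEStronglyMeasurable v (volume.restrict (EulerFlow.slab n I)))
    (hp_int : LocallyIntegrableOn p (EulerFlow.slab n I))
    (hv_holder : EulerFlow.timeHolderNorm I α v < ∞)
    (hp_norm : ∀ᵐ t ∂(volume.restrict (I : Set ℝ)),
      ∫ x in ZSpan.fundamentalDomain b, p (t, x) = 0)
    (h_euler : EulerFlow.IsEulerSolution I v p) :
    -- the distribution `∇ p` is a continuous function `q`, and `D_t v = - ∇ p`
    ∃ q : EulerFlow.SpaceTime n → EulerFlow.Space n,
      ContinuousOn q (EulerFlow.slab n I) ∧ EulerFlow.IsPeriodic b I q ∧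
      EulerFlow.grad (EulerFlow.toDist I p) = EulerFlow.toDist I q ∧
      EulerFlow.matDeriv I v v = EulerFlow.toDist I (-q) ∧
      -- the distribution `D_t ∇ p = - D_t² v` is a continuous function `g`
      ∃ g : EulerFlow.SpaceTime n → EulerFlow.Space n,
        ContinuousOn g (EulerFlow.slab n I) ∧ EulerFlow.IsPeriodic b I g ∧
        EulerFlow.matDeriv I v q = EulerFlow.toDist I g ∧
        EulerFlow.matDeriv I v (-q) = EulerFlow.toDist I (-g) := by
  -- A base time in `I` is needed for the primitives in time; for empty `I` the only test function
  -- is zero and all distributions coincide.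
  rcases (I : Set ℝ).eq_empty_or_nonempty with hE | ⟨t₀, ht₀⟩
  · have hmem : ∀ t, t ∉ I := fun t ht => by
      have : t ∈ (I : Set ℝ) := ht
      simp [hE] at this
    have hsl : (EulerFlow.slab n I : Set (EulerFlow.SpaceTime n)) = ∅ :=
      Set.eq_empty_of_forall_notMem fun z hz => hmem z.1 hz.1
    exact ⟨0, by simp [hsl], fun t ht => absurd ht (hmem t), EulerFlow.dist_eq_of_isEmpty hE _ _,
      EulerFlow.dist_eq_of_isEmpty hE _ _, 0, by simp [hsl], fun t ht => absurd ht (hmem t),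
      EulerFlow.dist_eq_of_isEmpty hE _ _, EulerFlow.dist_eq_of_isEmpty hE _ _⟩
  have hα' : 2 / 3 < (α : ℝ) := by
    have := NNReal.coe_lt_coe.2 hα
    simpa using this
  have hα1' : (α : ℝ) < 1 := by exact_mod_cast hα1
  obtain ⟨W, ψ, hW⟩ := EulerFlow.exists_dyadicPotential (n := n) (by omega)
  obtain ⟨M, hM⟩ := EulerFlow.timeHolderNorm_bounds hv_holder
  have hv : ∀ t ∈ I, ∀ i, EulerFlow.HolderBound M α fun x => v (t, x) i := fun t ht => (hM t ht).2
  have hvc : ∀ t ∈ I, Continuous fun x => v (t, x) := fun t ht =>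
    (PiLp.continuous_toLp 2 _).comp
      (continuous_pi fun i => (hv t ht i).continuous (by linarith))
  have hi := EulerFlow.hasIntegrableTerms_of_norm_le hv_meas hp_int
    fun z hz => (hM z.1 hz.1).1 z.2
  obtain ⟨u, huc, hu, hu_per, hvu⟩ := h_euler.exists_continuous_version hI hi hW b hp_per hv_per
    (by linarith) hα1' hvc hv ht₀
  -- With θ = α/2 the two requirements θ < 2α − 1 and α + θ > 1 are each equivalent to α > 2/3.
  obtain ⟨N, hflow⟩ := h_euler.isHolderFlow hI hi hW b hp_per (by linarith) hα1' hvc hv huc hu hvu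
    (θ := α / 2) (by linarith) (by linarith) ht₀
  have hslm := (EulerFlow.slab n I).isOpen.measurableSet
  have hq := hflow.continuousOn_force
  have hql := hq.locallyIntegrableOn (μ := volume) hslm
  have hvq : ∀ j, LocallyIntegrableOn (fun z => v z j • EulerFlow.forceField W u z)
      (EulerFlow.slab n I) := fun j =>
    LocallyIntegrableOn.smul_continuousOn (EulerFlow.slab n I).isOpen.isLocallyClosed
      (hi.component j) hq
  have hg := hflow.continuousOn_forceRate hW.test hα' (by linarith) (by linarith)
  have hgrad := h_euler.grad_toDist hi hW b hp_per (by linarith) hvc hv hvu hq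
  have hmat := hflow.matDeriv_forceField hW.test hW.test_mean hW.integral_mean hα' (by linarith)
    (by linarith) hvu hvq
  have hq_per := EulerFlow.isPeriodic_forceField (W := W) hu_per
  refine ⟨EulerFlow.forceField W u, hq, hq_per, hgrad, ?_,
    EulerFlow.forceRate W u (EulerFlow.forceField W u), hg,
    EulerFlow.isPeriodic_forceRate hu_per hq_per, hmat, ?_⟩
  · rw [EulerFlow.toDist_neg hql, ← hgrad]
    exact eq_neg_of_add_eq_zero_left h_euler.momentum
  · rw [EulerFlow.matDeriv_neg hql hvq, hmat,
      EulerFlow.toDist_neg (hg.locallyIntegrableOn (μ := volume) hslm)]
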